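/- Let $1<\alpha<2$, $0\le r\le 1$, and let $\beta\in[\alpha-1,1]$ satisfy $r=\dfrac{\sin(\pi\beta)}{\sin(\pi(\alpha-\beta))+\sin(\pi\beta)}$. Let $0<K_m\le K_M$ and $s\in\{0,1,2,\dots\}$. For real $a,b$ put $\omega^{(a,b)}(x)=(1-x)^a x^b$ on $(0,1)$, $(g,h)_{\omega}=\int_0^1\omega gh\,dx$, $\|g\|_\omega=(g,g)_\omega^{1/2}$, and $\|g\|_{m,\omega^{(a,b)}}^2=\sum_{j=0}^m\|D^jg\|^2_{\omega^{(a+j,b+j)}}$ with weak derivatives $D^j$; $H^m_{\omega^{(a,b)}}$ is the space of functions for which this norm is finite. Let $\|g\|_{W^m_\infty}=\max_{j\le m}\|D^jg\|_{L^\infty(0,1)}$. Let $P_n^{(a,b)}(y)=2^{-n}\sum_{m=0}^n\binom{n+a}{m}\binom{n+b}{n-m}(y-1)^{n-m}(y+1)^m$ be the Jacobi polynomials and $G_n^{(a,b)}(t)=P_n^{(a,b)}(2t-1)$. For functions $K,f$ on $(0,1)$ with $K_m\le K\le K_M$, put $f_1(x)=\frac1{K(x)}\int_0^xf(y)\,dy$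 and $f_2(x)=\frac1{K(x)}$. Consider the problem $$-\big(r\,{}_0I_x^{2-\alpha}+(1-r)\,{}_xI_1^{2-\alpha}\big)Du(x)=f_1(x)-A f_2(x)\quad\text{for a.e. }x\in(0,1),\qquad u(0)=u(1)=0,$$ $$A=K(0)\big[\big(r\,{}_0I_x^{2-\alpha}+(1-r)\,{}_xI_1^{2-\alpha}\big)Du\big]\big|_{x=0},$$ where ${}_0I_x^{\sigma}w(x)=\frac1{\Gamma(\sigma)}\int_0^xw(y)(x-y)^{\sigma-1}dy$ and ${}_xI_1^{\sigma}w(x)=\frac1{\Gamma(\sigma)}\int_x^1w(y)(y-x)^{\sigma-1}dy$. A solution is an absolutely continuous function $u$ on $[0,1]$ with $\|u\|_{\omega^{(-(\alpha-\beta),-\beta)}}<\infty$ that satisfies these equations, where the value at $x=0$ in the formula for $A$ is that of the representative of $K\,(r\,{}_0I_x^{2-\alpha}+(1-r)\,{}_xI_1^{2-\alpha})Du$ that is continuous on $[0,1)$. For $N\ge0$ the spectral approximation is $u_N=\omega^{(\alpha-\beta,\beta)}\sum_{i=0}^{N}c_i\,G_i^{(\alpha-\beta,\beta)}$, where $$c_i=\frac{-f_{1,i+1}+A_*\,f_{2,i+1}}{\lambda_i},\qquad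 \lambda_i=\frac{\sin(\pi\alpha)}{\sin(\pi(\alpha-\beta))+\sin(\pi\beta)}\,\frac{\Gamma(i+\alpha)}{i!},$$ $$f_{k,j}=\frac{(f_k,G_j^{(\beta-1,\alpha-\beta-1)})_{\rho}}{\|G_j^{(\beta-1,\alpha-\beta-1)}\|^2_{\rho}},\qquad A_*=\frac{(f_1,1)_{\rho}}{(1/K,1)_{\rho}},\qquad \rho=\omega^{(\beta-1,\alpha-\beta-1)}.$$ Then there is a constant $C>0$, depending only on $\alpha,\beta,r,s,K_m,K_M$, such that for all $K$ with $K_m\le K\le K_M$ on $(0,1)$ and $1/K\in W^{s+1}_\infty(0,1)$, and all $f\in H^s_{\omega^{(\beta,\alpha-\beta)}}(0,1)$ that are integrable on $(0,x)$ for every $x\in(0,1)$, the problem has a solution, and every solution $u$ satisfies, for all $N\ge0$, $$\|u-u_N\|_{L^2(0,1)}\le\frac{C\,\|1/K\|_{W^{s+1}_\infty}}{(N+1)^{\alpha+s}}\Big(\|f\|_{s,\omega^{(\beta,\alpha-\beta)}}+1\Big).$$ -/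

import Mathlib

open MeasureTheory Set Filter Topology
open scoped ENNReal ContDiff

noncomputable section

namespace FracDiff

/-- Lebesgue measure on the unit interval `I = (0,1)`. -/
def volI : Measure ℝ := volume.restrict (Ioo (0 : ℝ) 1)

/-- The Jacobi weight `ω^{(a,b)}(x) = (1 - x)^a x^b` on `(0,1)`. -/
def weight (a b x : ℝ) : ℝ := (1 - x) ^ a * x ^ b

/-- The measure `ω^{(a,b)}(x) dx` on `(0,1)`; then `L²_ω` is `MemLp · 2 (weightMeasure a b)`. -/
def weightMeasure (a b : ℝ) : Measure ℝ :=
  volI.withDensity fun x => ENNReal.ofReal (weight a b x)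

/-- The weighted inner product `(f, g)_ω = ∫₀¹ ω f g dx`, `ω = ω^{(a,b)}`. -/
def wInner (a b : ℝ) (f g : ℝ → ℝ) : ℝ := ∫ x, f x * g x ∂(weightMeasure a b)

/-- The weighted norm `‖f‖_ω`, `ω = ω^{(a,b)}`. -/
def wNorm (a b : ℝ) (f : ℝ → ℝ) : ℝ := (eLpNorm f 2 (weightMeasure a b)).toReal

/-- `g` is the weak derivative of order `j` of `v` on `(0,1)`. -/
def HasWeakDeriv (j : ℕ) (v g : ℝ → ℝ) : Prop :=
  LocallyIntegrableOn v (Ioo 0 1) ∧ LocallyIntegrableOn g (Ioo 0 1) ∧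
    ∀ φ : ℝ → ℝ, ContDiff ℝ ∞ φ → HasCompactSupport φ → tsupport φ ⊆ Ioo 0 1 →
      ∫ x in Ioo (0 : ℝ) 1, v x * iteratedDeriv j φ x =
        (-1) ^ j * ∫ x in Ioo (0 : ℝ) 1, g x * φ x

open Classical in
/-- The weak derivative `D^j v` on `(0,1)` (unique a.e. where it exists; `0` otherwise). -/
def weakDeriv (j : ℕ) (v : ℝ → ℝ) : ℝ → ℝ :=
  if h : ∃ g, HasWeakDeriv j v g then h.choose else 0

/-- `v ∈ H^m_{ω^{(a,b)}}(0,1)`: for all `j ≤ m`, `D^j v` exists and lies in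
`L²` with weight `ω^{(a+j,b+j)}`. -/
def MemH (m : ℕ) (a b : ℝ) (v : ℝ → ℝ) : Prop :=
  ∀ j ≤ m, ∃ g, HasWeakDeriv j v g ∧ MemLp g 2 (weightMeasure (a + j) (b + j))

/-- The norm `‖v‖_{m, ω^{(a,b)}}`. -/
def hNorm (m : ℕ) (a b : ℝ) (v : ℝ → ℝ) : ℝ :=
  √(∑ j ∈ Finset.range (m + 1), wNorm (a + j) (b + j) (weakDeriv j v) ^ 2)

/-- `v ∈ W^m_∞(0,1)`. -/
def MemWInf (m : ℕ) (v : ℝ → ℝ) : Prop :=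
  ∀ j ≤ m, ∃ g, HasWeakDeriv j v g ∧ MemLp g ∞ volI

/-- The norm `‖v‖_{W^m_∞(0,1)} = max_{j ≤ m} ‖D^j v‖_{L^∞}`. -/
def wInfNorm (m : ℕ) (v : ℝ → ℝ) : ℝ :=
  ((Finset.range (m + 1)).sup fun j => eLpNorm (weakDeriv j v) ∞ volI).toReal

/-- The left fractional integral `₀I_x^σ w`. -/
def leftFracInt (σ : ℝ) (w : ℝ → ℝ) (x : ℝ) : ℝ :=
  1 / Real.Gamma σ * ∫ s in (0 : ℝ)..x, w s * (x - s) ^ (σ - 1)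

/-- The right fractional integral `ₓI_1^σ w`. -/
def rightFracInt (σ : ℝ) (w : ℝ → ℝ) (x : ℝ) : ℝ :=
  1 / Real.Gamma σ * ∫ s in x..(1 : ℝ), w s * (s - x) ^ (σ - 1)

/-- `(r ₀I_x^{2-α} + (1-r) ₓI_1^{2-α}) Du`. -/
def fracFlux (α r : ℝ) (u : ℝ → ℝ) (x : ℝ) : ℝ :=
  r * leftFracInt (2 - α) (deriv u) x + (1 - r) * rightFracInt (2 - α) (deriv u) x

/-- `L_r^α u = -(r ₀I_x^{2-α} + (1-r) ₓI_1^{2-α}) Du`. -/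
def Lop (α r : ℝ) (u : ℝ → ℝ) (x : ℝ) : ℝ := -fracFlux α r u x

/-- `f₁(x) = (1/K(x)) ∫₀ˣ f(y) dy`. -/
def f₁ (K f : ℝ → ℝ) (x : ℝ) : ℝ := 1 / K x * ∫ y in (0 : ℝ)..x, f y

/-- `f₂(x) = 1/K(x)`. -/
def f₂ (K : ℝ → ℝ) (x : ℝ) : ℝ := 1 / K x

/-- `u` solves `L_r^α u = f₁ - A f₂` on `(0,1)`, `u(0) = u(1) = 0`, in the class
`L²_{ω^{(-(α-β),-β)}}`, where `A = K(0) [(r ₀I_x^{2-α} + (1-r) ₓI_1^{2-α}) Du]|_{x=0}`.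
The function `u` is absolutely continuous on `[0,1]`, so `Du ∈ L¹(0,1)` and the fractional
integrals of `Du` exist almost everywhere.  As they are defined only almost everywhere, the value
of `K (r ₀I_x^{2-α} + (1-r) ₓI_1^{2-α}) Du` at `0` is that of its continuous representative `p`. -/
structure IsSolution (α β r : ℝ) (K f u : ℝ → ℝ) : Prop where
  absCont : AbsolutelyContinuousOnInterval u 0 1
  left_bc : u 0 = 0
  right_bc : u 1 = 0
  memLp : MemLp u 2 (weightMeasure (-(α - β)) (-β))
  equation : ∃ p : ℝ → ℝ, ContinuousOn p (Ico 0 1) ∧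
    (∀ᵐ x ∂volI, p x = K x * fracFlux α r u x) ∧
    (∀ᵐ x ∂volI, Lop α r u x = f₁ K f x - p 0 * f₂ K x)

/-- The Jacobi polynomial `P_n^{(a,b)}`; `Ring.choose` is the generalized binomial coefficient
`z (z-1) ⋯ (z-m+1) / m!`. -/
def jacobiP (n : ℕ) (a b x : ℝ) : ℝ :=
  ∑ m ∈ Finset.range (n + 1),
    1 / 2 ^ n * Ring.choose ((n : ℝ) + a) m * Ring.choose ((n : ℝ) + b) (n - m) *
      (x - 1) ^ (n - m) * (x + 1) ^ m

/-- The shifted Jacobi polynomial `G_n^{(a,b)}(t) = P_n^{(a,b)}(2t - 1)`. -/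
def jacobiG (n : ℕ) (a b t : ℝ) : ℝ := jacobiP n a b (2 * t - 1)

/-- The numbers `λ_n`. -/
def lam (α β : ℝ) (n : ℕ) : ℝ :=
  Real.sin (Real.pi * α) / (Real.sin (Real.pi * (α - β)) + Real.sin (Real.pi * β)) *
    (Real.Gamma (n + α) / n.factorial)

/-- The expansion coefficient of `g` with respect to `G_j^{(β-1, α-β-1)}`. -/
def jacobiCoeff (α β : ℝ) (g : ℝ → ℝ) (j : ℕ) : ℝ :=
  wInner (β - 1) (α - β - 1) g (jacobiG j (β - 1) (α - β - 1)) /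
    wNorm (β - 1) (α - β - 1) (jacobiG j (β - 1) (α - β - 1)) ^ 2

/-- The constant `A = (f₁, 1)_ω / (1/K, 1)_ω`, `ω = ω^{(β-1, α-β-1)}`. -/
def constA (α β : ℝ) (K f : ℝ → ℝ) : ℝ :=
  wInner (β - 1) (α - β - 1) (f₁ K f) (fun _ => 1) /
    wInner (β - 1) (α - β - 1) (fun x => 1 / K x) (fun _ => 1)

/-- `c_j = (-f_{1,j+1} + A f_{2,j+1}) / λ_j`. -/
def coeffC (α β : ℝ) (K f : ℝ → ℝ) (j : ℕ) : ℝ :=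
  (-jacobiCoeff α β (f₁ K f) (j + 1) + constA α β K f * jacobiCoeff α β (f₂ K) (j + 1)) /
    lam α β j

/-- The spectral approximation
`u_N = ω^{(α-β,β)} ∑_{i=0}^{N} c_i G_i^{(α-β,β)}`. -/
def uN (α β : ℝ) (K f : ℝ → ℝ) (N : ℕ) (x : ℝ) : ℝ :=
  weight (α - β) β x *
    ∑ i ∈ Finset.range (N + 1), coeffC α β K f i * jacobiG i (α - β) β x

end FracDiff

end

/-! Write a = α-β, b = β. Everything rests on one spectral fact: the adjoint of the two-sided
fractional integral, applied to ω^{(b-1,a-1)} times a polynomial, returns a polynomial of no larger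
degree. For the constant polynomial this comes from beta integrals, and the relation between r and β
is exactly what makes the left and right contributions add up to a constant
(`lintegral_fluxKernel`). Higher monomials follow from a three-term recurrence
(`fluxOp_recurrence`). Comparing leading coefficients and using symmetry, the operator sends the
n-th Jacobi polynomial for (b-1,a-1) to `fluxEig` times the one for (a-1,b-1) (`fluxOp_jacPoly`).

Testing the equation against these polynomials and integrating by parts turns it into scalar
relations. The relation for n = 0 says that the right-hand side has weighted mean zero, which forces
A = A_*. The relation for n = i+1 says that the i-th Jacobi coefficient of ω^{(-a,-b)}u is c_i
(`IsSolution.moments`). So u_N is the truncated Jacobi expansion of any solution, and Parseval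
expresses the weighted error as a tail sum.

The tail gains the power α-1 from the growth of |λ_i| (`exists_le_mul_fluxEig`) and the power s+1
from the regularity of f₁ - A f₂ = (1/K)(∫₀ˣ f - A). Each derivative raises both weight exponents by
one and gains a factor n on Jacobi coefficients (`jacEnergy_succ_le`). The derivatives are bounded
by Leibniz' rule; a Poincaré inequality and the mean-zero condition bound the undifferentiated
primitive by f (`integral_primitive_sq_le`). Since ω^{(a,b)} ≤ 1, the weighted error dominates the
L² error.

For existence, Riesz–Fischer produces a function with the moments that u' must have. Completeness of
the Jacobi polynomials then gives the equation. -/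

noncomputable section

open Polynomial

namespace FracDiff

/-! ### Algebra of shifted Jacobi polynomials. -/

section

/-- The shifted Jacobi polynomial `G_n^{(a,b)}` as a polynomial. -/
def jacPoly (n : ℕ) (a b : ℝ) : ℝ[X] :=
  ∑ m ∈ Finset.range (n + 1),
    C (Ring.choose ((n : ℝ) + a) m * Ring.choose ((n : ℝ) + b) (n - m)) *
      ((X - 1) ^ (n - m) * X ^ m)

theorem jacobiG_eq_eval (n : ℕ) (a b t : ℝ) : jacobiG n a b t = (jacPoly n a b).eval t := by
  simp only [jacobiG, jacobiP, jacPoly, eval_finsetSum]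
  refine Finset.sum_congr rfl fun m hm => ?_
  have hm' : m ≤ n := by simpa [Nat.lt_succ_iff] using hm
  simp only [eval_mul, eval_C, eval_pow, eval_sub, eval_X, eval_one]
  have h1 : (2 * t - 1 - 1) = 2 * (t - 1) := by ring
  have h2 : (2 * t - 1 + 1) = 2 * t := by ring
  rw [h1, h2, mul_pow, mul_pow]
  have h3 : (2 : ℝ) ^ n = 2 ^ (n - m) * 2 ^ m := by rw [← pow_add]; congr 1; omega
  rw [h3]
  field_simp

/-- This recurrence is the only fact about generalized binomials behind the raising and lowering
relations. -/
theorem ringChoose_succ_mul (z : ℝ) (k : ℕ) :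
    ((k : ℝ) + 1) * Ring.choose z (k + 1) = (z - k) * Ring.choose z k := by
  have h := Ring.choose_smul_choose z (n := k + 1) (k := k) (by omega)
  simp only [Nat.choose_succ_self_right, Nat.add_sub_cancel_left, Ring.choose_one_right,
    nsmul_eq_mul] at h
  push_cast at h
  rw [h]; ring

/-- The first-order operator `q ↦ ω^{(-a,-b)} D (ω^{(a+1,b+1)} q)` on polynomials. -/
def rod (a b : ℝ) (q : ℝ[X]) : ℝ[X] :=
  X * (1 - X) * derivative q + (C (b + 1) * (1 - X) - C (a + 1) * X) * q

/-- Rodrigues' relation, checked on coefficients of (X-1)^(n+1-m) X^m. Each summand of the left side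
spreads over two neighbouring indices; after a shift, index m receives -m and -(n+1-m) times the
same coefficient, in total -(n+1). -/
theorem rod_jacPoly (n : ℕ) (a b : ℝ) :
    rod a b (jacPoly n (a + 1) (b + 1)) = -C ((n : ℝ) + 1) * jacPoly (n + 1) a b := by
  set d : ℕ → ℝ := fun m => Ring.choose ((n : ℝ) + 1 + a) m * Ring.choose ((n : ℝ) + 1 + b) (n + 1 - m)
    with hd
  have hR : jacPoly (n + 1) a b = ∑ m ∈ Finset.range (n + 2), C (d m) * ((X - 1) ^ (n + 1 - m) * X ^ m) := by
    simp [jacPoly, hd]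
  have hL : rod a b (jacPoly n (a + 1) (b + 1)) = ∑ m ∈ Finset.range (n + 1),
      (C (-((m : ℝ) + 1) * d (m + 1)) * ((X - 1) ^ (n + 1 - (m + 1)) * X ^ (m + 1)) +
        C (-((n : ℝ) + 1 - m) * d m) * ((X - 1) ^ (n + 1 - m) * X ^ m)) := by
    simp only [rod, jacPoly, derivative_sum, Finset.mul_sum, ← Finset.sum_add_distrib]
    refine Finset.sum_congr rfl fun m hm => ?_
    have hm' : m ≤ n := by simpa [Nat.lt_succ_iff] using hm
    obtain ⟨k, rfl⟩ := Nat.exists_eq_add_of_le hm'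
    have e1 : m + k - m = k := by omega
    have e2 : m + k + 1 - (m + 1) = k := by omega
    have e3 : m + k + 1 - m = k + 1 := by omega
    have h1 : -((m : ℝ) + 1) * d (m + 1) = -((k : ℝ) + 1 + a) *
        (Ring.choose (((m + k : ℕ) : ℝ) + (a + 1)) m * Ring.choose (((m + k : ℕ) : ℝ) + (b + 1)) k) := by
      have := ringChoose_succ_mul (((m + k : ℕ) : ℝ) + 1 + a) m
      simp only [hd, e2]
      rw [show (((m + k : ℕ) : ℝ) + (a + 1)) = ((m + k : ℕ) : ℝ) + 1 + a by ring,
        show (((m + k : ℕ) : ℝ) + (b + 1)) = ((m + k : ℕ) : ℝ) + 1 + b by ring]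
      push_cast at this ⊢
      linear_combination (-Ring.choose ((m : ℝ) + k + 1 + b) k) * this
    have h2 : -(((m + k : ℕ) : ℝ) + 1 - m) * d m = -((m : ℝ) + 1 + b) *
        (Ring.choose (((m + k : ℕ) : ℝ) + (a + 1)) m * Ring.choose (((m + k : ℕ) : ℝ) + (b + 1)) k) := by
      have := ringChoose_succ_mul (((m + k : ℕ) : ℝ) + 1 + b) k
      simp only [hd, e3]
      rw [show (((m + k : ℕ) : ℝ) + (a + 1)) = ((m + k : ℕ) : ℝ) + 1 + a by ring,
        show (((m + k : ℕ) : ℝ) + (b + 1)) = ((m + k : ℕ) : ℝ) + 1 + b by ring]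
      push_cast at this ⊢
      linear_combination (-Ring.choose ((m : ℝ) + k + 1 + a) m) * this
    rw [h1, h2, e1, e2, e3]
    simp only [derivative_mul, derivative_C, derivative_pow, derivative_sub,
      derivative_X, derivative_one, C_mul, C_add, C_neg, C_1, map_natCast]
    -- Differentiation produces the truncated exponents k-1 and m-1; the case split removes them so
    -- that `ring` applies.
    rcases k with _ | k <;> rcases m with _ | m <;>
    · try simp only [Nat.add_sub_cancel]
      push_cast
      ring
  rw [hL, hR, Finset.sum_add_distrib]
  -- Both sums extend to the common range because the added terms, m = 0 here and m = n+1 below,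
  -- have coefficient zero.
  have hS1 : ∑ m ∈ Finset.range (n + 1),
      C (-((m : ℝ) + 1) * d (m + 1)) * ((X - 1) ^ (n + 1 - (m + 1)) * X ^ (m + 1)) =
      ∑ m ∈ Finset.range (n + 2), C (-(m : ℝ) * d m) * ((X - 1 : ℝ[X]) ^ (n + 1 - m) * X ^ m) := by
    rw [Finset.sum_range_succ' _ (n + 1)]
    simp
  have hS2 : ∑ m ∈ Finset.range (n + 1),
      C (-((n : ℝ) + 1 - m) * d m) * ((X - 1) ^ (n + 1 - m) * X ^ m) =
      ∑ m ∈ Finset.range (n + 2),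
        C (-((n : ℝ) + 1 - m) * d m) * ((X - 1 : ℝ[X]) ^ (n + 1 - m) * X ^ m) := by
    rw [Finset.sum_range_succ _ (n + 1)]
    simp
  rw [hS1, hS2, ← Finset.sum_add_distrib, Finset.mul_sum]
  refine Finset.sum_congr rfl fun m _ => ?_
  rw [← add_mul, ← C_add, ← C_neg, ← mul_assoc (C _) (C _), ← C_mul]
  congr 2
  ring

/-- With k = n-m, the two contributions to (X-1)^k X^m carry the factors k+1+a and m+1+b, whose sum
n+a+b+2 no longer depends on m. -/
theorem derivative_jacPoly (n : ℕ) (a b : ℝ) :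
    derivative (jacPoly (n + 1) a b) = C ((n : ℝ) + a + b + 2) * jacPoly n (a + 1) (b + 1) := by
  set d : ℕ → ℝ := fun m => Ring.choose ((n : ℝ) + 1 + a) m * Ring.choose ((n : ℝ) + 1 + b) (n + 1 - m)
    with hd
  have hR : jacPoly (n + 1) a b = ∑ m ∈ Finset.range (n + 2), C (d m) * ((X - 1) ^ (n + 1 - m) * X ^ m) := by
    simp [jacPoly, hd]
  have hD : derivative (jacPoly (n + 1) a b) =
      ∑ m ∈ Finset.range (n + 2), C (((n : ℝ) + 1 - m) * d m) * ((X - 1 : ℝ[X]) ^ (n - m) * X ^ m) +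
      ∑ m ∈ Finset.range (n + 2), C ((m : ℝ) * d m) * ((X - 1 : ℝ[X]) ^ (n + 1 - m) * X ^ (m - 1)) := by
    rw [hR, derivative_sum, ← Finset.sum_add_distrib]
    refine Finset.sum_congr rfl fun m hm => ?_
    have hm' : m ≤ n + 1 := by simpa [Nat.lt_succ_iff] using hm
    have e : n + 1 - m - 1 = n - m := by omega
    simp only [derivative_mul, derivative_C, derivative_pow, derivative_sub,
      derivative_X, derivative_one, C_mul, C_add, C_1, C_sub, map_natCast, e]
    push_cast [Nat.cast_sub hm']
    ring
  rw [hD, Finset.sum_range_succ _ (n + 1), Finset.sum_range_succ' _ (n + 1)]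
  simp only [Nat.cast_add, Nat.cast_one, sub_self, zero_mul, C_0, add_zero, Nat.cast_zero]
  rw [← Finset.sum_add_distrib, jacPoly, Finset.mul_sum]
  refine Finset.sum_congr rfl fun m hm => ?_
  have hm' : m ≤ n := by simpa [Nat.lt_succ_iff] using hm
  obtain ⟨k, rfl⟩ := Nat.exists_eq_add_of_le hm'
  have e1 : m + k - m = k := by omega
  have e2 : m + k + 1 - (m + 1) = k := by omega
  have e3 : m + k + 1 - m = k + 1 := by omega
  rw [e1, e2, Nat.add_sub_cancel, ← add_mul, ← C_add, ← mul_assoc (C _) (C _), ← C_mul]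
  congr 2
  simp only [hd, e2, e3]
  rw [show (((m + k : ℕ) : ℝ) + (a + 1)) = ((m + k : ℕ) : ℝ) + 1 + a by ring,
    show (((m + k : ℕ) : ℝ) + (b + 1)) = ((m + k : ℕ) : ℝ) + 1 + b by ring]
  have h1 := ringChoose_succ_mul (((m + k : ℕ) : ℝ) + 1 + a) m
  have h2 := ringChoose_succ_mul (((m + k : ℕ) : ℝ) + 1 + b) k
  push_cast at h1 h2 ⊢
  linear_combination (Ring.choose ((m : ℝ) + k + 1 + b) k) * h1 +
    (Ring.choose ((m : ℝ) + k + 1 + a) m) * h2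

theorem jacPoly_zero (a b : ℝ) : jacPoly 0 a b = 1 := by simp [jacPoly]

theorem natDegree_jacPoly_le (n : ℕ) (a b : ℝ) : (jacPoly n a b).natDegree ≤ n := by
  refine natDegree_sum_le_of_forall_le _ _ fun m hm => ?_
  have hm' : m ≤ n := by simpa [Nat.lt_succ_iff] using hm
  refine (natDegree_C_mul_le _ _).trans (natDegree_mul_le.trans ?_)
  have h1 : ((X - 1 : ℝ[X]) ^ (n - m)).natDegree ≤ n - m := by
    refine natDegree_pow_le.trans ?_
    have : (X - 1 : ℝ[X]).natDegree ≤ 1 := by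
      simpa using natDegree_X_sub_C_le (1 : ℝ)
    nlinarith
  have h2 : ((X : ℝ[X]) ^ m).natDegree ≤ m := natDegree_X_pow_le m
  omega

theorem coeff_jacPoly_succ (n : ℕ) (a b : ℝ) :
    (jacPoly (n + 1) a b).coeff (n + 1) * ((n : ℝ) + 1) =
      ((n : ℝ) + a + b + 2) * (jacPoly n (a + 1) (b + 1)).coeff n := by
  have := congrArg (fun p => p.coeff n) (derivative_jacPoly n a b)
  simpa only [coeff_derivative, coeff_C_mul] using this

/-- Comparing leading coefficients in the derivative formula gives an induction with positive
factors. It shows that the degree is exactly n, so the family spans all polynomials. -/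
theorem coeff_jacPoly_pos (n : ℕ) : ∀ a b : ℝ, -2 < a + b → 0 < (jacPoly n a b).coeff n := by
  induction n with
  | zero => intro a b _; simp [jacPoly_zero]
  | succ n ih =>
    intro a b h
    have h1 := coeff_jacPoly_succ n a b
    have h2 := ih (a + 1) (b + 1) (by linarith)
    have h3 : (0 : ℝ) ≤ n := n.cast_nonneg
    have h4 : 0 < ((n : ℝ) + a + b + 2) * (jacPoly n (a + 1) (b + 1)).coeff n :=
      mul_pos (by linarith) h2
    rw [← h1] at h4
    exact pos_of_mul_pos_left h4 (by linarith)

/-- The recursion for the leading coefficient sees the parameters only through a+b. This lets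
leading terms be matched across the swap of weights in `fluxOp_jacPoly`. -/
theorem coeff_jacPoly_comm (n : ℕ) : ∀ a b : ℝ,
    (jacPoly n a b).coeff n = (jacPoly n b a).coeff n := by
  induction n with
  | zero => intro a b; simp [jacPoly_zero]
  | succ n ih =>
    intro a b
    have h1 := coeff_jacPoly_succ n a b
    have h2 := coeff_jacPoly_succ n b a
    rw [ih (a + 1) (b + 1)] at h1
    have h3 : (0 : ℝ) < (n : ℝ) + 1 := by positivity
    refine mul_right_cancel₀ h3.ne' ?_
    rw [h1, h2]; ring

end

/-! ### Jacobi weights, weighted measures and integration by parts. -/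

section

theorem weight_pos (a b : ℝ) {x : ℝ} (hx : x ∈ Ioo (0 : ℝ) 1) : 0 < weight a b x :=
  mul_pos (Real.rpow_pos_of_pos (by linarith [hx.2]) _) (Real.rpow_pos_of_pos hx.1 _)

@[fun_prop]
theorem measurable_weight (a b : ℝ) : Measurable (weight a b) := by
  unfold weight; fun_prop

theorem weight_mul_weight (a b c d : ℝ) {x : ℝ} (hx : x ∈ Ioo (0 : ℝ) 1) :
    weight a b x * weight c d x = weight (a + c) (b + d) x := by
  have h1 : 0 < 1 - x := by linarith [hx.2]
  simp only [weight, Real.rpow_add h1, Real.rpow_add hx.1]; ring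

theorem weight_zero (x : ℝ) : weight 0 0 x = 1 := by simp [weight]

theorem weight_neg_mul_weight (a b : ℝ) {x : ℝ} (hx : x ∈ Ioo (0 : ℝ) 1) :
    weight (-a) (-b) x * weight a b x = 1 := by
  rw [weight_mul_weight _ _ _ _ hx]; simp [weight]

theorem weight_one_one (x : ℝ) : weight 1 1 x = (1 - x) * x := by simp [weight]

theorem weight_le_weight {a b c d : ℝ} (hac : a ≤ c) (hbd : b ≤ d) {x : ℝ}
    (hx : x ∈ Ioo (0 : ℝ) 1) : weight c d x ≤ weight a b x :=
  mul_le_mul (Real.rpow_le_rpow_of_exponent_ge (by linarith [hx.2]) (by linarith [hx.1]) hac)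
    (Real.rpow_le_rpow_of_exponent_ge hx.1 hx.2.le hbd) (Real.rpow_nonneg hx.1.le _)
    (Real.rpow_nonneg (by linarith [hx.2]) _)

theorem weight_le_one {a b : ℝ} (ha : 0 ≤ a) (hb : 0 ≤ b) {x : ℝ} (hx : x ∈ Ioo (0 : ℝ) 1) :
    weight a b x ≤ 1 := by
  simpa [weight] using weight_le_weight ha hb hx

theorem weight_comm (a b x : ℝ) : weight a b (1 - x) = weight b a x := by
  simp [weight, mul_comm]

theorem lintegral_weight {a b : ℝ} (ha : -1 < a) (hb : -1 < b) :
    ∫⁻ x in Ioo (0 : ℝ) 1, ENNReal.ofReal (weight a b x) =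
      ENNReal.ofReal (ProbabilityTheory.beta (b + 1) (a + 1)) := by
  have h := ProbabilityTheory.lintegral_betaPDF_eq_one (α := b + 1) (β := a + 1)
    (by linarith) (by linarith)
  have hB := ProbabilityTheory.beta_pos (α := b + 1) (β := a + 1) (by linarith) (by linarith)
  rw [ProbabilityTheory.lintegral_betaPDF] at h
  set B := ProbabilityTheory.beta (b + 1) (a + 1)
  calc ∫⁻ x in Ioo (0 : ℝ) 1, ENNReal.ofReal (weight a b x)
      = ∫⁻ x in Ioo (0 : ℝ) 1, ENNReal.ofReal B *
          ENNReal.ofReal (1 / B * x ^ (b + 1 - 1) * (1 - x) ^ (a + 1 - 1)) := by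
        congr 1; ext x
        rw [← ENNReal.ofReal_mul hB.le]
        congr 1
        simp only [add_sub_cancel_right, weight]
        field_simp
    _ = ENNReal.ofReal B := by
        rw [lintegral_const_mul _ (by fun_prop), h, mul_one]

theorem integrableOn_weight {a b : ℝ} (ha : -1 < a) (hb : -1 < b) :
    IntegrableOn (weight a b) (Ioo 0 1) := by
  refine ⟨(measurable_weight a b).aestronglyMeasurable, ?_⟩
  rw [hasFiniteIntegral_iff_ofReal, lintegral_weight ha hb]
  · exact ENNReal.ofReal_lt_top
  · exact (ae_restrict_mem measurableSet_Ioo).mono fun x hx => (weight_pos a b hx).le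

theorem isFiniteMeasure_weightMeasure {a b : ℝ} (ha : -1 < a) (hb : -1 < b) :
    IsFiniteMeasure (weightMeasure a b) := by
  refine ⟨?_⟩
  rw [weightMeasure, withDensity_apply _ MeasurableSet.univ, Measure.restrict_univ, volI,
    lintegral_weight ha hb]
  exact ENNReal.ofReal_lt_top

theorem ae_volI_mem : ∀ᵐ x ∂volI, x ∈ Ioo (0 : ℝ) 1 := ae_restrict_mem measurableSet_Ioo

instance : IsFiniteMeasure volI := by unfold volI; infer_instance

/-- The weight is positive and finite on (0,1), so all weighted measures share their null sets; this
is how a.e. statements move between weights. -/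
theorem ae_weightMeasure (a b : ℝ) : ae (weightMeasure a b) = ae volI := by
  refine le_antisymm (withDensity_absolutelyContinuous _ _).ae_le ?_
  refine (withDensity_absolutelyContinuous' (by fun_prop) ?_).ae_le
  filter_upwards [ae_volI_mem] with x hx
  simpa using weight_pos a b hx

theorem aestronglyMeasurable_weightMeasure_iff {a b : ℝ} {f : ℝ → ℝ} :
    AEStronglyMeasurable f (weightMeasure a b) ↔ AEStronglyMeasurable f volI := by
  constructor
  · refine fun h => h.mono_ac ?_
    rw [← Measure.ae_le_iff_absolutelyContinuous, ae_weightMeasure]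
  · refine fun h => h.mono_ac ?_
    rw [← Measure.ae_le_iff_absolutelyContinuous, ae_weightMeasure]

theorem integral_weightMeasure (a b : ℝ) (f : ℝ → ℝ) :
    ∫ x, f x ∂(weightMeasure a b) = ∫ x in Ioo (0 : ℝ) 1, weight a b x * f x := by
  rw [weightMeasure, integral_withDensity_eq_integral_toReal_smul (by fun_prop) (by simp), volI]
  refine setIntegral_congr_fun measurableSet_Ioo fun x hx => ?_
  simp [ENNReal.toReal_ofReal (weight_pos a b hx).le]

theorem integrable_weightMeasure_iff {a b : ℝ} {f : ℝ → ℝ} :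
    Integrable f (weightMeasure a b) ↔ IntegrableOn (fun x => weight a b x * f x) (Ioo 0 1) := by
  rw [weightMeasure, integrable_withDensity_iff_integrable_smul' (by fun_prop) (by simp), volI]
  refine integrableOn_congr_fun (fun x hx => ?_) measurableSet_Ioo
  simp [ENNReal.toReal_ofReal (weight_pos a b hx).le]

theorem memLp_two_weightMeasure_iff {a b : ℝ} {f : ℝ → ℝ} :
    MemLp f 2 (weightMeasure a b) ↔ AEStronglyMeasurable f volI ∧
      IntegrableOn (fun x => weight a b x * f x ^ 2) (Ioo 0 1) := by
  rw [← integrable_weightMeasure_iff]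
  constructor
  · exact fun h => ⟨aestronglyMeasurable_weightMeasure_iff.1 h.1, h.integrable_sq⟩
  · exact fun h => (memLp_two_iff_integrable_sq
      (aestronglyMeasurable_weightMeasure_iff.2 h.1)).2 h.2

theorem weightMeasure_mono {a b c d : ℝ} (hac : a ≤ c) (hbd : b ≤ d) :
    weightMeasure c d ≤ weightMeasure a b := by
  refine withDensity_mono ?_
  filter_upwards [ae_volI_mem] with x hx
  exact ENNReal.ofReal_le_ofReal (weight_le_weight hac hbd hx)

theorem memLp_eval {a b : ℝ} (ha : -1 < a) (hb : -1 < b) (p : ℝ[X]) (q : ℝ≥0∞) :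
    MemLp (fun x => p.eval x) q (weightMeasure a b) := by
  have := isFiniteMeasure_weightMeasure ha hb
  obtain ⟨M, hM⟩ := isCompact_Icc.exists_bound_of_continuousOn (s := Icc (0 : ℝ) 1)
    (f := fun x => p.eval x) p.continuous.continuousOn
  refine MemLp.of_bound p.continuous.aestronglyMeasurable M ?_
  rw [ae_weightMeasure]
  filter_upwards [ae_volI_mem] with x hx
  exact hM x (Ioo_subset_Icc_self hx)

theorem integrable_mul_eval {a b : ℝ} {f : ℝ → ℝ} (hf : Integrable f (weightMeasure a b))
    (p : ℝ[X]) : Integrable (fun x => f x * p.eval x) (weightMeasure a b) := by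
  obtain ⟨M, hM⟩ := isCompact_Icc.exists_bound_of_continuousOn (s := Icc (0 : ℝ) 1)
    (f := fun x => p.eval x) p.continuous.continuousOn
  refine hf.mul_bdd (c := M) p.continuous.aestronglyMeasurable ?_
  rw [ae_weightMeasure]
  filter_upwards [ae_volI_mem] with x hx
  exact hM x (Ioo_subset_Icc_self hx)

theorem integral_sq_eq (a b : ℝ) {f : ℝ → ℝ} (hf : MemLp f 2 (weightMeasure a b)) :
    ∫ x, f x ^ 2 ∂(weightMeasure a b) = wNorm a b f ^ 2 := by
  have h := hf.eLpNorm_eq_integral_rpow_norm (by norm_num) (by norm_num)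
  have h0 : 0 ≤ ∫ x, f x ^ 2 ∂(weightMeasure a b) := integral_nonneg fun x => sq_nonneg _
  simp only [ENNReal.toReal_ofNat, Real.rpow_ofNat, Real.norm_eq_abs, sq_abs] at h
  rw [wNorm, h, ENNReal.toReal_ofReal (by positivity), ← Real.rpow_natCast, ← Real.rpow_mul h0]
  norm_num

/-- `v` agrees a.e. on `(0,1)` with a primitive of the locally integrable function `g`. -/
def IsPrimitive (v g : ℝ → ℝ) : Prop :=
  LocallyIntegrableOn g (Ioo 0 1) ∧
    ∃ c, ∀ᵐ x ∂volI, v x = c + ∫ t in (1 / 2 : ℝ)..x, g t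

theorem uIcc_subset_Ioo {x y : ℝ} (hx : x ∈ Ioo (0 : ℝ) 1) (hy : y ∈ Ioo (0 : ℝ) 1) :
    uIcc x y ⊆ Ioo 0 1 := OrdConnected.uIcc_subset inferInstance hx hy

theorem intervalIntegrable_of_locallyIntegrableOn {g : ℝ → ℝ}
    (hg : LocallyIntegrableOn g (Ioo 0 1)) {x y : ℝ} (hx : x ∈ Ioo (0 : ℝ) 1)
    (hy : y ∈ Ioo (0 : ℝ) 1) : IntervalIntegrable g volume x y := by
  rw [intervalIntegrable_iff']
  exact hg.integrableOn_compact_subset (uIcc_subset_Ioo hx hy) isCompact_uIcc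

theorem half_mem : (1 / 2 : ℝ) ∈ Ioo (0 : ℝ) 1 := by norm_num

theorem continuousOn_primitive_half {g : ℝ → ℝ} (hg : LocallyIntegrableOn g (Ioo 0 1)) :
    ContinuousOn (fun x => ∫ t in (1 / 2 : ℝ)..x, g t) (Ioo 0 1) := by
  intro x hx
  obtain ⟨y, hy⟩ := exists_between hx.1
  obtain ⟨z, hz⟩ := exists_between hx.2
  have hy' : y ∈ Ioo (0 : ℝ) 1 := ⟨hy.1, hy.2.trans hx.2⟩
  have hz' : z ∈ Ioo (0 : ℝ) 1 := ⟨hx.1.trans hz.1, hz.2⟩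
  have hmin : min y (1 / 2) ∈ Ioo (0 : ℝ) 1 := by
    rcases min_choice y (1 / 2) with h | h <;> rw [h] <;> first | exact hy' | exact half_mem
  have hmax : max z (1 / 2) ∈ Ioo (0 : ℝ) 1 := by
    rcases max_choice z (1 / 2) with h | h <;> rw [h] <;> first | exact hz' | exact half_mem
  have hle : min y (1 / 2) ≤ max z (1 / 2) := (min_le_right _ _).trans (le_max_right _ _)
  have hI := intervalIntegrable_of_locallyIntegrableOn hg hmin hmax
  have hac := hI.absolutelyContinuousOnInterval_intervalIntegral (c := 1 / 2) (by
    rw [uIcc_of_le hle]; exact ⟨min_le_right _ _, le_max_right _ _⟩)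
  have hc := hac.continuousOn
  rw [uIcc_of_le hle] at hc
  exact (hc.continuousAt (Icc_mem_nhds ((min_le_left _ _).trans_lt hy.2)
    (hz.1.trans_le (le_max_left _ _)))).continuousWithinAt

/-- Product rule for primitives. -/
theorem IsPrimitive.mul {v g w h : ℝ → ℝ} (hv : IsPrimitive v g) (hw : IsPrimitive w h) :
    IsPrimitive (fun x => v x * w x) (fun x => g x * w x + v x * h x) := by
  obtain ⟨hg, c, hc⟩ := hv
  obtain ⟨hh, d, hd⟩ := hw
  -- V and W are the locally absolutely continuous representatives. The base point 1/2 is used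
  -- because g and h need not be integrable up to the endpoints.
  set V : ℝ → ℝ := fun x => c + ∫ t in (1 / 2 : ℝ)..x, g t with hV
  set W : ℝ → ℝ := fun x => d + ∫ t in (1 / 2 : ℝ)..x, h t with hW
  have hVc : ContinuousOn V (Ioo 0 1) := continuousOn_const.add (continuousOn_primitive_half hg)
  have hWc : ContinuousOn W (Ioo 0 1) := continuousOn_const.add (continuousOn_primitive_half hh)
  have hloc : LocallyIntegrableOn (fun x => g x * W x + V x * h x) (Ioo 0 1) :=
    (hg.mul_continuousOn hWc isOpen_Ioo.isLocallyClosed).add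
      (hh.continuousOn_mul hVc isOpen_Ioo.isLocallyClosed)
  have hcongr : (fun x => g x * W x + V x * h x) =ᵐ[volI] fun x => g x * w x + v x * h x := by
    filter_upwards [hc, hd] with x h1 h2
    rw [h1, h2]
  have hloc' : LocallyIntegrableOn (fun x => g x * w x + v x * h x) (Ioo 0 1) := by
    rw [locallyIntegrableOn_iff isOpen_Ioo.isLocallyClosed] at hloc ⊢
    intro k hk hkc
    refine (hloc k hk hkc).congr ?_
    exact (ae_mono (Measure.restrict_mono hk le_rfl)) hcongr
  refine ⟨hloc', V (1 / 2) * W (1 / 2), ?_⟩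
  filter_upwards [hc, hd, ae_volI_mem] with x h1 h2 hx
  have hgi := intervalIntegrable_of_locallyIntegrableOn hg half_mem hx
  have hhi := intervalIntegrable_of_locallyIntegrableOn hh half_mem hx
  have hVac : AbsolutelyContinuousOnInterval V (1 / 2) x :=
    (contDiff_const (c := c)).contDiffOn.absolutelyContinuousOnInterval.add
      (hgi.absolutelyContinuousOnInterval_intervalIntegral left_mem_uIcc)
  have hWac : AbsolutelyContinuousOnInterval W (1 / 2) x :=
    (contDiff_const (c := d)).contDiffOn.absolutelyContinuousOnInterval.add
      (hhi.absolutelyContinuousOnInterval_intervalIntegral left_mem_uIcc)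
  have key := hVac.integral_deriv_mul_eq_sub hWac
  have hint : ∫ t in (1 / 2 : ℝ)..x, (g t * w t + v t * h t) =
      ∫ t in (1 / 2 : ℝ)..x, (deriv V t * W t + V t * deriv W t) := by
    refine intervalIntegral.integral_congr_ae ?_
    have hcongr' := (ae_restrict_iff' measurableSet_Ioo).1 hcongr
    filter_upwards [hcongr', hgi.ae_hasDerivAt_integral, hhi.ae_hasDerivAt_integral]
      with t ht hgt hht htm
    have htm' := uIoc_subset_uIcc htm
    have e1 : deriv V t = g t := ((hgt htm' _ left_mem_uIcc).const_add c).deriv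
    have e2 : deriv W t = h t := ((hht htm' _ left_mem_uIcc).const_add d).deriv
    rw [e1, e2]
    exact (ht (uIcc_subset_Ioo half_mem hx htm')).symm
  rw [hint, key, h1, h2]
  change V x * W x = _
  ring

theorem isPrimitive_of_hasDerivAt {v g : ℝ → ℝ} (hg : ContinuousOn g (Ioo 0 1))
    (hv : ∀ x ∈ Ioo (0 : ℝ) 1, HasDerivAt v (g x) x) : IsPrimitive v g := by
  refine ⟨hg.locallyIntegrableOn measurableSet_Ioo, v (1 / 2), ?_⟩
  filter_upwards [ae_volI_mem] with x hx
  rw [intervalIntegral.integral_eq_sub_of_hasDerivAt (f := v)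
    (fun t ht => hv t (uIcc_subset_Ioo half_mem hx ht))
    ((hg.mono (uIcc_subset_Ioo half_mem hx)).intervalIntegrable)]
  ring

/-- If `v` has an integrable derivative and `v / (x (1 - x))` is integrable,
the boundary values vanish. -/
theorem IsPrimitive.integral_eq_zero {v g : ℝ → ℝ} (hv : IsPrimitive v g)
    (hg : IntegrableOn g (Ioo 0 1)) (hv' : IntegrableOn (fun x => v x / ((1 - x) * x)) (Ioo 0 1)) :
    ∫ x in Ioo (0 : ℝ) 1, g x = 0 := by
  obtain ⟨-, c, hc⟩ := hv
  have hgi : IntervalIntegrable g volume 0 1 := by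
    rw [intervalIntegrable_iff_integrableOn_Ioo_of_le zero_le_one]; exact hg
  set V : ℝ → ℝ := fun x => c + ∫ t in (1 / 2 : ℝ)..x, g t with hV
  have hVc : ContinuousOn V (Icc 0 1) := by
    have := (hgi.absolutelyContinuousOnInterval_intervalIntegral (c := 1 / 2)
      (by rw [uIcc_of_le zero_le_one]; norm_num)).continuousOn
    rw [uIcc_of_le zero_le_one] at this
    exact continuousOn_const.add this
  have hV' : IntegrableOn (fun x => V x / ((1 - x) * x)) (Ioo 0 1) := by
    refine hv'.congr ?_
    filter_upwards [hc] with x hx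
    rw [hx]
  -- A nonzero endpoint value would make |V|/((1-x)x) dominate a multiple of 1/|x-x₀| near x₀, which
  -- is not integrable.
  have key : ∀ x₀ ∈ Icc (0 : ℝ) 1, (x₀ = 0 ∨ x₀ = 1) → V x₀ = 0 := by
    intro x₀ hx₀ hcase
    by_contra hne
    have hni : ¬ IntervalIntegrable (fun x => (x - x₀)⁻¹) volume 0 1 := by
      rw [intervalIntegrable_sub_inv_iff]
      simp only [zero_ne_one, false_or, not_not]
      rw [uIcc_of_le zero_le_one]; exact hx₀
    obtain ⟨δ, hδ, hδV⟩ : ∃ δ > 0, ∀ x ∈ Icc (0 : ℝ) 1, |x - x₀| < δ → |V x₀| / 2 ≤ |V x| := by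
      have := (hVc x₀ hx₀)
      rw [Metric.continuousWithinAt_iff] at this
      obtain ⟨δ, hδ, h⟩ := this (|V x₀| / 2) (by positivity)
      refine ⟨δ, hδ, fun x hx hd => ?_⟩
      have h1 := h hx (by rwa [Real.dist_eq])
      rw [Real.dist_eq] at h1
      have := abs_sub_abs_le_abs_sub (V x₀) (V x)
      rw [abs_sub_comm] at this
      linarith
    refine hni ?_
    rw [intervalIntegrable_iff_integrableOn_Ioo_of_le zero_le_one]
    have hdom : IntegrableOn (fun x => 2 / |V x₀| * |V x / ((1 - x) * x)| + 1 / δ) (Ioo 0 1) :=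
      (hV'.abs.const_mul _).add (integrable_const _)
    refine Integrable.mono' hdom (by fun_prop) ?_
    filter_upwards [ae_restrict_mem measurableSet_Ioo] with x hx
    have hx1 : 0 < 1 - x := by linarith [hx.2]
    have hx0 := hx.1
    have hV0 : 0 < |V x₀| := abs_pos.2 hne
    have hpos : 0 < |x - x₀| := by
      rcases hcase with rfl | rfl
      · simpa using hx.1.ne'
      · exact abs_pos.2 (by linarith [hx.2])
    have hprod : (1 - x) * x ≤ |x - x₀| := by
      rcases hcase with rfl | rfl
      · rw [sub_zero, abs_of_pos hx.1]; nlinarith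
      · rw [abs_of_neg (by linarith)]; nlinarith
    rw [norm_inv, Real.norm_eq_abs, abs_div, abs_of_pos (mul_pos hx1 hx0)]
    by_cases hd : |x - x₀| < δ
    · have h1 := hδV x (Ioo_subset_Icc_self hx) hd
      have h2 : |x - x₀|⁻¹ ≤ 2 / |V x₀| * (|V x| / ((1 - x) * x)) := by
        rw [div_mul_div_comm, inv_eq_one_div, div_le_div_iff₀ hpos (by positivity)]
        nlinarith [mul_le_mul_of_nonneg_left hprod hV0.le,
          mul_le_mul_of_nonneg_right h1 hpos.le]
      have : 0 ≤ 1 / δ := by positivity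
      linarith
    · push Not at hd
      have h1 : |x - x₀|⁻¹ ≤ 1 / δ := by
        rw [← one_div]; exact one_div_le_one_div_of_le hδ hd
      have : 0 ≤ 2 / |V x₀| * (|V x| / ((1 - x) * x)) := by positivity
      linarith
  have h0 := key 0 (by simp) (Or.inl rfl)
  have h1 := key 1 (by simp) (Or.inr rfl)
  have hsub : V 1 - V 0 = ∫ t in (0 : ℝ)..1, g t := by
    simp only [hV, add_sub_add_left_eq_sub]
    have hm : (1 / 2 : ℝ) ∈ uIcc (0 : ℝ) 1 := by rw [uIcc_of_le zero_le_one]; norm_num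
    exact intervalIntegral.integral_interval_sub_left
      (hgi.mono_set (uIcc_subset_uIcc hm right_mem_uIcc))
      (hgi.mono_set (uIcc_subset_uIcc hm left_mem_uIcc))
  rw [← integral_Ioc_eq_integral_Ioo, ← intervalIntegral.integral_of_le zero_le_one, ← hsub, h0, h1,
    sub_zero]

theorem hasDerivAt_weight_mul_eval (a b : ℝ) (q : ℝ[X]) {x : ℝ} (hx : x ∈ Ioo (0 : ℝ) 1) :
    HasDerivAt (fun x => weight (a + 1) (b + 1) x * q.eval x)
      (weight a b x * (rod a b q).eval x) x := by
  have h1 : 0 < 1 - x := by linarith [hx.2]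
  have d1 : HasDerivAt (fun x : ℝ => (1 - x) ^ (a + 1)) (-((a + 1) * (1 - x) ^ a)) x := by
    have := ((hasDerivAt_id x).const_sub 1).rpow_const (p := a + 1) (Or.inl h1.ne')
    convert! this using 1; simp; ring
  have d2 : HasDerivAt (fun x : ℝ => x ^ (b + 1)) ((b + 1) * x ^ b) x := by
    have := (hasDerivAt_id x).rpow_const (p := b + 1) (Or.inl hx.1.ne')
    simpa using this
  convert! (d1.mul d2).mul (q.hasDerivAt x) using 1
  simp only [weight, rod, Real.rpow_add h1, Real.rpow_add hx.1, Real.rpow_one, eval_add, eval_mul,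
    eval_sub, eval_X, eval_one, eval_C, Pi.mul_apply]
  ring

theorem continuousOn_weight (a b : ℝ) : ContinuousOn (weight a b) (Ioo 0 1) := by
  intro x hx
  have h1 : 1 - x ≠ 0 := by linarith [hx.2]
  refine ContinuousAt.continuousWithinAt (ContinuousAt.mul ?_ ?_)
  · exact ContinuousAt.rpow_const (by fun_prop) (Or.inl h1)
  · exact ContinuousAt.rpow_const (by fun_prop) (Or.inl hx.1.ne')

/-- Weighted integration by parts against a polynomial. -/
theorem IsPrimitive.integral_mul_eval {v g : ℝ → ℝ} (hv : IsPrimitive v g) {a b : ℝ}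
    (hv1 : Integrable v (weightMeasure a b)) (hg1 : Integrable g (weightMeasure (a + 1) (b + 1)))
    (q : ℝ[X]) :
    ∫ x, g x * q.eval x ∂(weightMeasure (a + 1) (b + 1)) =
      -∫ x, v x * (rod a b q).eval x ∂(weightMeasure a b) := by
  have hQ : IsPrimitive (fun x => weight (a + 1) (b + 1) x * q.eval x)
      (fun x => weight a b x * (rod a b q).eval x) :=
    isPrimitive_of_hasDerivAt
      ((continuousOn_weight a b).mul (rod a b q).continuous.continuousOn)
      fun x hx => hasDerivAt_weight_mul_eval a b q hx
  have hP := hv.mul hQ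
  have i1 := integrable_weightMeasure_iff.1 (integrable_mul_eval hg1 q)
  have i2 := integrable_weightMeasure_iff.1 (integrable_mul_eval hv1 (rod a b q))
  have i3 := integrable_weightMeasure_iff.1 (integrable_mul_eval hv1 q)
  -- Dividing v ω^{(a+1,b+1)} q by x(1-x) leaves v ω^{(a,b)} q, which is integrable; hence no
  -- boundary terms.
  have hz := hP.integral_eq_zero
    ((i1.add i2).congr (Eventually.of_forall fun x => by simp only [Pi.add_apply]; ring)) (by
      refine i3.congr ?_
      filter_upwards [ae_restrict_mem measurableSet_Ioo] with x hx
      have h1 : 0 < 1 - x := by linarith [hx.2]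
      have h0 := hx.1
      rw [← weight_mul_weight a b 1 1 hx, weight_one_one]
      field_simp)
  rw [integral_weightMeasure, integral_weightMeasure, eq_neg_iff_add_eq_zero]
  refine (integral_add i1 i2).symm.trans (Eq.trans ?_ hz)
  refine integral_congr_ae (Eventually.of_forall fun x => ?_)
  simp only
  ring

end

/-! ### Orthogonality, completeness and the Jacobi Hilbert basis. -/

section

/-- A polynomial vanishing a.e. on `(0,1)` is zero. -/
theorem eq_zero_of_eval_ae_eq_zero {p : ℝ[X]} (h : ∀ᵐ x ∂volI, p.eval x = 0) : p = 0 := by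
  by_contra hp
  have hfin : volI (↑p.roots.toFinset : Set ℝ) = 0 := by
    exact le_antisymm ((Measure.restrict_apply_le _ _).trans (Finset.measure_zero _ _).le) bot_le
  have h' : ∀ᵐ x ∂volI, x ∉ (↑p.roots.toFinset : Set ℝ) := measure_eq_zero_iff_ae_notMem.1 hfin
  have : ∀ᵐ x ∂volI, False := by
    filter_upwards [h, h'] with x h1 h2
    exact h2 (by simp [hp, h1])
  rw [eventually_false_iff_eq_bot, ae_eq_bot] at this
  have h2 : volI univ = 1 := by simp [volI]
  rw [this] at h2
  simp at h2

theorem isPrimitive_eval (p : ℝ[X]) :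
    IsPrimitive (fun x => p.eval x) (fun x => (derivative p).eval x) :=
  isPrimitive_of_hasDerivAt (derivative p).continuous.continuousOn fun x _ => p.hasDerivAt x

variable {a b : ℝ}

/-- Integration by parts combined with `rod_jacPoly`: a derivative is traded for the factor n+1
while both weight exponents go up by one. Orthogonality, norm ratios and coefficient decay all come
from this identity. -/
theorem IsPrimitive.integral_mul_jacPoly {v g : ℝ → ℝ} (hv : IsPrimitive v g)
    (hv1 : Integrable v (weightMeasure a b)) (hg1 : Integrable g (weightMeasure (a + 1) (b + 1)))
    (n : ℕ) :
    ∫ x, g x * (jacPoly n (a + 1) (b + 1)).eval x ∂(weightMeasure (a + 1) (b + 1)) =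
      ((n : ℝ) + 1) * ∫ x, v x * (jacPoly (n + 1) a b).eval x ∂(weightMeasure a b) := by
  rw [hv.integral_mul_eval hv1 hg1, rod_jacPoly, ← integral_neg, ← integral_const_mul]
  congr 1; ext x
  simp; ring

theorem integrable_eval (ha : -1 < a) (hb : -1 < b) (p : ℝ[X]) :
    Integrable (fun x => p.eval x) (weightMeasure a b) := by
  have := isFiniteMeasure_weightMeasure ha hb
  exact (memLp_eval ha hb p 1).integrable le_rfl

theorem integral_eval_mul_jacPoly (ha : -1 < a) (hb : -1 < b) (p : ℝ[X]) (n : ℕ) :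
    ∫ x, (derivative p).eval x * (jacPoly n (a + 1) (b + 1)).eval x
        ∂(weightMeasure (a + 1) (b + 1)) =
      ((n : ℝ) + 1) * ∫ x, p.eval x * (jacPoly (n + 1) a b).eval x ∂(weightMeasure a b) :=
  (isPrimitive_eval p).integral_mul_jacPoly (integrable_eval ha hb p)
    (integrable_eval (by linarith) (by linarith) _) n

/-- Orthogonality of the Jacobi polynomials to polynomials of lower degree. -/
theorem integral_mul_jacPoly_eq_zero (n : ℕ) : ∀ {a b : ℝ}, -1 < a → -1 < b → ∀ p : ℝ[X],
    p.natDegree < n → ∫ x, p.eval x * (jacPoly n a b).eval x ∂(weightMeasure a b) = 0 := by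
  induction n with
  | zero => intro a b _ _ p hp; omega
  | succ n ih =>
    intro a b ha hb p hp
    have h := integral_eval_mul_jacPoly ha hb p n
    have hz : ∫ x, (derivative p).eval x * (jacPoly n (a + 1) (b + 1)).eval x
        ∂(weightMeasure (a + 1) (b + 1)) = 0 := by
      rcases Nat.eq_zero_or_pos p.natDegree with h0 | h0
      · rw [derivative_of_natDegree_zero h0]; simp
      · exact ih (by linarith) (by linarith) _ ((natDegree_derivative_lt h0.ne').trans_le (by omega))
    rw [hz] at h
    have h3 : (n : ℝ) + 1 ≠ 0 := by positivity
    simpa [h3] using h.symm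

/-- `‖G_n^{(a,b)}‖²` in the weighted `L²` space. -/
def jacNorm (n : ℕ) (a b : ℝ) : ℝ := ∫ x, (jacPoly n a b).eval x ^ 2 ∂(weightMeasure a b)

/-- The moment identity applied to the Jacobi polynomial of degree n+1 itself, whose derivative is
again a Jacobi polynomial. -/
theorem jacNorm_succ (ha : -1 < a) (hb : -1 < b) (n : ℕ) :
    ((n : ℝ) + a + b + 2) * jacNorm n (a + 1) (b + 1) = ((n : ℝ) + 1) * jacNorm (n + 1) a b := by
  have h := integral_eval_mul_jacPoly ha hb (jacPoly (n + 1) a b) n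
  rw [derivative_jacPoly] at h
  simp only [jacNorm, sq, ← h, ← integral_const_mul]
  congr 1; ext x
  simp; ring

theorem integral_eval_sq_pos (ha : -1 < a) (hb : -1 < b) {p : ℝ[X]} (hp : p ≠ 0) :
    0 < ∫ x, p.eval x ^ 2 ∂(weightMeasure a b) := by
  refine lt_of_le_of_ne (integral_nonneg fun x => sq_nonneg _) fun h => hp ?_
  rw [eq_comm, integral_eq_zero_iff_of_nonneg (fun x => sq_nonneg _)
    (memLp_eval ha hb p 2).integrable_sq] at h
  refine eq_zero_of_eval_ae_eq_zero ?_
  have h' : ∀ᵐ x ∂(weightMeasure a b), p.eval x ^ 2 = 0 := h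
  rw [ae_weightMeasure] at h'
  exact h'.mono fun x hx => by simpa using hx

theorem jacPoly_ne_zero (ha : -1 < a) (hb : -1 < b) (n : ℕ) : jacPoly n a b ≠ 0 := fun h => by
  have := coeff_jacPoly_pos n a b (by linarith)
  rw [h] at this; simp at this

theorem jacNorm_pos (ha : -1 < a) (hb : -1 < b) (n : ℕ) : 0 < jacNorm n a b :=
  integral_eval_sq_pos ha hb (jacPoly_ne_zero ha hb n)

theorem integral_jacPoly_mul_jacPoly (ha : -1 < a) (hb : -1 < b) {m n : ℕ} (h : m ≠ n) :
    ∫ x, (jacPoly m a b).eval x * (jacPoly n a b).eval x ∂(weightMeasure a b) = 0 := by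
  rcases lt_or_gt_of_ne h with h | h
  · exact integral_mul_jacPoly_eq_zero n ha hb _ ((natDegree_jacPoly_le m a b).trans_lt h)
  · simp_rw [mul_comm (eval _ (jacPoly m a b))]
    exact integral_mul_jacPoly_eq_zero m ha hb _ ((natDegree_jacPoly_le n a b).trans_lt h)

/-- Subtracting the multiple of the N-th Jacobi polynomial that kills the coefficient of X^N lowers
the degree, so the Jacobi polynomials span. -/
theorem jacPoly_induction (ha : -1 < a) (hb : -1 < b) {P : ℝ[X] → Prop} (h0 : P 0)
    (hadd : ∀ p n c, P p → P (p + C c * jacPoly n a b)) (p : ℝ[X]) : P p := by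
  have key : ∀ N : ℕ, ∀ p : ℝ[X], p.degree < N → P p := by
    intro N
    induction N with
    | zero =>
      intro p hp
      rw [degree_lt_iff_coeff_zero] at hp
      have : p = 0 := by ext m; simpa using hp m (Nat.zero_le m)
      rwa [this]
    | succ N ih =>
      intro p hp
      have hc := coeff_jacPoly_pos N a b (by linarith)
      set c := p.coeff N / (jacPoly N a b).coeff N with hcdef
      have hq : (p - C c * jacPoly N a b).degree < N := by
        rw [degree_lt_iff_coeff_zero]
        intro m hm
        rcases hm.eq_or_lt with rfl | hm
        · simp [hcdef, hc.ne']
        · rw [degree_lt_iff_coeff_zero] at hp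
          have h1 : (jacPoly N a b).coeff m = 0 :=
            coeff_eq_zero_of_natDegree_lt ((natDegree_jacPoly_le N a b).trans_lt hm)
          rw [coeff_sub, coeff_C_mul, h1, hp m hm]; simp
      have := hadd _ N c (ih _ hq)
      rwa [sub_add_cancel] at this
  exact key (p.natDegree + 1) p (degree_le_natDegree.trans_lt (by exact_mod_cast Nat.lt_succ_self _))

/-- An integrable function on `(0,1)` is determined by its moments. -/
theorem ae_eq_zero_of_forall_integral_mul_eval {v : ℝ → ℝ} (hv : IntegrableOn v (Ioo 0 1))
    (h : ∀ p : ℝ[X], ∫ x in Ioo (0 : ℝ) 1, v x * p.eval x = 0) : ∀ᵐ x ∂volI, v x = 0 := by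
  rw [volI, ae_restrict_iff' measurableSet_Ioo]
  refine isOpen_Ioo.ae_eq_zero_of_integral_contDiff_smul_eq_zero hv.locallyIntegrableOn ?_
  intro φ hφ _ hsupp
  have hset : ∫ x, φ x • v x = ∫ x in Ioo (0 : ℝ) 1, v x * φ x := by
    rw [← setIntegral_eq_integral_of_forall_compl_eq_zero (s := Ioo (0 : ℝ) 1)]
    · simp [mul_comm]
    · intro x hx
      have : φ x = 0 := image_eq_zero_of_notMem_tsupport fun hx' => hx (hsupp hx')
      simp [this]
  rw [hset]
  -- Weierstrass: φ is uniformly within ε of a polynomial, and polynomials contribute nothing.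
  have hbound : ∀ ε > 0, |∫ x in Ioo (0 : ℝ) 1, v x * φ x| ≤ ε * ∫ x in Ioo (0 : ℝ) 1, |v x| := by
    intro ε hε
    obtain ⟨p, hp⟩ := exists_polynomial_near_of_continuousOn 0 1 φ hφ.continuous.continuousOn ε hε
    have hbd : ∀ {ψ : ℝ → ℝ}, Continuous ψ → IntegrableOn (fun x => v x * ψ x) (Ioo 0 1) := by
      intro ψ hψ
      obtain ⟨M, hM⟩ := isCompact_Icc.exists_bound_of_continuousOn (s := Icc (0 : ℝ) 1)
        (f := ψ) hψ.continuousOn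
      refine Integrable.mul_bdd (c := M) hv hψ.aestronglyMeasurable ?_
      filter_upwards [ae_restrict_mem measurableSet_Ioo] with x hx
      exact hM x (Ioo_subset_Icc_self hx)
    have h1 : ∫ x in Ioo (0 : ℝ) 1, v x * φ x = ∫ x in Ioo (0 : ℝ) 1, v x * (φ x - p.eval x) := by
      simp_rw [mul_sub]
      rw [integral_sub (hbd hφ.continuous) (hbd p.continuous), h p, sub_zero]
    rw [h1, ← integral_const_mul]
    refine (norm_integral_le_integral_norm _).trans (integral_mono_ae
      (hbd (hφ.continuous.sub p.continuous)).norm (hv.abs.const_mul ε) ?_)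
    filter_upwards [ae_restrict_mem measurableSet_Ioo] with x hx
    have := hp x (Ioo_subset_Icc_self hx)
    rw [norm_mul, Real.norm_eq_abs, Real.norm_eq_abs, mul_comm, Pi.sub_apply, abs_sub_comm]
    exact mul_le_mul_of_nonneg_right this.le (abs_nonneg _)
  by_contra hne
  have hpos := abs_pos.2 hne
  set I := ∫ x in Ioo (0 : ℝ) 1, |v x| with hI
  have hI0 : 0 ≤ I := integral_nonneg fun x => abs_nonneg _
  -- This ε bounds the integral by half of itself; the +1 guards against I = 0.
  have := hbound (|∫ x in Ioo (0 : ℝ) 1, v x * φ x| / (2 * (I + 1))) (by positivity)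
  rw [div_mul_eq_mul_div, le_div_iff₀ (by positivity)] at this
  nlinarith

theorem inner_toLp {f g : ℝ → ℝ} {μ : Measure ℝ} (hf : MemLp f 2 μ) (hg : MemLp g 2 μ) :
    inner ℝ (hf.toLp f) (hg.toLp g) = ∫ x, f x * g x ∂μ := by
  rw [L2.inner_def]
  refine integral_congr_ae ?_
  filter_upwards [hf.coeFn_toLp, hg.coeFn_toLp] with x h1 h2
  rw [h1, h2]; simp [mul_comm]

/-- Only integrability is assumed, not square integrability, because fluxes are known a priori only
to be weighted integrable. -/
theorem jacPoly_complete (ha : -1 < a) (hb : -1 < b) {v : ℝ → ℝ}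
    (hv : Integrable v (weightMeasure a b))
    (h : ∀ n, ∫ x, v x * (jacPoly n a b).eval x ∂(weightMeasure a b) = 0) :
    ∀ᵐ x ∂volI, v x = 0 := by
  have hall : ∀ p : ℝ[X], ∫ x, v x * p.eval x ∂(weightMeasure a b) = 0 := by
    refine jacPoly_induction ha hb (by simp) fun p n c hp => ?_
    have e : ∀ x, v x * (p + C c * jacPoly n a b).eval x =
        v x * p.eval x + c * (v x * (jacPoly n a b).eval x) := fun x => by simp; ring
    simp_rw [e]
    rw [integral_add (integrable_mul_eval hv p) ((integrable_mul_eval hv _).const_mul c), hp,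
      integral_const_mul, h n]
    simp
  have := ae_eq_zero_of_forall_integral_mul_eval (integrable_weightMeasure_iff.1 hv) fun p => by
    refine Eq.trans ?_ (hall p)
    rw [integral_weightMeasure]
    simp_rw [mul_assoc]
  filter_upwards [this, ae_volI_mem] with x h1 h2
  exact (mul_eq_zero.1 h1).resolve_left (weight_pos a b h2).ne'

/-- The normalized Jacobi polynomials as elements of the weighted `L²` space. -/
def jacVec (ha : -1 < a) (hb : -1 < b) (n : ℕ) : Lp ℝ 2 (weightMeasure a b) :=
  (√(jacNorm n a b))⁻¹ • (memLp_eval ha hb (jacPoly n a b) 2).toLp _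

theorem inner_jacVec (ha : -1 < a) (hb : -1 < b) (n : ℕ) {v : ℝ → ℝ}
    (hv : MemLp v 2 (weightMeasure a b)) :
    inner ℝ (jacVec ha hb n) (hv.toLp v) =
      (√(jacNorm n a b))⁻¹ * ∫ x, v x * (jacPoly n a b).eval x ∂(weightMeasure a b) := by
  rw [jacVec, real_inner_smul_left, inner_toLp]
  simp_rw [mul_comm (v _)]

theorem orthonormal_jacVec (ha : -1 < a) (hb : -1 < b) : Orthonormal ℝ (jacVec ha hb) := by
  rw [orthonormal_iff_ite]
  intro m n
  rw [jacVec, jacVec, real_inner_smul_left, real_inner_smul_right, inner_toLp]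
  split_ifs with h
  · subst h
    have hp := jacNorm_pos ha hb m
    have : ∫ x, (jacPoly m a b).eval x * (jacPoly m a b).eval x ∂(weightMeasure a b) =
        jacNorm m a b := by simp_rw [jacNorm, sq]
    rw [this, ← mul_assoc, ← mul_inv, Real.mul_self_sqrt hp.le, inv_mul_cancel₀ hp.ne']
  · rw [integral_jacPoly_mul_jacPoly ha hb h]; simp

theorem span_jacVec_orthogonal (ha : -1 < a) (hb : -1 < b) :
    (Submodule.span ℝ (range (jacVec ha hb)))ᗮ = ⊥ := by
  have := isFiniteMeasure_weightMeasure ha hb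
  rw [Submodule.eq_bot_iff]
  intro v hv
  have hvm : MemLp v 2 (weightMeasure a b) := Lp.memLp v
  have hz := jacPoly_complete ha hb (v := v) (hvm.integrable (by norm_num)) fun n => by
    have h1 := (Submodule.mem_orthogonal _ _).1 hv (jacVec ha hb n)
      (Submodule.subset_span (mem_range_self n))
    rw [← Lp.toLp_coeFn v hvm, inner_jacVec ha hb n hvm] at h1
    have h2 := Real.sqrt_pos.2 (jacNorm_pos ha hb n)
    simpa [h2.ne'] using h1
  rw [← ae_weightMeasure a b] at hz
  exact (Lp.eq_zero_iff_ae_eq_zero).2 hz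

/-- The Hilbert basis of normalized Jacobi polynomials. -/
def jacBasis (ha : -1 < a) (hb : -1 < b) : HilbertBasis ℕ ℝ (Lp ℝ 2 (weightMeasure a b)) :=
  HilbertBasis.mkOfOrthogonalEqBot (orthonormal_jacVec ha hb) (span_jacVec_orthogonal ha hb)

/-- Parseval's identity for Jacobi expansions. -/
theorem hasSum_jacPoly_sq (ha : -1 < a) (hb : -1 < b) {v : ℝ → ℝ}
    (hv : MemLp v 2 (weightMeasure a b)) :
    HasSum (fun n => (∫ x, v x * (jacPoly n a b).eval x ∂(weightMeasure a b)) ^ 2 / jacNorm n a b)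
      (∫ x, v x ^ 2 ∂(weightMeasure a b)) := by
  have h := (jacBasis ha hb).hasSum_inner_mul_inner (hv.toLp v) (hv.toLp v)
  rw [inner_toLp] at h
  convert! h using 1
  · ext n
    have hp := jacNorm_pos ha hb n
    rw [jacBasis, HilbertBasis.coe_mkOfOrthogonalEqBot, real_inner_comm, inner_jacVec ha hb n hv]
    have := Real.sq_sqrt hp.le
    field_simp
    rw [this]
  · simp_rw [sq]

/-- Riesz–Fischer for Jacobi expansions. -/
theorem exists_memLp_of_summable (ha : -1 < a) (hb : -1 < b) {γ : ℕ → ℝ}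
    (h : Summable fun n => γ n ^ 2 / jacNorm n a b) :
    ∃ v, MemLp v 2 (weightMeasure a b) ∧
      ∀ n, ∫ x, v x * (jacPoly n a b).eval x ∂(weightMeasure a b) = γ n := by
  have hm : Memℓp (fun n => (√(jacNorm n a b))⁻¹ * γ n) 2 := by
    refine memℓp_gen ?_
    simp only [ENNReal.toReal_ofNat, Real.rpow_ofNat, Real.norm_eq_abs, sq_abs]
    refine h.congr fun n => ?_
    rw [mul_pow, inv_pow, Real.sq_sqrt (jacNorm_pos ha hb n).le]
    field_simp
  set w := (jacBasis ha hb).repr.symm ⟨_, hm⟩ with hw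
  have hwm : MemLp w 2 (weightMeasure a b) := Lp.memLp w
  refine ⟨w, hwm, fun n => ?_⟩
  have h1 : (jacBasis ha hb).repr w n = (√(jacNorm n a b))⁻¹ * γ n := by
    rw [hw, LinearIsometryEquiv.apply_symm_apply]
  rw [HilbertBasis.repr_apply_apply, jacBasis, HilbertBasis.coe_mkOfOrthogonalEqBot,
    ← Lp.toLp_coeFn w hwm, inner_jacVec ha hb n hwm] at h1
  have h2 := Real.sqrt_pos.2 (jacNorm_pos ha hb n)
  exact mul_left_cancel₀ (inv_ne_zero h2.ne') (by simpa using h1)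

end

/-! ### The flux kernel and its value on the weight. -/

section

/-- The kernel of `(1-r) ₀I_x^{2-α} + r ₓI_1^{2-α}`. -/
def fluxKernel (α r x y : ℝ) : ℝ :=
  (1 - r) / Real.Gamma (2 - α) * (max (x - y) 0) ^ (1 - α) +
    r / Real.Gamma (2 - α) * (max (y - x) 0) ^ (1 - α)

/-- The admissible parameters, with `a = α - β`, `b = β`. -/
structure Params (α r a b : ℝ) : Prop where
  one_lt : 1 < α
  lt_two : α < 2
  sum : a + b = α
  a_le : a ≤ 1
  b_le : b ≤ 1
  r_eq : r = Real.sin (Real.pi * b) / (Real.sin (Real.pi * a) + Real.sin (Real.pi * b))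

namespace Params
variable {α r a b : ℝ}

theorem a_pos (h : Params α r a b) : 0 < a := by linarith [h.one_lt, h.sum, h.b_le]
theorem b_pos (h : Params α r a b) : 0 < b := by linarith [h.one_lt, h.sum, h.a_le]

theorem sin_nonneg {t : ℝ} (h0 : 0 < t) (h1 : t ≤ 1) : 0 ≤ Real.sin (Real.pi * t) :=
  Real.sin_nonneg_of_nonneg_of_le_pi (by positivity) (by nlinarith [Real.pi_pos])

theorem sin_pos {t : ℝ} (h0 : 0 < t) (h1 : t < 1) : 0 < Real.sin (Real.pi * t) :=
  Real.sin_pos_of_pos_of_lt_pi (by positivity) (by nlinarith [Real.pi_pos])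

theorem sin_add_pos (h : Params α r a b) :
    0 < Real.sin (Real.pi * a) + Real.sin (Real.pi * b) := by
  have ha := sin_nonneg h.a_pos h.a_le
  have hb := sin_nonneg h.b_pos h.b_le
  rcases lt_or_eq_of_le h.a_le with h1 | h1
  · linarith [sin_pos h.a_pos h1]
  · have : b < 1 := by linarith [h.lt_two, h.sum]
    linarith [sin_pos h.b_pos this]

theorem one_sub_r (h : Params α r a b) :
    1 - r = Real.sin (Real.pi * a) / (Real.sin (Real.pi * a) + Real.sin (Real.pi * b)) := by
  have := h.sin_add_pos.ne'
  rw [h.r_eq]; field_simp; ring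

/-- The reflection x ↦ 1-x exchanges the two one-sided integrals; statements about the right half
are deduced from the left half through this symmetry. -/
theorem symm (h : Params α r a b) : Params α (1 - r) b a where
  one_lt := h.one_lt
  lt_two := h.lt_two
  sum := by rw [← h.sum, add_comm]
  a_le := h.b_le
  b_le := h.a_le
  r_eq := by rw [h.one_sub_r, add_comm]

theorem r_nonneg (h : Params α r a b) : 0 ≤ r := by
  rw [h.r_eq]; exact div_nonneg (sin_nonneg h.b_pos h.b_le) h.sin_add_pos.le

theorem one_sub_r_nonneg (h : Params α r a b) : 0 ≤ 1 - r := h.symm.r_nonneg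

theorem Gamma_pos (h : Params α r a b) : 0 < Real.Gamma (2 - α) :=
  Real.Gamma_pos_of_pos (by linarith [h.lt_two])

end Params

theorem measurable_fluxKernel (α r : ℝ) : Measurable fun z : ℝ × ℝ => fluxKernel α r z.1 z.2 := by
  unfold fluxKernel; fun_prop

@[fun_prop]
theorem measurable_fluxKernel_right (α r x : ℝ) : Measurable (fluxKernel α r x) := by
  unfold fluxKernel; fun_prop

variable {α r a b : ℝ}

theorem fluxKernel_nonneg (h : Params α r a b) (x y : ℝ) : 0 ≤ fluxKernel α r x y := by
  have := h.Gamma_pos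
  have h1 := h.r_nonneg
  have h2 := h.one_sub_r_nonneg
  unfold fluxKernel
  have e1 : 0 ≤ (max (x - y) 0) ^ (1 - α) := Real.rpow_nonneg (le_max_right _ _) _
  have e2 : 0 ≤ (max (y - x) 0) ^ (1 - α) := Real.rpow_nonneg (le_max_right _ _) _
  positivity

/-- The inactive branch is 0^(1-α), and a real power of 0 with nonzero exponent is 0 even when the
exponent is negative. -/
theorem fluxKernel_of_lt (hα : 1 < α) {x y : ℝ} (hxy : y < x) :
    fluxKernel α r x y = (1 - r) / Real.Gamma (2 - α) * (x - y) ^ (1 - α) := by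
  rw [fluxKernel, max_eq_left (by linarith), max_eq_right (by linarith),
    Real.zero_rpow (by linarith)]
  ring

theorem fluxKernel_of_gt (hα : 1 < α) {x y : ℝ} (hxy : x < y) :
    fluxKernel α r x y = r / Real.Gamma (2 - α) * (y - x) ^ (1 - α) := by
  rw [fluxKernel, max_eq_right (by linarith), max_eq_left (by linarith),
    Real.zero_rpow (by linarith)]
  ring

/-- Transposing the kernel exchanges r and 1-r, so the adjoint operator is of the same type with
swapped parameters. -/
theorem fluxKernel_swap (α r x y : ℝ) : fluxKernel α (1 - r) x y = fluxKernel α r y x := by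
  simp only [fluxKernel]; ring

/-- A projective change of variables in a beta integral. -/
theorem lintegral_weight_mul_rpow (hα : α < 2) (ha : 0 < a) (hs : a + b = α) {t : ℝ}
    (ht : t ∈ Ioo (0 : ℝ) 1) :
    ∫⁻ s in Ioo (0 : ℝ) 1, ENNReal.ofReal (weight (1 - α) (a - 1) s * (1 - t * s) ^ (b - 2)) =
      ENNReal.ofReal ((1 - t) ^ (-a) * ProbabilityTheory.beta a (2 - α)) := by
  obtain ⟨ht0, ht1⟩ := ht
  have hu : 0 < 1 - t := by linarith
  -- This projective map of (0,1) turns 1-φ, φ and 1-tφ into quotients with the same denominator D.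
  -- The powers of D, together with D⁻² from the Jacobian, cancel because a+b = α.
  set φ : ℝ → ℝ := fun τ => τ / (1 - t + t * τ) with hφ
  have hD : ∀ τ ∈ Ioo (0 : ℝ) 1, 0 < 1 - t + t * τ := fun τ hτ => by nlinarith [hτ.1]
  have hd : ∀ τ ∈ Ioo (0 : ℝ) 1,
      HasDerivWithinAt φ ((1 - t) / (1 - t + t * τ) ^ 2) (Ioo 0 1) τ := by
    intro τ hτ
    have h1 : HasDerivAt (fun τ : ℝ => 1 - t + t * τ) t τ := by
      simpa using ((hasDerivAt_id τ).const_mul t).const_add (1 - t)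
    have := (hasDerivAt_id τ).div h1 (hD τ hτ).ne'
    refine HasDerivAt.hasDerivWithinAt ?_
    convert! this using 1
    simp only [id, one_mul]
    ring
  have hinj : InjOn φ (Ioo 0 1) := by
    intro τ hτ σ hσ he
    have h1 := (hD τ hτ).ne'
    have h2 := (hD σ hσ).ne'
    simp only [hφ] at he
    rw [div_eq_div_iff h1 h2] at he
    have : (1 - t) * (τ - σ) = 0 := by linarith
    rcases mul_eq_zero.1 this with h | h <;> linarith
  have himg : φ '' Ioo 0 1 = Ioo 0 1 := by
    ext s
    constructor
    · rintro ⟨τ, hτ, rfl⟩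
      refine ⟨div_pos hτ.1 (hD τ hτ), ?_⟩
      simp only [hφ]
      rw [div_lt_one (hD τ hτ)]
      nlinarith [hτ.2]
    · rintro ⟨h0, h1⟩
      have hE : 0 < 1 - t * s := by nlinarith
      refine ⟨(1 - t) * s / (1 - t * s), ⟨by positivity, ?_⟩, ?_⟩
      · rw [div_lt_one hE]; nlinarith
      · simp only [hφ]
        have : 1 - t + t * ((1 - t) * s / (1 - t * s)) = (1 - t) / (1 - t * s) := by
          field_simp; ring
        rw [this]; field_simp
  conv_lhs => rw [← himg]
  rw [lintegral_image_eq_lintegral_abs_deriv_mul measurableSet_Ioo hd hinj]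
  have hB := lintegral_weight (a := 1 - α) (b := a - 1) (by linarith) (by linarith)
  rw [show a - 1 + 1 = a by ring, show 1 - α + 1 = 2 - α by ring] at hB
  rw [ENNReal.ofReal_mul (by positivity), ← hB, ← lintegral_const_mul _ (by fun_prop)]
  refine setLIntegral_congr_fun measurableSet_Ioo fun τ hτ => ?_
  have hDτ := hD τ hτ
  have hτ1 : 0 < 1 - τ := by linarith [hτ.2]
  rw [← ENNReal.ofReal_mul (by positivity), ← ENNReal.ofReal_mul (by positivity)]
  congr 1
  rw [abs_of_pos (by positivity)]
  have e1 : 1 - φ τ = (1 - t) * (1 - τ) / (1 - t + t * τ) := by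
    simp only [hφ]; rw [eq_div_iff hDτ.ne', sub_mul, div_mul_cancel₀ _ hDτ.ne']; ring
  have e2 : 1 - t * φ τ = (1 - t) / (1 - t + t * τ) := by
    simp only [hφ]; rw [eq_div_iff hDτ.ne', sub_mul, mul_assoc, div_mul_cancel₀ _ hDτ.ne']; ring
  have e3 : φ τ = τ / (1 - t + t * τ) := rfl
  simp only [weight]
  rw [e1, e2, e3]
  set D := 1 - t + t * τ
  set u := 1 - t
  have hτ0 := hτ.1
  rw [Real.div_rpow (by positivity) hDτ.le, Real.div_rpow (by positivity) hDτ.le,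
    Real.div_rpow (by positivity) hDτ.le, Real.mul_rpow hu.le hτ1.le]
  have k1 : u ^ (-a) = u * u ^ (1 - α) * u ^ (b - 2) := by
    rw [← Real.rpow_one_add' hu.le, ← Real.rpow_add hu]
    · congr 1; linarith
    · linarith
  have k2 : D ^ (2 : ℕ) * D ^ (1 - α) * D ^ (a - 1) * D ^ (b - 2) = 1 := by
    rw [← Real.rpow_natCast, ← Real.rpow_add hDτ, ← Real.rpow_add hDτ, ← Real.rpow_add hDτ,
      ← Real.rpow_zero D]
    congr 1; push_cast; linarith
  rw [k1]
  have p1 := Real.rpow_pos_of_pos hDτ (1 - α)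
  have p2 := Real.rpow_pos_of_pos hDτ (a - 1)
  have p3 := Real.rpow_pos_of_pos hDτ (b - 2)
  field_simp
  rw [show D ^ 2 * D ^ (1 - α) * D ^ (a - 1) * D ^ (b - 2) = 1 from k2]

theorem lintegral_Ioo_scale {x : ℝ} (hx : 0 < x) (g : ℝ → ℝ≥0∞) :
    ∫⁻ y in Ioo 0 x, g y = ∫⁻ s in Ioo (0 : ℝ) 1, ENNReal.ofReal x * g (x * s) := by
  have himg : (fun s : ℝ => x * s) '' Ioo 0 1 = Ioo 0 x := by
    rw [image_mul_left_Ioo hx]; simp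
  rw [← himg, lintegral_image_eq_lintegral_abs_deriv_mul measurableSet_Ioo
    (f' := fun _ => x) (fun s _ => by simpa using ((hasDerivAt_id s).const_mul x).hasDerivWithinAt)
    (mul_right_injective₀ hx.ne').injOn]
  simp [abs_of_pos hx]

theorem lintegral_Ioo_reflect (x : ℝ) (g : ℝ → ℝ≥0∞) :
    ∫⁻ y in Ioo x 1, g y = ∫⁻ s in Ioo 0 (1 - x), g (1 - s) := by
  have himg : (fun s : ℝ => 1 - s) '' Ioo 0 (1 - x) = Ioo x 1 := by
    rw [image_const_sub_Ioo]; simp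
  rw [← himg, lintegral_image_eq_lintegral_abs_deriv_mul measurableSet_Ioo
    (f' := fun _ => -1) (fun s _ => by simpa using ((hasDerivAt_id s).const_sub 1).hasDerivWithinAt)
    (sub_right_injective.injOn)]
  simp

theorem lintegral_left_scale (hs : a + b = α) {x : ℝ} (hx : x ∈ Ioo (0 : ℝ) 1) :
    ∫⁻ y in Ioo 0 x, ENNReal.ofReal ((x - y) ^ (1 - α) * weight (b - 1) (a - 1) y) =
      ∫⁻ s in Ioo (0 : ℝ) 1, ENNReal.ofReal
        (x ^ (1 - b) * (weight (1 - α) (a - 1) s * (1 - x * s) ^ (b - 1))) := by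
  rw [lintegral_Ioo_scale hx.1]
  refine setLIntegral_congr_fun measurableSet_Ioo fun s hsm => ?_
  have h1 : 0 < 1 - s := by linarith [hsm.2]
  have h0 := hsm.1
  have hx0 := hx.1
  rw [← ENNReal.ofReal_mul hx.1.le]
  congr 1
  simp only [weight]
  rw [show x - x * s = x * (1 - s) by ring, Real.mul_rpow hx0.le h1.le, Real.mul_rpow hx0.le h0.le]
  have k : x ^ (1 - b) = x * x ^ (1 - α) * x ^ (a - 1) := by
    nth_rewrite 2 [← Real.rpow_one x]
    rw [← Real.rpow_add hx0, ← Real.rpow_add hx0]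
    congr 1; linarith
  rw [k]; ring

/-- After scaling, x^(1-b)(1-xs)^(b-1) is written as (1-b)∫₀ˣ t^(-b)(1-ts)^(b-2) dt. Exchanging
integrals and applying `lintegral_weight_mul_rpow` leaves an incomplete beta integral over (0,x),
ready to be completed by the right half. -/
theorem lintegral_left_eq (hα : α < 2) (ha : 0 < a) (hb : b < 1) (hs : a + b = α) {x : ℝ}
    (hx : x ∈ Ioo (0 : ℝ) 1) :
    ∫⁻ y in Ioo 0 x, ENNReal.ofReal ((x - y) ^ (1 - α) * weight (b - 1) (a - 1) y) =
      ENNReal.ofReal ((1 - b) * ProbabilityTheory.beta a (2 - α)) *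
        ∫⁻ t in Ioo 0 x, ENNReal.ofReal (weight (-a) (-b) t) := by
  have hx0 := hx.1
  have hb1 : 0 < 1 - b := by linarith
  have hB : 0 < ProbabilityTheory.beta a (2 - α) :=
    ProbabilityTheory.beta_pos ha (by linarith)
  have inner : ∀ s ∈ Ioo (0 : ℝ) 1,
      ∫⁻ t in Ioo 0 x, ENNReal.ofReal (t ^ (-b) * (1 - t * s) ^ (b - 2)) =
        ENNReal.ofReal (x ^ (1 - b) * (1 - x * s) ^ (b - 1) / (1 - b)) := by
    intro s hsm
    have hpos : ∀ t ∈ Icc 0 x, 0 < 1 - t * s := fun t ht => by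
      nlinarith [ht.1, ht.2, hsm.1, hsm.2, hx.2]
    have hint : IntervalIntegrable (fun t => t ^ (-b) * (1 - t * s) ^ (b - 2)) volume 0 x := by
      refine (intervalIntegral.intervalIntegrable_rpow' (by linarith)).mul_continuousOn ?_
      rw [uIcc_of_le hx0.le]
      exact ContinuousOn.rpow_const (by fun_prop) fun t ht => Or.inl (hpos t ht).ne'
    have hcont : ContinuousOn (fun t => t ^ (1 - b) * (1 - t * s) ^ (b - 1) / (1 - b)) (Icc 0 x) := by
      refine ContinuousOn.div_const (ContinuousOn.mul ?_ ?_) _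
      · exact ContinuousOn.rpow_const (by fun_prop) fun t ht => Or.inr hb1.le
      · exact ContinuousOn.rpow_const (by fun_prop) fun t ht => Or.inl (hpos t ht).ne'
    have hFTC := intervalIntegral.integral_eq_sub_of_hasDerivAt_of_le hx0.le hcont
      (f' := fun t => t ^ (-b) * (1 - t * s) ^ (b - 2)) (fun t ht => ?_) hint
    · rw [Real.zero_rpow hb1.ne', intervalIntegral.integral_of_le hx0.le,
        integral_Ioc_eq_integral_Ioo] at hFTC
      simp only [zero_mul, zero_div, sub_zero] at hFTC
      rw [← hFTC, ofReal_integral_eq_lintegral_ofReal]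
      · exact (intervalIntegrable_iff_integrableOn_Ioo_of_le hx0.le).1 hint
      · filter_upwards [ae_restrict_mem measurableSet_Ioo] with t ht
        have h1 := hpos t (Ioo_subset_Icc_self ht)
        have h2 := ht.1
        simp only [Pi.zero_apply]
        positivity
    · have h1 := hpos t (Ioo_subset_Icc_self ht)
      have h2 := ht.1
      have hl : HasDerivAt (fun t : ℝ => 1 - t * s) (-s) t := by
        simpa using ((hasDerivAt_id t).mul_const s).const_sub 1
      have d1 := (hasDerivAt_id t).rpow_const (p := 1 - b) (Or.inl h2.ne')
      have d2 := hl.rpow_const (p := b - 1) (Or.inl h1.ne')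
      convert! (d1.mul d2).div_const (1 - b) using 1
      simp only [id]
      rw [show 1 - b - 1 = -b by ring, show b - 1 - 1 = b - 2 by ring,
        show b - 1 = 1 + (b - 2) by ring, show 1 - b = 1 + -b by ring,
        Real.rpow_add h1, Real.rpow_add h2, Real.rpow_one, Real.rpow_one]
      have : 1 + -b ≠ 0 := by linarith
      field_simp
      ring
  have h1 : ENNReal.ofReal (ProbabilityTheory.beta a (2 - α)) *
      ∫⁻ t in Ioo 0 x, ENNReal.ofReal (weight (-a) (-b) t) =
      ∫⁻ s in Ioo (0 : ℝ) 1, ENNReal.ofReal (weight (1 - α) (a - 1) s *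
        (x ^ (1 - b) * (1 - x * s) ^ (b - 1) / (1 - b))) := by
    rw [← lintegral_const_mul _ (by fun_prop)]
    calc _ = ∫⁻ t in Ioo 0 x, ∫⁻ s in Ioo (0 : ℝ) 1,
          ENNReal.ofReal (t ^ (-b) * (weight (1 - α) (a - 1) s * (1 - t * s) ^ (b - 2))) := by
          refine setLIntegral_congr_fun measurableSet_Ioo fun t ht => ?_
          have ht0 := ht.1
          have ht1 : 0 < 1 - t := by linarith [ht.2, hx.2]
          have hp : 0 ≤ t ^ (-b) := by positivity
          simp_rw [ENNReal.ofReal_mul hp]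
          rw [lintegral_const_mul _ (by fun_prop),
            lintegral_weight_mul_rpow hα ha hs ⟨ht.1, ht.2.trans hx.2⟩,
            ← ENNReal.ofReal_mul hp, ← ENNReal.ofReal_mul hB.le]
          congr 1
          simp only [weight]; ring
      _ = ∫⁻ s in Ioo (0 : ℝ) 1, ∫⁻ t in Ioo 0 x,
          ENNReal.ofReal (t ^ (-b) * (weight (1 - α) (a - 1) s * (1 - t * s) ^ (b - 2))) :=
          lintegral_lintegral_swap (by
            refine Measurable.aemeasurable ?_
            simp only [weight]
            fun_prop)
      _ = _ := by
          refine setLIntegral_congr_fun measurableSet_Ioo fun s hsm => ?_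
          have hp := (weight_pos (1 - α) (a - 1) hsm).le
          rw [ENNReal.ofReal_mul hp, ← inner s hsm, ← lintegral_const_mul _ (by fun_prop)]
          congr 1; ext t
          rw [← ENNReal.ofReal_mul hp]
          congr 1; ring
  rw [lintegral_left_scale hs hx, ENNReal.ofReal_mul hb1.le, mul_assoc, h1,
    ← lintegral_const_mul _ (by fun_prop)]
  congr 1; ext s
  rw [← ENNReal.ofReal_mul hb1.le]
  congr 1
  field_simp

/-- At the edge b = 1 the weight has no factor in 1-y, and scaling alone shows that the integral
does not depend on x. -/
theorem lintegral_left_eq_of_b_eq_one (hα : α < 2) (ha : 0 < a) (hb : b = 1) (hs : a + b = α)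
    {x : ℝ} (hx : x ∈ Ioo (0 : ℝ) 1) :
    ∫⁻ y in Ioo 0 x, ENNReal.ofReal ((x - y) ^ (1 - α) * weight (b - 1) (a - 1) y) =
      ENNReal.ofReal (ProbabilityTheory.beta a (2 - α)) := by
  have hB := lintegral_weight (a := 1 - α) (b := a - 1) (by linarith) (by linarith)
  rw [show a - 1 + 1 = a by ring, show 1 - α + 1 = 2 - α by ring] at hB
  rw [lintegral_left_scale hs hx, ← hB, hb]
  simp

/-- The constant value of the flux operator on the weight. -/
def fluxConst (α a b : ℝ) : ℝ :=
  Real.pi / (Real.Gamma (2 - α) * (Real.sin (Real.pi * a) + Real.sin (Real.pi * b)))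

theorem fluxConst_pos (h : Params α r a b) : 0 < fluxConst α a b :=
  div_pos Real.pi_pos (mul_pos h.Gamma_pos h.sin_add_pos)

theorem lintegral_split {x : ℝ} (hx : x ∈ Ioo (0 : ℝ) 1) (g : ℝ → ℝ≥0∞) :
    ∫⁻ y in Ioo (0 : ℝ) 1, g y = (∫⁻ y in Ioo 0 x, g y) + ∫⁻ y in Ioo x 1, g y := by
  rw [← Ioc_union_Ioo_eq_Ioo hx.1.le hx.2, lintegral_union measurableSet_Ioo
    (Set.disjoint_left.2 fun y h1 h2 => h1.2.not_gt h2.1)]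
  congr 1
  exact (setLIntegral_congr Ioo_ae_eq_Ioc).symm

theorem lintegral_fluxKernel_split (h : Params α r a b) {x : ℝ} (hx : x ∈ Ioo (0 : ℝ) 1) :
    ∫⁻ y in Ioo (0 : ℝ) 1, ENNReal.ofReal (fluxKernel α r x y * weight (b - 1) (a - 1) y) =
      ENNReal.ofReal ((1 - r) / Real.Gamma (2 - α)) *
        (∫⁻ y in Ioo 0 x, ENNReal.ofReal ((x - y) ^ (1 - α) * weight (b - 1) (a - 1) y)) +
      ENNReal.ofReal (r / Real.Gamma (2 - α)) *
        ∫⁻ y in Ioo 0 (1 - x),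
          ENNReal.ofReal ((1 - x - y) ^ (1 - α) * weight (a - 1) (b - 1) y) := by
  rw [lintegral_split hx, lintegral_Ioo_reflect x]
  have hG := h.Gamma_pos
  have h1 := h.one_sub_r_nonneg
  have h2 := h.r_nonneg
  congr 1
  · rw [← lintegral_const_mul _ (by fun_prop)]
    refine setLIntegral_congr_fun measurableSet_Ioo fun y hy => ?_
    rw [fluxKernel_of_lt h.one_lt hy.2, mul_assoc, ENNReal.ofReal_mul (by positivity)]
  · rw [← lintegral_const_mul _ (by fun_prop)]
    refine setLIntegral_congr_fun measurableSet_Ioo fun y hy => ?_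
    rw [fluxKernel_of_gt h.one_lt (by linarith [hy.2] : x < 1 - y), mul_assoc,
      ENNReal.ofReal_mul (by positivity), weight_comm, show 1 - y - x = 1 - x - y by ring]

/-- The right side is symmetric in a and b, so the left and right halves carry the same constant.
This is where the relation between r and β enters; Euler's reflection formula cancels the sine in
1-r. -/
theorem fluxConst_aux (h : Params α r a b) (ha : a < 1) (hb : b < 1) :
    (1 - r) / Real.Gamma (2 - α) * ((1 - b) * ProbabilityTheory.beta a (2 - α)) =
      Real.pi / ((Real.sin (Real.pi * a) + Real.sin (Real.pi * b)) *
        (Real.Gamma (1 - a) * Real.Gamma (1 - b))) := by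
  have hG := h.Gamma_pos
  have hc := h.sin_add_pos
  have g1 : 0 < Real.Gamma (1 - a) := Real.Gamma_pos_of_pos (by linarith)
  have g2 : 0 < Real.Gamma (1 - b) := Real.Gamma_pos_of_pos (by linarith)
  have g3 : 0 < Real.Gamma a := Real.Gamma_pos_of_pos h.a_pos
  have hs : Real.sin (Real.pi * a) ≠ 0 := (Params.sin_pos h.a_pos ha).ne'
  have hr := Real.Gamma_mul_Gamma_one_sub a
  have hb2 : Real.Gamma (a + (2 - α)) = (1 - b) * Real.Gamma (1 - b) := by
    rw [← Real.Gamma_add_one (by linarith)]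
    congr 1; linarith [h.sum]
  have hb1 : 1 - b ≠ 0 := by linarith
  rw [h.one_sub_r, ProbabilityTheory.beta, hb2]
  rw [eq_div_iff hs] at hr
  field_simp
  linarith

/-- The flux operator maps the weight to a constant. -/
theorem lintegral_fluxKernel (h : Params α r a b) {x : ℝ} (hx : x ∈ Ioo (0 : ℝ) 1) :
    ∫⁻ y in Ioo (0 : ℝ) 1, ENNReal.ofReal (fluxKernel α r x y * weight (b - 1) (a - 1) y) =
      ENNReal.ofReal (fluxConst α a b) := by
  have hG := h.Gamma_pos
  have hx' : 1 - x ∈ Ioo (0 : ℝ) 1 := ⟨by linarith [hx.2], by linarith [hx.1]⟩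
  have h1 := h.one_sub_r_nonneg
  have h2 := h.r_nonneg
  -- When b = 1 (or, by symmetry, a = 1) only one of the two one-sided integrals survives.
  have edge : ∀ {r a b : ℝ}, Params α r a b → b = 1 →
      (1 - r) / Real.Gamma (2 - α) * ProbabilityTheory.beta a (2 - α) = fluxConst α a b ∧ r = 0 := by
    intro r a b h hb
    have hc := h.sin_add_pos
    have hr0 : r = 0 := by rw [h.r_eq, hb]; simp
    refine ⟨?_, hr0⟩
    have hr := Real.Gamma_mul_Gamma_one_sub a
    have e : 1 - a = 2 - α := by linarith [h.sum]
    rw [hb] at hc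
    simp only [mul_one, Real.sin_pi, add_zero] at hc
    rw [hr0, ProbabilityTheory.beta, show a + (2 - α) = 1 by linarith [h.sum], Real.Gamma_one,
      fluxConst, hb]
    rw [e, eq_div_iff hc.ne'] at hr
    simp only [mul_one, Real.sin_pi, add_zero]
    field_simp
    linarith
  rw [lintegral_fluxKernel_split h hx]
  rcases eq_or_lt_of_le h.b_le with hb | hb
  · obtain ⟨e1, e2⟩ := edge h hb
    rw [lintegral_left_eq_of_b_eq_one h.lt_two h.a_pos hb h.sum hx, ← ENNReal.ofReal_mul
      (by positivity), e1, e2]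
    simp
  rcases eq_or_lt_of_le h.a_le with ha | ha
  · obtain ⟨e1, e2⟩ := edge h.symm ha
    rw [lintegral_left_eq_of_b_eq_one h.lt_two h.b_pos ha h.symm.sum hx']
    rw [sub_sub_cancel] at e1
    rw [e2, ← ENNReal.ofReal_mul (by positivity), e1]
    simp only [zero_div, ENNReal.ofReal_zero, zero_mul, zero_add, fluxConst, add_comm]
  rw [lintegral_left_eq h.lt_two h.a_pos hb h.sum hx,
    lintegral_left_eq h.lt_two h.b_pos ha h.symm.sum hx', ← mul_assoc, ← mul_assoc,
    ← ENNReal.ofReal_mul (by positivity), ← ENNReal.ofReal_mul (by positivity),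
    fluxConst_aux h ha hb]
  have hsy := fluxConst_aux h.symm hb ha
  rw [sub_sub_cancel] at hsy
  rw [hsy, add_comm (Real.sin (Real.pi * b)), mul_comm (Real.Gamma (1 - b)), ← mul_add]
  -- Reflected, the right half is the same integrand over (x,1); both halves together form a
  -- complete beta integral, free of x.
  have hrefl : ∫⁻ t in Ioo 0 (1 - x), ENNReal.ofReal (weight (-b) (-a) t) =
      ∫⁻ t in Ioo x 1, ENNReal.ofReal (weight (-a) (-b) t) := by
    rw [lintegral_Ioo_reflect]
    simp_rw [weight_comm]
  have g1 : 0 < Real.Gamma (1 - a) := Real.Gamma_pos_of_pos (by linarith)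
  have g2 : 0 < Real.Gamma (1 - b) := Real.Gamma_pos_of_pos (by linarith)
  have hc := h.sin_add_pos
  have hpi := Real.pi_pos
  rw [hrefl, ← lintegral_split hx fun t => ENNReal.ofReal (weight (-a) (-b) t), lintegral_weight (by linarith) (by linarith),
    ← ENNReal.ofReal_mul (by positivity)]
  congr 1
  rw [ProbabilityTheory.beta, fluxConst, show -b + 1 + (-a + 1) = 2 - α by linarith [h.sum],
    show -b + 1 = 1 - b by ring, show -a + 1 = 1 - a by ring]
  field_simp

end

/-! ### Action of the flux operator on monomials. -/

section

variable {α r a b : ℝ}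

theorem integrableOn_fluxKernel_mul_weight (h : Params α r a b) {x : ℝ} (hx : x ∈ Ioo (0 : ℝ) 1) :
    IntegrableOn (fun y => fluxKernel α r x y * weight (b - 1) (a - 1) y) (Ioo 0 1) := by
  refine ⟨by fun_prop, ?_⟩
  rw [hasFiniteIntegral_iff_ofReal, lintegral_fluxKernel h hx]
  · exact ENNReal.ofReal_lt_top
  · filter_upwards [ae_restrict_mem measurableSet_Ioo] with y hy
    exact mul_nonneg (fluxKernel_nonneg h x y) (weight_pos _ _ hy).le

theorem integral_fluxKernel_mul_weight (h : Params α r a b) {x : ℝ} (hx : x ∈ Ioo (0 : ℝ) 1) :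
    ∫ y in Ioo (0 : ℝ) 1, fluxKernel α r x y * weight (b - 1) (a - 1) y = fluxConst α a b := by
  rw [integral_eq_lintegral_of_nonneg_ae, lintegral_fluxKernel h hx,
    ENNReal.toReal_ofReal (fluxConst_pos h).le]
  · filter_upwards [ae_restrict_mem measurableSet_Ioo] with y hy
    exact mul_nonneg (fluxKernel_nonneg h x y) (weight_pos _ _ hy).le
  · fun_prop

/-- The flux operator applied to a polynomial times the weight. -/
def fluxOp (α r a b : ℝ) (p : ℝ[X]) (x : ℝ) : ℝ :=
  ∫ y in Ioo (0 : ℝ) 1, fluxKernel α r x y * weight (b - 1) (a - 1) y * p.eval y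

theorem integrableOn_mul_eval {g : ℝ → ℝ} (hg : IntegrableOn g (Ioo 0 1)) (p : ℝ[X]) :
    IntegrableOn (fun y => g y * p.eval y) (Ioo 0 1) := by
  have h := integrable_mul_eval (a := 0) (b := 0) (f := g)
    (integrable_weightMeasure_iff.2 (by simpa [weight_zero] using hg)) p
  simpa [weight_zero] using integrable_weightMeasure_iff.1 h

theorem fluxOp_add (h : Params α r a b) (p q : ℝ[X]) {x : ℝ} (hx : x ∈ Ioo (0 : ℝ) 1) :
    fluxOp α r a b (p + q) x = fluxOp α r a b p x + fluxOp α r a b q x := by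
  have hk := integrableOn_fluxKernel_mul_weight h hx
  simp only [fluxOp, eval_add, mul_add]
  exact integral_add (integrableOn_mul_eval hk p) (integrableOn_mul_eval hk q)

theorem fluxOp_C_mul (c : ℝ) (p : ℝ[X]) (x : ℝ) :
    fluxOp α r a b (C c * p) x = c * fluxOp α r a b p x := by
  simp only [fluxOp, eval_mul, eval_C, ← integral_const_mul]
  congr 1; ext y; ring

/-- `t ↦ t κ(t)`, where `κ(x - y)` is the flux kernel. -/
def fluxPrim (α r t : ℝ) : ℝ :=
  (1 - r) / Real.Gamma (2 - α) * (max t 0) ^ (2 - α) -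
    r / Real.Gamma (2 - α) * (max (-t) 0) ^ (2 - α)

theorem continuous_fluxPrim (hα : α < 2) : Continuous (fluxPrim α r) := by
  unfold fluxPrim
  have h1 : Continuous fun t : ℝ => (max t 0) ^ (2 - α) :=
    (continuous_id.max continuous_const).rpow_const fun _ => Or.inr (by linarith)
  have h2 : Continuous fun t : ℝ => (max (-t) 0) ^ (2 - α) :=
    (continuous_neg.max continuous_const).rpow_const fun _ => Or.inr (by linarith)
  exact (continuous_const.mul h1).sub (continuous_const.mul h2)

/-- The factor x-y removes the singularity of the kernel. As the derivative of `fluxPrim` off 0 is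
again a multiple of the kernel, integrations by parts stay inside the family. -/
theorem fluxPrim_sub (h1 : 1 < α) (h2 : α < 2) (x y : ℝ) :
    fluxPrim α r (x - y) = (x - y) * fluxKernel α r x y := by
  have hz : (2 - α) ≠ 0 := by linarith
  have he : 1 + (1 - α) ≠ 0 := by linarith
  rcases lt_trichotomy x y with hxy | rfl | hxy
  · rw [fluxKernel_of_gt h1 hxy, fluxPrim, max_eq_right (by linarith), max_eq_left (by linarith),
      Real.zero_rpow hz, show 2 - α = 1 + (1 - α) by ring, Real.rpow_one_add' (by linarith) he,
      show -(x - y) = y - x by ring]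
    ring
  · simp [fluxPrim, Real.zero_rpow hz]
  · rw [fluxKernel_of_lt h1 hxy, fluxPrim, max_eq_left (by linarith), max_eq_right (by linarith),
      Real.zero_rpow hz, show 2 - α = 1 + (1 - α) by ring, Real.rpow_one_add' (by linarith) he]
    ring

theorem hasDerivAt_fluxPrim (h1 : 1 < α) (h2 : α < 2) {x y : ℝ} (hxy : x ≠ y) :
    HasDerivAt (fluxPrim α r) ((2 - α) * fluxKernel α r x y) (x - y) := by
  have hz : (2 - α) ≠ 0 := by linarith
  rcases lt_or_gt_of_ne hxy with hlt | hlt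
  · have hd : HasDerivAt (fun t : ℝ => -(r / Real.Gamma (2 - α) * (-t) ^ (2 - α)))
        ((2 - α) * fluxKernel α r x y) (x - y) := by
      have := (((hasDerivAt_id (x - y)).neg.rpow_const (p := 2 - α)
        (Or.inl (by simp only [id, Pi.neg_apply]; linarith))).const_mul
          (r / Real.Gamma (2 - α))).neg
      convert! this using 1
      rw [fluxKernel_of_gt h1 hlt]
      simp only [id, Pi.neg_apply, neg_sub, show 2 - α - 1 = 1 - α by ring]
      ring
    refine hd.congr_of_eventuallyEq ?_
    filter_upwards [eventually_lt_nhds (by linarith : x - y < 0)] with t ht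
    rw [fluxPrim, max_eq_right ht.le, max_eq_left (by linarith), Real.zero_rpow hz]
    ring
  · have hd : HasDerivAt (fun t : ℝ => (1 - r) / Real.Gamma (2 - α) * t ^ (2 - α))
        ((2 - α) * fluxKernel α r x y) (x - y) := by
      have := ((hasDerivAt_id (x - y)).rpow_const (p := 2 - α)
        (Or.inl (by simp only [id]; linarith))).const_mul ((1 - r) / Real.Gamma (2 - α))
      convert! this using 1
      rw [fluxKernel_of_lt h1 hlt]
      simp only [id, show 2 - α - 1 = 1 - α by ring]
      ring
    refine hd.congr_of_eventuallyEq ?_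
    filter_upwards [eventually_gt_nhds (by linarith : 0 < x - y)] with t ht
    rw [fluxPrim, max_eq_left ht.le, max_eq_right (by linarith), Real.zero_rpow hz]
    ring

theorem intervalIntegrable_fluxKernel_left (h2 : α < 2) (y c d : ℝ) :
    IntervalIntegrable (fun z => fluxKernel α r z y) volume c d := by
  have key : ∀ c d : ℝ, IntervalIntegrable (fun t : ℝ => (max t 0) ^ (1 - α)) volume c d := by
    intro c d
    by_cases h1 : α = 1
    · simp [h1]
    have hb := intervalIntegral.intervalIntegrable_rpow' (a := c) (b := d) (r := 1 - α) (by linarith)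
    rw [intervalIntegrable_iff] at hb ⊢
    refine (Integrable.indicator hb (measurableSet_Ioi (a := (0 : ℝ)))).congr
      (Eventually.of_forall fun t => ?_)
    change (Ioi (0 : ℝ)).indicator (fun t : ℝ => t ^ (1 - α)) t = (max t 0) ^ (1 - α)
    by_cases ht : 0 < t
    · rw [indicator_of_mem (mem_Ioi.2 ht), max_eq_left ht.le]
    · rw [indicator_of_notMem (by simpa using ht), max_eq_right (by linarith),
        Real.zero_rpow (by intro h; apply h1; linarith)]
  have k1 := (key (c - y) (d - y)).comp_sub_right y
  have k2 := (key (y - c) (y - d)).comp_sub_left y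
  simp only [sub_add_cancel, sub_sub_cancel] at k1 k2
  unfold fluxKernel
  exact (k1.const_mul _).add (k2.const_mul _)

theorem fluxPrim_sub_fluxPrim (h1 : 1 < α) (h2 : α < 2) (x₀ x₁ y : ℝ) :
    fluxPrim α r (x₁ - y) - fluxPrim α r (x₀ - y) =
      (2 - α) * ∫ z in x₀..x₁, fluxKernel α r z y := by
  rw [← intervalIntegral.integral_const_mul]
  symm
  refine integral_eq_of_hasDerivAt_off_countable (fun z => fluxPrim α r (z - y)) _
    (countable_singleton y) ?_ ?_ ((intervalIntegrable_fluxKernel_left h2 y _ _).const_mul _)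
  · exact ((continuous_fluxPrim h2).comp (continuous_sub_right y)).continuousOn
  · intro z hz
    have := (hasDerivAt_fluxPrim (r := r) h1 h2 (x := z) (y := y) hz.2).comp z
      ((hasDerivAt_id z).sub_const y)
    convert! this using 1
    ring

theorem fluxOp_one (h : Params α r a b) {x : ℝ} (hx : x ∈ Ioo (0 : ℝ) 1) :
    fluxOp α r a b 1 x = fluxConst α a b := by
  simp [fluxOp, integral_fluxKernel_mul_weight h hx]

/-- Joint integrability of the flux kernel against an integrable function. -/
theorem integrable_prod_fluxKernel (h : Params α r a b) {v : ℝ → ℝ} (hv : Integrable v volI) :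
    Integrable (fun z : ℝ × ℝ => v z.1 * (fluxKernel α r z.1 z.2 * weight (b - 1) (a - 1) z.2))
      (volI.prod volI) := by
  have hm : AEStronglyMeasurable
      (fun z : ℝ × ℝ => v z.1 * (fluxKernel α r z.1 z.2 * weight (b - 1) (a - 1) z.2))
      (volI.prod volI) := by
    refine hv.1.comp_fst.mul (Measurable.aestronglyMeasurable ?_)
    exact (measurable_fluxKernel α r).mul ((measurable_weight _ _).comp measurable_snd)
  rw [integrable_prod_iff hm]
  constructor
  · filter_upwards [ae_volI_mem] with x hx
    exact (integrableOn_fluxKernel_mul_weight h hx).const_mul (v x)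
  · refine (hv.norm.mul_const (fluxConst α a b)).congr ?_
    filter_upwards [ae_volI_mem] with x hx
    rw [← integral_fluxKernel_mul_weight h hx, ← integral_const_mul]
    refine integral_congr_ae ?_
    filter_upwards [ae_volI_mem] with y hy
    rw [norm_mul, Real.norm_of_nonneg (mul_nonneg (fluxKernel_nonneg h x y) (weight_pos _ _ hy).le)]

/-- Let τ be the constant flux of the weight. Integrating `fluxPrim` (x-y) against the weight gives
τx minus the wanted value, while by Fubini its increments in x are (2-α)τ times the increment of x.
Hence the slope τ(α-1). -/
theorem fluxOp_X (h : Params α r a b) : ∃ c, ∀ x ∈ Ioo (0 : ℝ) 1,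
    fluxOp α r a b X x = fluxConst α a b * (α - 1) * x + c := by
  set τ := fluxConst α a b
  have hS : ∀ x ∈ Ioo (0 : ℝ) 1, IntegrableOn
      (fun y => fluxPrim α r (x - y) * weight (b - 1) (a - 1) y) (Ioo 0 1) ∧
      ∫ y in Ioo (0 : ℝ) 1, fluxPrim α r (x - y) * weight (b - 1) (a - 1) y =
        τ * x - fluxOp α r a b X x := by
    intro x hx
    have hk := integrableOn_fluxKernel_mul_weight h hx
    have e : ∀ y, fluxPrim α r (x - y) * weight (b - 1) (a - 1) y =
        fluxKernel α r x y * weight (b - 1) (a - 1) y * (C x - X : ℝ[X]).eval y := by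
      intro y; rw [fluxPrim_sub h.one_lt h.lt_two]; simp; ring
    simp_rw [e]
    refine ⟨integrableOn_mul_eval hk _, ?_⟩
    have : (C x - X : ℝ[X]) = C x * 1 + C (-1) * X := by simp; ring
    change fluxOp α r a b (C x - X) x = _
    rw [this, fluxOp_add h _ _ hx, fluxOp_C_mul, fluxOp_C_mul, fluxOp_one h hx]
    ring
  have hdiff : ∀ x ∈ Ioo (0 : ℝ) 1,
      (τ * x - fluxOp α r a b X x) - (τ * (1 / 2) - fluxOp α r a b X (1 / 2)) =
        (2 - α) * (τ * (x - 1 / 2)) := by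
    intro x hx
    have hsub := uIcc_subset_Ioo half_mem hx
    rw [← (hS x hx).2, ← (hS _ half_mem).2, ← integral_sub (hS x hx).1 (hS _ half_mem).1]
    simp_rw [← sub_mul, fluxPrim_sub_fluxPrim h.one_lt h.lt_two (1 / 2) x, mul_assoc]
    rw [integral_const_mul]
    congr 1
    have hsub' : uIoc (1 / 2) x ⊆ Ioo 0 1 := uIoc_subset_uIcc.trans hsub
    -- The indicator of the unordered interval lets one Fubini argument serve both x ≥ 1/2 and x <
    -- 1/2.
    have hv : Integrable ((uIoc (1 / 2) x).indicator fun _ => (1 : ℝ)) volI :=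
      (integrable_const _).indicator measurableSet_uIoc
    have hP := integrable_prod_fluxKernel h hv
    have hsw := integral_integral_swap (μ := volI) (ν := volI)
      (f := fun z y => (uIoc (1 / 2) x).indicator (fun _ => (1 : ℝ)) z *
        (fluxKernel α r z y * weight (b - 1) (a - 1) y)) hP
    have hL : ∫ z, ∫ y, ((uIoc (1 / 2) x).indicator (fun _ => (1 : ℝ)) z) *
        (fluxKernel α r z y * weight (b - 1) (a - 1) y) ∂volI ∂volI = τ * |x - 1 / 2| := by
      have : ∀ᵐ z ∂volI, ∫ y, ((uIoc (1 / 2) x).indicator (fun _ => (1 : ℝ)) z) *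
          (fluxKernel α r z y * weight (b - 1) (a - 1) y) ∂volI =
          (uIoc (1 / 2) x).indicator (fun _ => τ) z := by
        filter_upwards [ae_volI_mem] with z hz
        rw [integral_const_mul, volI, integral_fluxKernel_mul_weight h hz]
        by_cases hzm : z ∈ uIoc (1 / 2) x
        · rw [indicator_of_mem hzm, indicator_of_mem hzm, one_mul]
        · rw [indicator_of_notMem hzm, indicator_of_notMem hzm, zero_mul]
      rw [integral_congr_ae this, integral_indicator measurableSet_uIoc, volI,
        Measure.restrict_restrict measurableSet_uIoc, inter_eq_left.2 hsub']
      rw [integral_const, smul_eq_mul, Measure.real, Measure.restrict_apply_univ, Real.volume_uIoc,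
        ENNReal.toReal_ofReal (abs_nonneg _), mul_comm]
    have hR : ∫ y, ∫ z, ((uIoc (1 / 2) x).indicator (fun _ => (1 : ℝ)) z) *
        (fluxKernel α r z y * weight (b - 1) (a - 1) y) ∂volI ∂volI =
        ∫ y in Ioo (0 : ℝ) 1, (∫ z in uIoc (1 / 2) x, fluxKernel α r z y) *
          weight (b - 1) (a - 1) y := by
      rw [volI]
      congr 1; ext y
      have e : ∀ z, ((uIoc (1 / 2) x).indicator (fun _ => (1 : ℝ)) z) *
          (fluxKernel α r z y * weight (b - 1) (a - 1) y) =
          (uIoc (1 / 2) x).indicator (fun z => fluxKernel α r z y) z * weight (b - 1) (a - 1) y := by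
        intro z
        by_cases hzm : z ∈ uIoc (1 / 2) x
        · rw [indicator_of_mem hzm, indicator_of_mem hzm, one_mul]
        · rw [indicator_of_notMem hzm, indicator_of_notMem hzm, zero_mul, zero_mul]
      simp_rw [e]
      rw [integral_mul_const, integral_indicator measurableSet_uIoc,
        Measure.restrict_restrict measurableSet_uIoc, inter_eq_left.2 hsub']
    rw [hL, hR] at hsw
    simp_rw [intervalIntegral.intervalIntegral_eq_integral_uIoc]
    split_ifs with hle
    · simp only [one_smul]
      rw [← hsw, abs_of_nonneg (by linarith)]
    · push Not at hle
      simp only [neg_smul, one_smul, neg_mul]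
      rw [integral_neg, ← hsw, abs_of_neg (by linarith)]
      ring
  refine ⟨fluxOp α r a b X (1 / 2) - τ * (α - 1) * (1 / 2), fun x hx => ?_⟩
  have := hdiff x hx
  linear_combination -this

/-- With x fixed, the y-derivative of `fluxPrim` (x-y) (1-y)^b y^(n+a) is kernel times weight times
a combination of y^n, y^(n+1), y^(n+2). The function vanishes at both endpoints, so that combination
integrates to zero. -/
theorem fluxOp_recurrence (h : Params α r a b) (n : ℕ) {x : ℝ} (hx : x ∈ Ioo (0 : ℝ) 1) :
    ((n : ℝ) + 2) * fluxOp α r a b (X ^ (n + 2)) x =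
      ((n : ℝ) + 2 - b + x * (n + α)) * fluxOp α r a b (X ^ (n + 1)) x -
        x * (n + a) * fluxOp α r a b (X ^ n) x := by
  have h1 := h.one_lt
  have h2 := h.lt_two
  have ha := h.a_pos
  have hb := h.b_pos
  set q : ℝ[X] := C ((n : ℝ) + 2) * X ^ (n + 2) + (C (-((n : ℝ) + 2 - b + x * (n + α))) * X ^ (n + 1)
    + C (x * (n + a)) * X ^ n) with hq
  have hn : (0 : ℝ) ≤ n := n.cast_nonneg
  have hzero : fluxOp α r a b q x = 0 := by
    set H : ℝ → ℝ := fun y => fluxPrim α r (x - y) * ((1 - y) ^ b * y ^ ((n : ℝ) + a)) with hH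
    have hFTC := integral_eq_of_hasDerivAt_off_countable_of_le H
      (fun y => fluxKernel α r x y * weight (b - 1) (a - 1) y * q.eval y) (zero_le_one' ℝ)
      (countable_singleton x) ?_ ?_ ?_
    · rw [intervalIntegral.integral_of_le zero_le_one, integral_Ioc_eq_integral_Ioo] at hFTC
      rw [fluxOp, hFTC]
      simp [hH, Real.zero_rpow hb.ne', Real.zero_rpow (by positivity : (n : ℝ) + a ≠ 0)]
    · refine ((continuous_fluxPrim h2).comp (continuous_sub_left x)).continuousOn.mul
        (ContinuousOn.mul ?_ ?_)
      · exact ContinuousOn.rpow_const (by fun_prop) fun _ _ => Or.inr hb.le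
      · exact ContinuousOn.rpow_const (by fun_prop) fun _ _ => Or.inr (by positivity)
    · rintro y ⟨hy, hyx⟩
      have hy0 := hy.1
      have hy1 : 0 < 1 - y := by linarith [hy.2]
      have d0 : HasDerivAt (fun y => fluxPrim α r (x - y)) (-((2 - α) * fluxKernel α r x y)) y := by
        have := (hasDerivAt_fluxPrim (r := r) h1 h2 (x := x) (y := y) (Ne.symm hyx)).comp y
          ((hasDerivAt_id y).const_sub x)
        convert! this using 1; ring
      have d1 := ((hasDerivAt_id y).const_sub 1).rpow_const (p := b) (Or.inl hy1.ne')
      have d2 := (hasDerivAt_id y).rpow_const (p := (n : ℝ) + a) (Or.inl hy0.ne')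
      convert! d0.mul (d1.mul d2) using 1
      rw [fluxPrim_sub h1 h2]
      simp only [id, hq, weight, eval_add, eval_mul, eval_C, eval_pow, eval_X, Pi.mul_apply]
      have e1 : (1 - y) ^ b = (1 - y) * (1 - y) ^ (b - 1) := by
        rw [← Real.rpow_one_add' hy1.le (by linarith)]; congr 1; ring
      have e2 : y ^ ((n : ℝ) + a) = y ^ n * y * y ^ (a - 1) := by
        rw [mul_assoc, ← Real.rpow_one_add' hy0.le (by linarith), ← Real.rpow_natCast,
          ← Real.rpow_add hy0]
        congr 1; ring
      have e3 : y ^ ((n : ℝ) + a - 1) = y ^ n * y ^ (a - 1) := by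
        rw [← Real.rpow_natCast, ← Real.rpow_add hy0]; congr 1; ring
      rw [e1, e2, e3, ← h.sum]
      ring
    · rw [intervalIntegrable_iff_integrableOn_Ioo_of_le zero_le_one]
      exact integrableOn_mul_eval (integrableOn_fluxKernel_mul_weight h hx) q
  rw [hq, fluxOp_add h _ _ hx, fluxOp_add h _ _ hx, fluxOp_C_mul, fluxOp_C_mul, fluxOp_C_mul] at hzero
  linear_combination hzero

end

/-! ### Diagonalisation in Jacobi polynomials and duality. -/

section

variable {α r a b : ℝ}

/-- The eigenvalues of the flux operator on Jacobi polynomials. -/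
def fluxEig (α a b : ℝ) (n : ℕ) : ℝ :=
  fluxConst α a b * (Real.Gamma (n + α - 1) / (Real.Gamma (α - 1) * n.factorial))

theorem fluxEig_zero (h : Params α r a b) : fluxEig α a b 0 = fluxConst α a b := by
  have : 0 < Real.Gamma (α - 1) := Real.Gamma_pos_of_pos (by linarith [h.one_lt])
  simp [fluxEig, this.ne']

theorem fluxEig_succ (h : Params α r a b) (n : ℕ) :
    fluxEig α a b (n + 1) = fluxEig α a b n * ((n : ℝ) + α - 1) / ((n : ℝ) + 1) := by
  have h1 : 0 < Real.Gamma (α - 1) := Real.Gamma_pos_of_pos (by linarith [h.one_lt])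
  have hn : (0 : ℝ) ≤ n := n.cast_nonneg
  have h2 : (n : ℝ) + α - 1 ≠ 0 := by linarith [h.one_lt]
  have e : Real.Gamma ((n + 1 : ℕ) + α - 1) = ((n : ℝ) + α - 1) * Real.Gamma (n + α - 1) := by
    rw [← Real.Gamma_add_one h2]; push_cast; congr 1; ring
  rw [fluxEig, fluxEig, e, Nat.factorial_succ]
  push_cast
  field_simp

theorem fluxEig_pos (h : Params α r a b) (n : ℕ) : 0 < fluxEig α a b n := by
  have h1 : 0 < Real.Gamma (α - 1) := Real.Gamma_pos_of_pos (by linarith [h.one_lt])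
  have hn : (0 : ℝ) ≤ n := n.cast_nonneg
  have h2 : 0 < Real.Gamma (n + α - 1) := Real.Gamma_pos_of_pos (by linarith [h.one_lt])
  have := fluxConst_pos h
  unfold fluxEig
  positivity

theorem fluxEig_comm (α a b : ℝ) (n : ℕ) : fluxEig α a b n = fluxEig α b a n := by
  simp only [fluxEig, fluxConst, add_comm]

/-- In the recurrence only x(n+α) times the previous polynomial reaches degree n+2, so the leading
coefficient is multiplied by (n+α)/(n+2), the ratio of consecutive `fluxEig`. -/
theorem exists_fluxOp_X_pow (h : Params α r a b) (n : ℕ) :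
    ∃ t : ℝ[X], t.natDegree ≤ n ∧ t.coeff n = fluxEig α a b n ∧
      ∀ x ∈ Ioo (0 : ℝ) 1, fluxOp α r a b (X ^ n) x = t.eval x := by
  induction n using Nat.twoStepInduction with
  | zero =>
    refine ⟨C (fluxConst α a b), by simp, by simp [fluxEig_zero h], fun x hx => ?_⟩
    simp [fluxOp_one h hx]
  | one =>
    obtain ⟨c, hc⟩ := fluxOp_X h
    refine ⟨C (fluxConst α a b * (α - 1)) * X + C c, natDegree_linear_le, ?_, fun x hx => ?_⟩
    · have := fluxEig_succ h 0
      rw [fluxEig_zero h] at this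
      simp only [Nat.cast_zero, zero_add, div_one] at this
      rw [this]
      simp
    · simp [hc x hx]
  | more n ih0 ih1 =>
    obtain ⟨t0, hd0, hc0, he0⟩ := ih0
    obtain ⟨t1, hd1, hc1, he1⟩ := ih1
    have hn : ((n : ℝ) + 2) ≠ 0 := by positivity
    refine ⟨C (((n : ℝ) + 2)⁻¹) * (C ((n : ℝ) + 2 - b) * t1 + C ((n : ℝ) + α) * (X * t1)
      - C ((n : ℝ) + a) * (X * t0)), ?_, ?_, fun x hx => ?_⟩
    · have hX1 : (X * t1).natDegree ≤ n + 2 := natDegree_mul_le.trans (by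
        have := natDegree_X_le (R := ℝ); omega)
      have hX0 : (X * t0).natDegree ≤ n + 2 := natDegree_mul_le.trans (by
        have := natDegree_X_le (R := ℝ); omega)
      refine (natDegree_C_mul_le _ _).trans ?_
      refine (natDegree_sub_le_of_le (natDegree_add_le_of_degree_le ?_ ?_) ?_).trans
        (max_self (n + 2)).le
      · exact (natDegree_C_mul_le _ _).trans (by omega)
      · exact (natDegree_C_mul_le _ _).trans hX1
      · exact (natDegree_C_mul_le _ _).trans hX0
    · have z1 : t1.coeff (n + 2) = 0 := coeff_eq_zero_of_natDegree_lt (by omega)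
      have z0 : t0.coeff (n + 1) = 0 := coeff_eq_zero_of_natDegree_lt (by omega)
      have := fluxEig_succ h (n + 1)
      rw [this]
      simp only [coeff_C_mul, coeff_sub, coeff_add, coeff_X_mul, z1, z0, hc1]
      push_cast
      field_simp
      ring
    · have := fluxOp_recurrence h n hx
      simp only [eval_mul, eval_C, eval_sub, eval_add, eval_X, ← he0 x hx, ← he1 x hx]
      field_simp
      rw [mul_comm, this]; ring

theorem exists_fluxOp_poly (h : Params α r a b) {p : ℝ[X]} {N : ℕ} (hp : p.natDegree ≤ N) :
    ∃ t : ℝ[X], t.natDegree ≤ N ∧ t.coeff N = fluxEig α a b N * p.coeff N ∧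
      ∀ x ∈ Ioo (0 : ℝ) 1, fluxOp α r a b p x = t.eval x := by
  choose t htd htc hte using exists_fluxOp_X_pow h
  refine ⟨∑ i ∈ Finset.range (N + 1), C (p.coeff i) * t i, ?_, ?_, fun x hx => ?_⟩
  · refine natDegree_sum_le_of_forall_le _ _ fun i hi => ?_
    have : i ≤ N := by simpa [Nat.lt_succ_iff] using hi
    exact (natDegree_C_mul_le _ _).trans ((htd i).trans this)
  · rw [finsetSum_coeff, Finset.sum_range_succ, Finset.sum_eq_zero]
    · rw [coeff_C_mul, htc]; ring
    · intro i hi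
      have hi' : i < N := by simpa using hi
      rw [coeff_C_mul, coeff_eq_zero_of_natDegree_lt ((htd i).trans_lt hi'), mul_zero]
  · have key : ∀ M : ℕ, fluxOp α r a b (∑ i ∈ Finset.range M, C (p.coeff i) * X ^ i) x =
        (∑ i ∈ Finset.range M, C (p.coeff i) * t i).eval x := by
      intro M
      induction M with
      | zero => simp [fluxOp]
      | succ M ih =>
        rw [Finset.sum_range_succ, Finset.sum_range_succ, fluxOp_add h _ _ hx, ih, fluxOp_C_mul,
          hte M x hx, eval_add, eval_mul, eval_C]
    rw [← key, ← as_sum_range_C_mul_X_pow' p (by omega)]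

/-- The flux of an integrable function. -/
def flux (α r : ℝ) (v : ℝ → ℝ) (y : ℝ) : ℝ := ∫ x in Ioo (0 : ℝ) 1, fluxKernel α r x y * v x

theorem ae_integrable_fluxKernel_mul (h : Params α r a b) {v : ℝ → ℝ} (hv : Integrable v volI) :
    ∀ᵐ y ∂volI, Integrable (fun x => fluxKernel α r x y * v x) volI := by
  have hP := (integrable_prod_fluxKernel h hv).prod_left_ae
  filter_upwards [hP, ae_volI_mem] with y hy hym
  have hw := (weight_pos (b - 1) (a - 1) hym).ne'
  refine (hy.const_mul (weight (b - 1) (a - 1) y)⁻¹).congr (Eventually.of_forall fun x => ?_)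
  simp only
  field_simp

theorem integrable_weight_mul_flux (h : Params α r a b) {v : ℝ → ℝ} (hv : Integrable v volI) :
    Integrable (flux α r v) (weightMeasure (b - 1) (a - 1)) := by
  rw [integrable_weightMeasure_iff]
  refine (integrable_prod_fluxKernel h hv).integral_prod_right.congr
    (Eventually.of_forall fun y => ?_)
  simp only [flux, volI, ← integral_const_mul]
  congr 1; ext x; ring

/-- Duality between the flux and the flux operator on polynomials. -/
theorem integral_flux_mul_eval (h : Params α r a b) {v : ℝ → ℝ} (hv : Integrable v volI)
    (p : ℝ[X]) :
    ∫ y, flux α r v y * p.eval y ∂(weightMeasure (b - 1) (a - 1)) =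
      ∫ x in Ioo (0 : ℝ) 1, v x * fluxOp α r a b p x := by
  obtain ⟨M, hM⟩ := isCompact_Icc.exists_bound_of_continuousOn (s := Icc (0 : ℝ) 1)
    (f := fun x => p.eval x) p.continuous.continuousOn
  have hP : Integrable (fun z : ℝ × ℝ => (v z.1 * (fluxKernel α r z.1 z.2 *
      weight (b - 1) (a - 1) z.2)) * p.eval z.2) (volI.prod volI) := by
    refine (integrable_prod_fluxKernel h hv).mul_bdd (c := M)
      (p.continuous.comp continuous_snd).aestronglyMeasurable ?_
    have : ∀ᵐ z : ℝ × ℝ ∂(volI.prod volI), z.2 ∈ Ioo (0 : ℝ) 1 :=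
      Measure.quasiMeasurePreserving_snd.ae ae_volI_mem
    filter_upwards [this] with z hz
    exact hM _ (Ioo_subset_Icc_self hz)
  have hsw := integral_integral_swap (μ := volI) (ν := volI) (f := fun x y =>
    (v x * (fluxKernel α r x y * weight (b - 1) (a - 1) y)) * p.eval y) hP
  rw [integral_weightMeasure]
  have e1 : ∀ y, weight (b - 1) (a - 1) y * (flux α r v y * p.eval y) =
      ∫ x, v x * (fluxKernel α r x y * weight (b - 1) (a - 1) y) * p.eval y ∂volI := by
    intro y
    rw [flux, volI, ← mul_assoc, ← integral_const_mul, ← integral_mul_const]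
    congr 1; ext x; ring
  have e2 : ∀ x, v x * fluxOp α r a b p x =
      ∫ y, v x * (fluxKernel α r x y * weight (b - 1) (a - 1) y) * p.eval y ∂volI := by
    intro x
    rw [fluxOp, volI, ← integral_const_mul]
    congr 1; ext y; ring
  simp_rw [e1, e2]
  exact hsw.symm

theorem flux_weight_mul_eval (α r a b : ℝ) (p : ℝ[X]) (y : ℝ) :
    flux α r (fun x => weight (a - 1) (b - 1) x * p.eval x) y = fluxOp α (1 - r) b a p y := by
  simp only [flux, fluxOp, fluxKernel_swap, mul_assoc]

theorem integrable_weight_mul_eval (ha : -1 < a) (hb : -1 < b) (p : ℝ[X]) :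
    Integrable (fun x => weight a b x * p.eval x) volI :=
  integrable_weightMeasure_iff.1 (integrable_eval ha hb p)

/-- Symmetry of the flux operator between the two weighted spaces. -/
theorem integral_fluxOp_symm (h : Params α r a b) (p q : ℝ[X]) :
    ∫ y, fluxOp α (1 - r) b a q y * p.eval y ∂(weightMeasure (b - 1) (a - 1)) =
      ∫ x, q.eval x * fluxOp α r a b p x ∂(weightMeasure (a - 1) (b - 1)) := by
  have := integral_flux_mul_eval h (integrable_weight_mul_eval
    (by linarith [h.a_pos]) (by linarith [h.b_pos]) q (a := a - 1) (b := b - 1)) p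
  simp_rw [flux_weight_mul_eval] at this
  rw [this, integral_weightMeasure]
  simp_rw [mul_assoc]

theorem integral_weightMeasure_congr {f g : ℝ → ℝ} (a b : ℝ) (h : ∀ x ∈ Ioo (0 : ℝ) 1, f x = g x) :
    ∫ x, f x ∂(weightMeasure a b) = ∫ x, g x ∂(weightMeasure a b) := by
  rw [integral_weightMeasure, integral_weightMeasure]
  exact setIntegral_congr_fun measurableSet_Ioo fun x hx => by simp only [h x hx]

/-- The flux operator diagonalizes in Jacobi polynomials. -/
theorem fluxOp_jacPoly (h : Params α r a b) (n : ℕ) {x : ℝ} (hx : x ∈ Ioo (0 : ℝ) 1) :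
    fluxOp α r a b (jacPoly n (b - 1) (a - 1)) x =
      fluxEig α a b n * (jacPoly n (a - 1) (b - 1)).eval x := by
  have ha : -1 < a - 1 := by linarith [h.a_pos]
  have hb : -1 < b - 1 := by linarith [h.b_pos]
  obtain ⟨t, htd, htc, hte⟩ := exists_fluxOp_poly h (natDegree_jacPoly_le n (b - 1) (a - 1))
  -- Symmetry moves the operator onto p, where the swapped operator does not raise the degree;
  -- orthogonality of the source polynomial then applies.
  have hort : ∀ p : ℝ[X], p.natDegree < n →
      ∫ x, p.eval x * t.eval x ∂(weightMeasure (a - 1) (b - 1)) = 0 := by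
    intro p hp
    have h1 := integral_fluxOp_symm h (jacPoly n (b - 1) (a - 1)) p
    obtain ⟨s, hsd, -, hse⟩ := exists_fluxOp_poly h.symm (le_refl p.natDegree)
    rw [integral_weightMeasure_congr (b - 1) (a - 1)
      (g := fun y => s.eval y * (jacPoly n (b - 1) (a - 1)).eval y) fun y hy => by rw [hse y hy],
      integral_mul_jacPoly_eq_zero n hb ha s (hsd.trans_lt hp)] at h1
    rw [h1]
    exact integral_weightMeasure_congr _ _ fun y hy => by rw [hte y hy]
  -- Leading coefficients match, so D has degree below n or is zero; since t and the Jacobi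
  -- polynomial are orthogonal to lower degrees, D would be orthogonal to itself.
  set D := t - C (fluxEig α a b n) * jacPoly n (a - 1) (b - 1) with hD
  have hDc : D.coeff n = 0 := by
    rw [hD, coeff_sub, htc, coeff_C_mul, coeff_jacPoly_comm, sub_self]
  have hDd : D.natDegree ≤ n :=
    (natDegree_sub_le_of_le htd ((natDegree_C_mul_le _ _).trans
      (natDegree_jacPoly_le n _ _))).trans (max_self n).le
  have hD0 : D = 0 := by
    by_contra hne
    have hlt : D.natDegree < n := by
      refine lt_of_le_of_ne hDd fun he => hne ?_
      rw [← leadingCoeff_eq_zero, leadingCoeff, he, hDc]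
    refine (integral_eval_sq_pos ha hb hne).ne' ?_
    have e : ∀ x, D.eval x ^ 2 = D.eval x * t.eval x -
        fluxEig α a b n * (D.eval x * (jacPoly n (a - 1) (b - 1)).eval x) := by
      intro x
      have : D.eval x = t.eval x - fluxEig α a b n * (jacPoly n (a - 1) (b - 1)).eval x := by
        rw [hD]; simp
      rw [sq]; nth_rewrite 2 [this]; ring
    simp_rw [e]
    have i := integrable_eval ha hb D
    rw [integral_sub (integrable_mul_eval i t) ((integrable_mul_eval i _).const_mul _),
      integral_const_mul, hort D hlt, integral_mul_jacPoly_eq_zero n ha hb D hlt]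
    simp
  rw [hte x hx, sub_eq_zero.1 hD0]; simp

/-- The symmetric pairing of the two degree-n eigenpolynomials, computed from either side, yields
the two norms with the same eigenvalue, since `fluxEig` is symmetric in a and b. -/
theorem jacNorm_comm (h : Params α r a b) (n : ℕ) :
    jacNorm n (b - 1) (a - 1) = jacNorm n (a - 1) (b - 1) := by
  have h1 := integral_fluxOp_symm h (jacPoly n (b - 1) (a - 1)) (jacPoly n (a - 1) (b - 1))
  rw [integral_weightMeasure_congr (b - 1) (a - 1)
    (g := fun y => fluxEig α b a n * (jacPoly n (b - 1) (a - 1)).eval y ^ 2) fun y hy => by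
      rw [fluxOp_jacPoly h.symm n hy]; ring,
    integral_weightMeasure_congr (a - 1) (b - 1)
    (g := fun y => fluxEig α a b n * (jacPoly n (a - 1) (b - 1)).eval y ^ 2) fun y hy => by
      rw [fluxOp_jacPoly h n hy]; ring, integral_const_mul, integral_const_mul, fluxEig_comm] at h1
  exact mul_left_cancel₀ (fluxEig_pos h n).ne' h1

/-- The moments of the flux. -/
theorem integral_flux_mul_jacPoly (h : Params α r a b) {v : ℝ → ℝ} (hv : Integrable v volI)
    (n : ℕ) :
    ∫ y, flux α r v y * (jacPoly n (b - 1) (a - 1)).eval y ∂(weightMeasure (b - 1) (a - 1)) =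
      fluxEig α a b n * ∫ x in Ioo (0 : ℝ) 1, v x * (jacPoly n (a - 1) (b - 1)).eval x := by
  rw [integral_flux_mul_eval h hv, ← integral_const_mul]
  refine setIntegral_congr_fun measurableSet_Ioo fun x hx => ?_
  simp only [fluxOp_jacPoly h n hx]; ring

/-- Splitting the integral at x needs integrability of kernel times u', which Fubini provides only
for almost every x. -/
theorem fracFlux_ae_eq_flux (h : Params α r a b) {u : ℝ → ℝ} (hu : Integrable (deriv u) volI) :
    ∀ᵐ x ∂volI, fracFlux α r u x = flux α r (deriv u) x := by
  filter_upwards [ae_integrable_fluxKernel_mul h hu, ae_volI_mem] with x hx hxm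
  have hsplit : flux α r (deriv u) x = (∫ s in Ioo 0 x, fluxKernel α r s x * deriv u s) +
      ∫ s in Ioo x 1, fluxKernel α r s x * deriv u s := by
    have hx' : IntegrableOn (fun s => fluxKernel α r s x * deriv u s) (Ioo 0 1) := hx
    rw [flux, ← Ioc_union_Ioo_eq_Ioo hxm.1.le hxm.2, setIntegral_union
      (Set.disjoint_left.2 fun y h1 h2 => h1.2.not_gt h2.1) measurableSet_Ioo
      (hx'.mono_set (Ioc_subset_Ioo_right hxm.2)) (hx'.mono_set (Ioo_subset_Ioo_left hxm.1.le)),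
      integral_Ioc_eq_integral_Ioo]
  rw [hsplit, fracFlux, leftFracInt, rightFracInt, intervalIntegral.integral_of_le hxm.1.le,
    intervalIntegral.integral_of_le hxm.2.le, integral_Ioc_eq_integral_Ioo,
    integral_Ioc_eq_integral_Ioo, ← mul_assoc, ← mul_assoc, ← integral_const_mul,
    ← integral_const_mul]
  congr 1
  · refine setIntegral_congr_fun measurableSet_Ioo fun s hs => ?_
    simp only [fluxKernel_of_gt h.one_lt hs.2, show 2 - α - 1 = 1 - α by ring]
    ring
  · refine setIntegral_congr_fun measurableSet_Ioo fun s hs => ?_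
    simp only [fluxKernel_of_lt h.one_lt hs.1, show 2 - α - 1 = 1 - α by ring]
    ring

end

/-! ### Weak derivatives as primitives. -/

section

theorem integrable_mul_of_locallyIntegrableOn {g φ : ℝ → ℝ}
    (hg : LocallyIntegrableOn g (Ioo 0 1)) (hφ : Continuous φ) (hc : HasCompactSupport φ)
    (hs : tsupport φ ⊆ Ioo 0 1) : Integrable (fun x => g x * φ x) := by
  have hK : IntegrableOn (fun x => g x * φ x) (tsupport φ) :=
    (hg.integrableOn_compact_subset hs hc).mul_continuousOn hφ.continuousOn hc
  refine (integrableOn_iff_integrable_of_support_subset ?_).1 hK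
  intro x hx
  refine subset_tsupport φ ?_
  intro h0
  exact hx (by simp [h0])

theorem setIntegral_mul_test {g φ : ℝ → ℝ} (hs : tsupport φ ⊆ Ioo 0 1) :
    ∫ x in Ioo (0 : ℝ) 1, g x * φ x = ∫ x, g x * φ x := by
  refine setIntegral_eq_integral_of_forall_compl_eq_zero fun x hx => ?_
  rw [image_eq_zero_of_notMem_tsupport fun hx' => hx (hs hx'), mul_zero]

/-- Locally integrable functions are determined by testing. -/
theorem ae_eq_of_forall_test {f g : ℝ → ℝ} (hf : LocallyIntegrableOn f (Ioo 0 1))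
    (hg : LocallyIntegrableOn g (Ioo 0 1))
    (h : ∀ φ : ℝ → ℝ, ContDiff ℝ ∞ φ → HasCompactSupport φ → tsupport φ ⊆ Ioo 0 1 →
      ∫ x in Ioo (0 : ℝ) 1, f x * φ x = ∫ x in Ioo (0 : ℝ) 1, g x * φ x) :
    f =ᵐ[volI] g := by
  have key := isOpen_Ioo.ae_eq_zero_of_integral_contDiff_smul_eq_zero (hf.sub hg) (by
    intro φ hφ hc hs
    have h1 := h φ hφ hc hs
    rw [setIntegral_mul_test hs, setIntegral_mul_test hs] at h1
    have e : ∀ x, φ x • (f - g) x = f x * φ x - g x * φ x := fun x => by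
      simp only [Pi.sub_apply, smul_eq_mul]; ring
    simp_rw [e]
    rw [integral_sub (integrable_mul_of_locallyIntegrableOn hf hφ.continuous hc hs)
      (integrable_mul_of_locallyIntegrableOn hg hφ.continuous hc hs), h1, sub_self])
  rw [volI, EventuallyEq, ae_restrict_iff' measurableSet_Ioo]
  filter_upwards [key] with x hx hm
  have := hx hm
  simpa [sub_eq_zero] using this

theorem HasWeakDeriv.unique {j : ℕ} {v g g' : ℝ → ℝ} (h : HasWeakDeriv j v g)
    (h' : HasWeakDeriv j v g') : g =ᵐ[volI] g' := by
  refine ae_eq_of_forall_test h.2.1 h'.2.1 fun φ h1 h2 h3 => ?_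
  have e := (h.2.2 φ h1 h2 h3).symm.trans (h'.2.2 φ h1 h2 h3)
  exact mul_left_cancel₀ (pow_ne_zero j (by norm_num)) e

theorem HasWeakDeriv.ae_eq_of_zero {v g : ℝ → ℝ} (h : HasWeakDeriv 0 v g) : v =ᵐ[volI] g := by
  refine ae_eq_of_forall_test h.1 h.2.1 fun φ h1 h2 h3 => ?_
  simpa using h.2.2 φ h1 h2 h3

theorem hasWeakDeriv_weakDeriv {j : ℕ} {v g : ℝ → ℝ} (h : HasWeakDeriv j v g) :
    HasWeakDeriv j v (weakDeriv j v) := by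
  have he : ∃ g, HasWeakDeriv j v g := ⟨g, h⟩
  unfold weakDeriv
  rw [dif_pos he]
  exact he.choose_spec

/-- Testing the relation of order j with φ' reduces higher weak derivatives to a chain of
first-order ones. -/
theorem HasWeakDeriv.succ {j : ℕ} {v g g' : ℝ → ℝ} (h : HasWeakDeriv j v g)
    (h' : HasWeakDeriv (j + 1) v g') : HasWeakDeriv 1 g g' := by
  refine ⟨h.2.1, h'.2.1, fun φ h1 h2 h3 => ?_⟩
  have hd : ContDiff ℝ ∞ (deriv φ) := (contDiff_infty_iff_deriv.1 h1).2
  have e1 := h.2.2 (deriv φ) hd h2.deriv (tsupport_deriv_subset.trans h3)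
  have e2 := h'.2.2 φ h1 h2 h3
  rw [iteratedDeriv_succ'] at e2
  rw [e2] at e1
  rw [iteratedDeriv_one, pow_one]
  have hp : ((-1 : ℝ) ^ j) ≠ 0 := pow_ne_zero j (by norm_num)
  apply mul_left_cancel₀ hp
  rw [← e1, pow_succ]; ring

theorem isPrimitive_primitive_half {g : ℝ → ℝ} (hg : LocallyIntegrableOn g (Ioo 0 1)) :
    IsPrimitive (fun x => ∫ t in (1 / 2 : ℝ)..x, g t) g :=
  ⟨hg, 0, Eventually.of_forall fun x => by simp⟩

theorem continuousOn_locallyIntegrableOn {g : ℝ → ℝ} (hg : ContinuousOn g (Ioo 0 1)) :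
    LocallyIntegrableOn g (Ioo 0 1) := hg.locallyIntegrableOn measurableSet_Ioo

theorem integral_primitive_mul_deriv {g φ : ℝ → ℝ} (hg : LocallyIntegrableOn g (Ioo 0 1))
    (hφ : ContDiff ℝ ∞ φ) (hc : HasCompactSupport φ) (hs : tsupport φ ⊆ Ioo 0 1) :
    ∫ x in Ioo (0 : ℝ) 1, (∫ t in (1 / 2 : ℝ)..x, g t) * deriv φ x =
      -∫ x in Ioo (0 : ℝ) 1, g x * φ x := by
  have hd : ContDiff ℝ ∞ (deriv φ) := (contDiff_infty_iff_deriv.1 hφ).2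
  have hV := continuousOn_primitive_half hg
  have hP := (isPrimitive_primitive_half hg).mul (isPrimitive_of_hasDerivAt (v := φ)
    hd.continuous.continuousOn fun x _ => (hφ.differentiable (by simp) x).hasDerivAt)
  have i1 := (integrable_mul_of_locallyIntegrableOn hg hφ.continuous hc hs).integrableOn
    (s := Ioo (0 : ℝ) 1)
  have i2 := (integrable_mul_of_locallyIntegrableOn (continuousOn_locallyIntegrableOn hV)
    hd.continuous hc.deriv (tsupport_deriv_subset.trans hs)).integrableOn (s := Ioo (0 : ℝ) 1)
  have hq : ContinuousOn (fun x => (∫ t in (1 / 2 : ℝ)..x, g t) / ((1 - x) * x)) (Ioo 0 1) := by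
    refine hV.div (by fun_prop) fun x hx => ?_
    have : 0 < 1 - x := by linarith [hx.2]
    exact (mul_pos this hx.1).ne'
  have hz := hP.integral_eq_zero (i1.add i2) (by
    refine ((integrable_mul_of_locallyIntegrableOn (continuousOn_locallyIntegrableOn hq)
      hφ.continuous hc hs).integrableOn).congr (Eventually.of_forall fun x => ?_)
    simp only; ring)
  have := (integral_add i1 i2).symm.trans hz
  linarith

/-- **du Bois-Reymond**: a weakly differentiable function is a primitive of its derivative. -/
theorem HasWeakDeriv.isPrimitive {v g : ℝ → ℝ} (h : HasWeakDeriv 1 v g) : IsPrimitive v g := by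
  obtain ⟨hv, hg, ht⟩ := h
  have hVc := continuousOn_primitive_half hg
  have hV := continuousOn_locallyIntegrableOn hVc
  set V : ℝ → ℝ := fun x => ∫ t in (1 / 2 : ℝ)..x, g t with hVdef
  have hw : LocallyIntegrableOn (fun x => v x - V x) (Ioo 0 1) := hv.sub hV
  have hz : ∀ φ : ℝ → ℝ, ContDiff ℝ ∞ φ → HasCompactSupport φ → tsupport φ ⊆ Ioo 0 1 →
      ∫ x, (v x - V x) * deriv φ x = 0 := by
    intro φ h1 h2 h3
    have hd : ContDiff ℝ ∞ (deriv φ) := (contDiff_infty_iff_deriv.1 h1).2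
    have h3' := tsupport_deriv_subset.trans h3
    have e1 := ht φ h1 h2 h3
    have e2 := integral_primitive_mul_deriv hg h1 h2 h3
    rw [iteratedDeriv_one, pow_one, setIntegral_mul_test h3'] at e1
    rw [setIntegral_mul_test h3'] at e2
    simp_rw [sub_mul]
    rw [integral_sub (integrable_mul_of_locallyIntegrableOn hv hd.continuous h2.deriv h3')
      (integrable_mul_of_locallyIntegrableOn hV hd.continuous h2.deriv h3'), e1, e2]
    ring
  let B : ContDiffBump (1 / 2 : ℝ) := ⟨1 / 8, 1 / 4, by norm_num, by norm_num⟩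
  set η : ℝ → ℝ := B.normed volume with hη
  have hη1 : ContDiff ℝ ∞ η := B.contDiff_normed
  have hη2 : HasCompactSupport η := B.hasCompactSupport_normed
  have hη3 : tsupport η ⊆ Ioo 0 1 := by
    rw [hη, B.tsupport_normed_eq]
    intro x hx
    rw [Metric.mem_closedBall, Real.dist_eq, abs_le] at hx
    have hB : B.rOut = 1 / 4 := rfl
    rw [hB] at hx
    constructor <;> linarith [hx.1, hx.2]
  have hη4 : ∫ x, η x = 1 := B.integral_normed
  -- η has integral one, so this is the only candidate for the constant value of v - V.
  set c : ℝ := ∫ x, (v x - V x) * η x with hcdef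
  refine ⟨hg, c, ?_⟩
  have hae : (fun x => v x - V x) =ᵐ[volI] fun _ => c := by
    refine ae_eq_of_forall_test hw (continuousOn_locallyIntegrableOn continuousOn_const) ?_
    intro ψ h1 h2 h3
    rw [setIntegral_mul_test h3, setIntegral_mul_test h3, integral_const_mul]
    set m := ∫ x, ψ x with hm
    -- Removing the mean of ψ makes its primitive Θ compactly supported, hence an admissible test
    -- function with derivative θ.
    set θ : ℝ → ℝ := fun x => ψ x - m * η x with hθ
    have hθc : ContDiff ℝ ∞ θ := h1.sub (contDiff_const.mul hη1)
    have iψ : Integrable ψ := h1.continuous.integrable_of_hasCompactSupport h2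
    have iη : Integrable η := hη1.continuous.integrable_of_hasCompactSupport hη2
    have iθ : Integrable θ := iψ.sub (iη.const_mul m)
    have hθ0 : ∫ x, θ x = 0 := by
      rw [hθ, integral_sub iψ (iη.const_mul m), integral_const_mul, hη4]; simp [hm]
    obtain ⟨lo, hi, hlo, hhi, hsub⟩ : ∃ lo hi : ℝ, 0 < lo ∧ hi < 1 ∧
        tsupport ψ ∪ tsupport η ⊆ Icc lo hi := by
      have hK : IsCompact (tsupport ψ ∪ tsupport η) := h2.isCompact.union hη2.isCompact
      have hne : (tsupport ψ ∪ tsupport η).Nonempty := by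
        rw [union_nonempty]; right
        by_contra hemp
        rw [not_nonempty_iff_eq_empty] at hemp
        rw [tsupport_eq_empty_iff.1 hemp] at hη4
        simp at hη4
      obtain ⟨lo, hlo⟩ := hK.exists_isLeast hne
      obtain ⟨hi, hhi⟩ := hK.exists_isGreatest hne
      have hU : tsupport ψ ∪ tsupport η ⊆ Ioo 0 1 := union_subset h3 hη3
      exact ⟨lo, hi, (hU hlo.1).1, (hU hhi.1).2, fun x hx => ⟨hlo.2 hx, hhi.2 hx⟩⟩
    have hθout : ∀ x, x ∉ Icc lo hi → θ x = 0 := by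
      intro x hx
      have a1 : ψ x = 0 := image_eq_zero_of_notMem_tsupport fun hx' => hx (hsub (Or.inl hx'))
      have a2 : η x = 0 := image_eq_zero_of_notMem_tsupport fun hx' => hx (hsub (Or.inr hx'))
      simp [hθ, a1, a2]
    set Θ : ℝ → ℝ := fun x => ∫ t in Iic x, θ t with hΘ
    have hΘd : ∀ x, HasDerivAt Θ (θ x) x := by
      intro x
      have e : Θ = fun y => (∫ t in Iic 0, θ t) + ∫ t in (0 : ℝ)..y, θ t := by
        ext y
        rw [← intervalIntegral.integral_Iic_sub_Iic iθ.integrableOn iθ.integrableOn]; ring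
      rw [e]
      exact (intervalIntegral.integral_hasDerivAt_right
        (hθc.continuous.intervalIntegrable _ _)
        (hθc.continuous.stronglyMeasurableAtFilter _ _) hθc.continuous.continuousAt).const_add _
    have hΘ' : deriv Θ = θ := funext fun x => (hΘd x).deriv
    have hΘc : ContDiff ℝ ∞ Θ :=
      contDiff_infty_iff_deriv.2 ⟨fun x => (hΘd x).differentiableAt, by rwa [hΘ']⟩
    have hΘout : ∀ x, x ∉ Icc lo hi → Θ x = 0 := by
      intro x hx
      rw [mem_Icc, not_and_or, not_le, not_le] at hx
      rcases hx with hx | hx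
      · exact setIntegral_eq_zero_of_forall_eq_zero fun t ht =>
          hθout t fun h' => by linarith [h'.1, mem_Iic.1 ht]
      · rw [← hθ0]
        exact setIntegral_eq_integral_of_forall_compl_eq_zero fun t ht =>
          hθout t fun h' => ht (by rw [mem_Iic]; linarith [h'.2])
    have hts : tsupport Θ ⊆ Icc lo hi :=
      closure_minimal (fun x hx => by_contra fun h' => hx (hΘout x h')) isClosed_Icc
    have hΘcs : HasCompactSupport Θ :=
      isCompact_Icc.of_isClosed_subset (isClosed_tsupport _) hts
    have h0 := hz Θ hΘc hΘcs (hts.trans fun x hx => ⟨hlo.trans_le hx.1, hx.2.trans_lt hhi⟩)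
    rw [hΘ'] at h0
    have e : ∀ x, (v x - V x) * θ x = (v x - V x) * ψ x - m * ((v x - V x) * η x) := by
      intro x; simp only [hθ]; ring
    simp_rw [e] at h0
    rw [integral_sub (integrable_mul_of_locallyIntegrableOn hw h1.continuous h2 h3)
      ((integrable_mul_of_locallyIntegrableOn hw hη1.continuous hη2 hη3).const_mul m),
      integral_const_mul] at h0
    linarith
  filter_upwards [hae] with x hx
  linarith

theorem IsPrimitive.congr {v w g h : ℝ → ℝ} (hv : IsPrimitive v g) (h1 : v =ᵐ[volI] w)
    (h2 : g =ᵐ[volI] h) : IsPrimitive w h := by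
  obtain ⟨hg, c, hc⟩ := hv
  refine ⟨?_, c, ?_⟩
  · rw [locallyIntegrableOn_iff isOpen_Ioo.isLocallyClosed] at hg ⊢
    intro k hk hkc
    exact (hg k hk hkc).congr ((ae_mono (Measure.restrict_mono hk le_rfl)) h2)
  · have h2' := (ae_restrict_iff' measurableSet_Ioo).1 h2
    filter_upwards [hc, h1, ae_volI_mem] with x hx hx1 hxm
    rw [← hx1, hx]
    congr 1
    refine intervalIntegral.integral_congr_ae ?_
    filter_upwards [h2'] with t ht htm
    exact ht (uIcc_subset_Ioo half_mem hxm (uIoc_subset_uIcc htm))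

theorem IsPrimitive.add {v w g h : ℝ → ℝ} (hv : IsPrimitive v g) (hw : IsPrimitive w h) :
    IsPrimitive (fun x => v x + w x) (fun x => g x + h x) := by
  obtain ⟨hg, c, hc⟩ := hv
  obtain ⟨hh, d, hd⟩ := hw
  refine ⟨hg.add hh, c + d, ?_⟩
  filter_upwards [hc, hd, ae_volI_mem] with x h1 h2 hx
  rw [h1, h2, intervalIntegral.integral_add
    (intervalIntegrable_of_locallyIntegrableOn hg half_mem hx)
    (intervalIntegrable_of_locallyIntegrableOn hh half_mem hx)]
  ring

theorem isPrimitive_const (c : ℝ) : IsPrimitive (fun _ => c) (fun _ => 0) :=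
  isPrimitive_of_hasDerivAt continuousOn_const fun x _ => hasDerivAt_const x c

theorem IsPrimitive.const_mul {v g : ℝ → ℝ} (hv : IsPrimitive v g) (c : ℝ) :
    IsPrimitive (fun x => c * v x) (fun x => c * g x) := by
  simpa using (isPrimitive_const c).mul hv

theorem IsPrimitive.sum {ι : Type*} (s : Finset ι) {v g : ι → ℝ → ℝ}
    (h : ∀ i ∈ s, IsPrimitive (v i) (g i)) :
    IsPrimitive (fun x => ∑ i ∈ s, v i x) (fun x => ∑ i ∈ s, g i x) := by
  classical
  induction s using Finset.induction_on with
  | empty => simpa using isPrimitive_const 0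
  | insert i s hi ih =>
    simp_rw [Finset.sum_insert hi]
    exact (h i (Finset.mem_insert_self i s)).add
      (ih fun j hj => h j (Finset.mem_insert_of_mem hj))

/-- Leibniz rule for chains of primitives. -/
theorem isPrimitive_leibniz {m : ℕ} {v w : ℕ → ℝ → ℝ}
    (hv : ∀ i < m, IsPrimitive (v i) (v (i + 1))) (hw : ∀ i < m, IsPrimitive (w i) (w (i + 1)))
    {j : ℕ} (hj : j < m) :
    IsPrimitive (fun x => ∑ p ∈ Finset.HasAntidiagonal.antidiagonal j, (j.choose p.1 : ℝ) * (v p.1 x * w p.2 x))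
      (fun x => ∑ p ∈ Finset.HasAntidiagonal.antidiagonal (j + 1),
        ((j + 1).choose p.1 : ℝ) * (v p.1 x * w p.2 x)) := by
  have h := IsPrimitive.sum (Finset.HasAntidiagonal.antidiagonal j)
    (v := fun p x => (j.choose p.1 : ℝ) * (v p.1 x * w p.2 x))
    (g := fun p x => (j.choose p.1 : ℝ) * (v (p.1 + 1) x * w p.2 x + v p.1 x * w (p.2 + 1) x))
    fun p hp => by
      have := Finset.HasAntidiagonal.mem_antidiagonal.1 hp
      exact ((hv p.1 (by omega)).mul (hw p.2 (by omega))).const_mul _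
  convert! h using 2 with x
  rw [Finset.sum_antidiagonal_choose_succ_mul (fun i k => v i x * w k x) j, ← Finset.sum_add_distrib]
  refine Finset.sum_congr rfl fun p hp => ?_
  rw [Nat.choose_symm_of_eq_add (Finset.HasAntidiagonal.mem_antidiagonal.1 hp).symm]
  ring

end

/-! ### Weighted estimates: Hardy, Jacobi energies, Poincaré, Leibniz. -/

section

/-- For y between 1/2 and x, one factor is monotone towards x. The other has base at least 1/2, so
it is at most 2, while its counterpart at x is at least 1. -/
theorem weight_neg_le {c d x y : ℝ} (hc0 : 0 ≤ c) (hc1 : c ≤ 1) (hd0 : 0 ≤ d) (hd1 : d ≤ 1)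
    (hx : x ∈ Ioo (0 : ℝ) 1) (hy : y ∈ uIoc (1 / 2) x) :
    weight (-c) (-d) y ≤ 2 * weight (-c) (-d) x := by
  have hx0 := hx.1
  have hx1 : 0 < 1 - x := by linarith [hx.2]
  have half : ∀ {z e : ℝ}, 1 / 2 ≤ z → 0 ≤ e → e ≤ 1 → z ^ (-e) ≤ 2 := by
    intro z e hz he0 he1
    calc z ^ (-e) ≤ (1 / 2 : ℝ) ^ (-e) :=
          Real.rpow_le_rpow_of_nonpos (by norm_num) hz (by linarith)
      _ ≤ (1 / 2 : ℝ) ^ (-1 : ℝ) :=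
          Real.rpow_le_rpow_of_exponent_ge (by norm_num) (by norm_num) (by linarith)
      _ = 2 := by rw [Real.rpow_neg_one]; norm_num
  have one_le : ∀ {z e : ℝ}, 0 < z → z ≤ 1 → 0 ≤ e → 1 ≤ z ^ (-e) := fun h0 h1 he =>
    Real.one_le_rpow_of_pos_of_le_one_of_nonpos h0 h1 (by linarith)
  unfold weight
  rw [mem_uIoc] at hy
  rcases hy with ⟨h1, h2⟩ | ⟨h1, h2⟩
  · have e1 : (1 - y) ^ (-c) ≤ (1 - x) ^ (-c) :=
      Real.rpow_le_rpow_of_nonpos hx1 (by linarith) (by linarith)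
    have e2 : y ^ (-d) ≤ 2 * x ^ (-d) := by
      linarith [half h1.le hd0 hd1, one_le hx0 hx.2.le hd0]
    calc _ ≤ (1 - x) ^ (-c) * (2 * x ^ (-d)) :=
          mul_le_mul e1 e2 (Real.rpow_nonneg (by linarith) _) (Real.rpow_nonneg hx1.le _)
      _ = _ := by ring
  · have e1 : y ^ (-d) ≤ x ^ (-d) := Real.rpow_le_rpow_of_nonpos hx0 h1.le (by linarith)
    have e2 : (1 - y) ^ (-c) ≤ 2 * (1 - x) ^ (-c) := by
      linarith [half (by linarith : 1 / 2 ≤ 1 - y) hc0 hc1, one_le hx1 (by linarith) hc0]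
    calc _ ≤ (2 * (1 - x) ^ (-c)) * x ^ (-d) :=
          mul_le_mul e2 e1 (Real.rpow_nonneg (by linarith) _) (by positivity)
      _ = _ := by ring

/-- A weighted Hardy-type inclusion for primitives. -/
theorem IsPrimitive.memLp {p q : ℝ} (hp0 : 0 < p) (hp1 : p ≤ 1) (hq0 : 0 < q) (hq1 : q ≤ 1)
    {v g : ℝ → ℝ} (hv : IsPrimitive v g) (hg : MemLp g 2 (weightMeasure p q)) :
    MemLp v 2 (weightMeasure (p - 1) (q - 1)) := by
  obtain ⟨hgl, c, hc⟩ := hv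
  rw [memLp_two_weightMeasure_iff] at hg ⊢
  -- Young's inequality, weighted by the quarter-power weight t at x, gives |g| ≤ t k on the path
  -- from 1/2 to x. Then the primitive of g is at most tM, and t² ω^{(p-1,q-1)} = ω^{(p/2-1,q/2-1)}
  -- is still integrable.
  set k : ℝ → ℝ := fun y => weight p q y * g y ^ 2 + 2 * weight (-(p / 2)) (-(q / 2)) y with hk
  have hki : IntegrableOn k (Ioo 0 1) :=
    hg.2.add ((integrableOn_weight (by linarith) (by linarith)).const_mul 2)
  have hk0 : ∀ y ∈ Ioo (0 : ℝ) 1, 0 ≤ k y := fun y hy => by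
    have h1 := weight_pos p q hy
    have h2 := weight_pos (-(p / 2)) (-(q / 2)) hy
    positivity
  set M := ∫ y in Ioo (0 : ℝ) 1, k y with hM
  have hbound : ∀ x ∈ Ioo (0 : ℝ) 1, |∫ t in (1 / 2 : ℝ)..x, g t| ≤
      weight (-(p / 4)) (-(q / 4)) x * M := by
    intro x hx
    set t := weight (-(p / 4)) (-(q / 4)) x with ht
    have htpos : 0 < t := weight_pos _ _ hx
    have htsq : weight (-(p / 2)) (-(q / 2)) x = t * t := by
      rw [ht, weight_mul_weight _ _ _ _ hx]; congr 1 <;> ring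
    have hsub : uIoc (1 / 2) x ⊆ Ioo 0 1 := uIoc_subset_uIcc.trans (uIcc_subset_Ioo half_mem hx)
    have hpt : ∀ y ∈ uIoc (1 / 2) x, |g y| ≤ t * k y := by
      intro y hy
      have hy' := hsub hy
      set w := weight (-(p / 2)) (-(q / 2)) y with hw
      have hwpos : 0 < w := weight_pos _ _ hy'
      have h1 := weight_neg_le (c := p / 2) (d := q / 2) (by linarith) (by linarith) (by linarith)
        (by linarith) hx hy
      rw [htsq, ← hw] at h1
      have h2 : weight p q y * (w * w) = 1 := by
        rw [hw, weight_mul_weight _ _ _ _ hy', weight_mul_weight _ _ _ _ hy',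
          show p + (-(p / 2) + -(p / 2)) = 0 by ring, show q + (-(q / 2) + -(q / 2)) = 0 by ring,
          weight_zero]
      set z := weight p q y with hz
      have hzpos : 0 < z := weight_pos _ _ hy'
      have h3 : |g y| * t ≤ t * t * (z * g y ^ 2) + w * w := by
        have h5 := two_mul_le_add_sq (t * |g y| * z) 1
        have h6 : (t * |g y| * z) ^ 2 = t * t * z * (z * g y ^ 2) := by
          rw [mul_pow, mul_pow, sq_abs]; ring
        rw [h6] at h5
        have h7 : 0 ≤ t * |g y| * z := by positivity
        have h8 : z * (|g y| * t) ≤ z * (t * t * (z * g y ^ 2) + w * w) := by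
          rw [mul_add, h2]; linarith
        exact le_of_mul_le_mul_left h8 hzpos
      have h4 : w * w ≤ t * t * (2 * w) := by nlinarith
      have h9 : |g y| * t ≤ t * k y * t := by simp only [hk]; nlinarith
      exact le_of_mul_le_mul_right h9 htpos
    rw [intervalIntegral.abs_intervalIntegral_eq]
    have hgi := intervalIntegrable_iff.1 (intervalIntegrable_of_locallyIntegrableOn hgl half_mem hx)
    calc |∫ y in uIoc (1 / 2) x, g y| ≤ ∫ y in uIoc (1 / 2) x, ‖g y‖ :=
          norm_integral_le_integral_norm g
      _ ≤ ∫ y in uIoc (1 / 2) x, t * k y :=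
          setIntegral_mono_on hgi.norm ((hki.mono_set hsub).const_mul t) measurableSet_uIoc hpt
      _ ≤ ∫ y in Ioo (0 : ℝ) 1, t * k y := by
          refine setIntegral_mono_set (hki.const_mul t) ?_ (Eventually.of_forall hsub)
          filter_upwards [ae_restrict_mem measurableSet_Ioo] with y hy
          exact mul_nonneg htpos.le (hk0 y hy)
      _ = t * M := integral_const_mul _ _
  have hmeas : AEStronglyMeasurable v volI := by
    have : AEStronglyMeasurable (fun x => c + ∫ t in (1 / 2 : ℝ)..x, g t) volI :=
      (continuousOn_const.add (continuousOn_primitive_half hgl)).aestronglyMeasurable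
        measurableSet_Ioo
    exact this.congr (hc.mono fun x hx => hx.symm)
  refine ⟨hmeas, ?_⟩
  have hdom : IntegrableOn (fun x => 2 * c ^ 2 * weight (p - 1) (q - 1) x +
      2 * M ^ 2 * weight (p / 2 - 1) (q / 2 - 1) x) (Ioo 0 1) :=
    ((integrableOn_weight (by linarith) (by linarith)).const_mul _).add
      ((integrableOn_weight (by linarith) (by linarith)).const_mul _)
  refine Integrable.mono' hdom ((measurable_weight _ _).aestronglyMeasurable.mul (hmeas.pow 2)) ?_
  filter_upwards [hc, ae_restrict_mem measurableSet_Ioo] with x hx hxm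
  have hz := weight_pos (p - 1) (q - 1) hxm
  have hb := hbound x hxm
  set I := ∫ t in (1 / 2 : ℝ)..x, g t
  have hw : weight (p / 2 - 1) (q / 2 - 1) x = weight (p - 1) (q - 1) x *
      (weight (-(p / 4)) (-(q / 4)) x * weight (-(p / 4)) (-(q / 4)) x) := by
    rw [weight_mul_weight _ _ _ _ hxm, weight_mul_weight _ _ _ _ hxm]
    congr 1 <;> ring
  rw [Real.norm_of_nonneg (by positivity), hx, hw]
  set t := weight (-(p / 4)) (-(q / 4)) x
  have hI : I ^ 2 ≤ (t * M) ^ 2 := by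
    rw [← sq_abs I]; exact pow_le_pow_left₀ (abs_nonneg _) hb 2
  have : (c + I) ^ 2 ≤ 2 * c ^ 2 + 2 * (t * M) ^ 2 := by nlinarith [sq_nonneg (c - I)]
  calc _ ≤ weight (p - 1) (q - 1) x * (2 * c ^ 2 + 2 * (t * M) ^ 2) :=
        mul_le_mul_of_nonneg_left this hz.le
    _ = _ := by ring

/-- The contribution of `G_n^{(a,b)}` to the squared norm of `v`. -/
def jacEnergy (n : ℕ) (a b : ℝ) (v : ℝ → ℝ) : ℝ :=
  (∫ x, v x * (jacPoly n a b).eval x ∂(weightMeasure a b)) ^ 2 / jacNorm n a b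

variable {a b : ℝ}

theorem jacEnergy_nonneg (ha : -1 < a) (hb : -1 < b) (n : ℕ) (v : ℝ → ℝ) : 0 ≤ jacEnergy n a b v :=
  div_nonneg (sq_nonneg _) (jacNorm_pos ha hb n).le

theorem jacEnergy_le (ha : -1 < a) (hb : -1 < b) {v : ℝ → ℝ} (hv : MemLp v 2 (weightMeasure a b))
    (s : Finset ℕ) : ∑ n ∈ s, jacEnergy n a b v ≤ ∫ x, v x ^ 2 ∂(weightMeasure a b) :=
  sum_le_hasSum s (fun n _ => jacEnergy_nonneg ha hb n v) (hasSum_jacPoly_sq ha hb hv)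

theorem integrable_of_memLp (ha : -1 < a) (hb : -1 < b) {v : ℝ → ℝ}
    (hv : MemLp v 2 (weightMeasure a b)) : Integrable v (weightMeasure a b) := by
  have := isFiniteMeasure_weightMeasure ha hb
  exact hv.integrable (by norm_num)

/-- The moments differ by exactly n+1, and by `jacNorm_succ` the norm does not grow under the shift,
because n+1 ≤ n+a+b+2; this is where a+b ≥ -1 is needed. -/
theorem jacEnergy_succ_le (ha : -1 < a) (hb : -1 < b) (hab : -1 ≤ a + b) {v g : ℝ → ℝ}
    (hv : IsPrimitive v g) (hv1 : Integrable v (weightMeasure a b))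
    (hg1 : Integrable g (weightMeasure (a + 1) (b + 1))) (n : ℕ) :
    ((n : ℝ) + 1) ^ 2 * jacEnergy (n + 1) a b v ≤ jacEnergy n (a + 1) (b + 1) g := by
  have h1 := hv.integral_mul_jacPoly hv1 hg1 n
  have h2 := jacNorm_succ ha hb n
  have p1 := jacNorm_pos ha hb (n + 1)
  have p2 := jacNorm_pos (a := a + 1) (b := b + 1) (by linarith) (by linarith) n
  have hn : (0 : ℝ) ≤ n := n.cast_nonneg
  have p3 : 0 < (n : ℝ) + a + b + 2 := by linarith
  rw [jacEnergy, jacEnergy, h1, mul_pow, mul_div_assoc]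
  refine mul_le_mul_of_nonneg_left ?_ (sq_nonneg _)
  refine div_le_div_of_nonneg_left (sq_nonneg _) p2 ?_
  nlinarith

/-- Iterated energy estimate along a chain of derivatives. -/
theorem jacEnergy_chain (ha : -1 < a) (hb : -1 < b) (hab : -1 ≤ a + b) {P : ℕ → ℝ → ℝ} (m : ℕ)
    (hP : ∀ j < m, IsPrimitive (P j) (P (j + 1)))
    (hL : ∀ j ≤ m, MemLp (P j) 2 (weightMeasure (a + j) (b + j))) (n : ℕ) :
    (((n : ℝ) + 1) ^ m) ^ 2 * jacEnergy (n + m) a b (P 0) ≤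
      jacEnergy n (a + m) (b + m) (P m) := by
  induction m generalizing n with
  | zero => simp
  | succ m ih =>
    have hm : (0 : ℝ) ≤ m := m.cast_nonneg
    have hn : (0 : ℝ) ≤ n := n.cast_nonneg
    have h1 := ih (fun j hj => hP j (by omega)) (fun j hj => hL j (by omega)) (n + 1)
    have i1 := integrable_of_memLp (by linarith) (by linarith) (hL m (by omega))
    have hLm := hL (m + 1) le_rfl
    have e1 : a + ((m + 1 : ℕ) : ℝ) = a + m + 1 := by push_cast; ring
    have e2 : b + ((m + 1 : ℕ) : ℝ) = b + m + 1 := by push_cast; ring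
    rw [e1, e2] at hLm ⊢
    have i2 := integrable_of_memLp (by linarith) (by linarith) hLm
    have h2 := jacEnergy_succ_le (by linarith) (by linarith) (by linarith) (hP m (by omega)) i1 i2 n
    refine le_trans ?_ h2
    have h3 : (((n : ℝ) + 1) ^ m) ^ 2 ≤ ((((n + 1 : ℕ) : ℝ) + 1) ^ m) ^ 2 := by
      push_cast; gcongr; linarith
    have h4 := jacEnergy_nonneg ha hb (n + 1 + m) (P 0)
    rw [show n + (m + 1) = n + 1 + m by ring]
    calc (((n : ℝ) + 1) ^ (m + 1)) ^ 2 * jacEnergy (n + 1 + m) a b (P 0)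
        = ((n : ℝ) + 1) ^ 2 * ((((n : ℝ) + 1) ^ m) ^ 2 * jacEnergy (n + 1 + m) a b (P 0)) := by ring
      _ ≤ ((n : ℝ) + 1) ^ 2 * ((((((n + 1 : ℕ) : ℝ) + 1) ^ m) ^ 2) *
            jacEnergy (n + 1 + m) a b (P 0)) := by gcongr
      _ ≤ _ := by gcongr

theorem summable_jacEnergy (ha : -1 < a) (hb : -1 < b) {v : ℝ → ℝ}
    (hv : MemLp v 2 (weightMeasure a b)) : Summable fun n => jacEnergy n a b v :=
  (hasSum_jacPoly_sq ha hb hv).summable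

theorem tsum_jacEnergy (ha : -1 < a) (hb : -1 < b) {v : ℝ → ℝ}
    (hv : MemLp v 2 (weightMeasure a b)) :
    ∑' n, jacEnergy n a b v = ∫ x, v x ^ 2 ∂(weightMeasure a b) :=
  (hasSum_jacPoly_sq ha hb hv).tsum_eq

/-- Decay of Jacobi coefficients along a chain of derivatives. -/
theorem tsum_pow_mul_jacEnergy_le (ha : -1 < a) (hb : -1 < b) (hab : -1 ≤ a + b)
    {P : ℕ → ℝ → ℝ} {m : ℕ} (hm : 1 ≤ m)
    (hP : ∀ j < m, IsPrimitive (P j) (P (j + 1)))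
    (hL : ∀ j ≤ m, MemLp (P j) 2 (weightMeasure (a + j) (b + j))) :
    (Summable fun n : ℕ => ((n : ℝ) ^ m) ^ 2 * jacEnergy n a b (P 0)) ∧
    ∑' n : ℕ, ((n : ℝ) ^ m) ^ 2 * jacEnergy n a b (P 0) ≤
      ((m : ℝ) ^ m) ^ 2 * ((∫ x, P 0 x ^ 2 ∂(weightMeasure a b)) +
        ∫ x, P m x ^ 2 ∂(weightMeasure (a + m) (b + m))) := by
  have hm0 : (1 : ℝ) ≤ m := by exact_mod_cast hm
  have ha' : -1 < a + m := by linarith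
  have hb' : -1 < b + m := by linarith
  have hL0 : MemLp (P 0) 2 (weightMeasure a b) := by simpa using hL 0 (by omega)
  have hLm := hL m le_rfl
  have key : ∀ n : ℕ, (((n + m : ℕ) : ℝ) ^ m) ^ 2 * jacEnergy (n + m) a b (P 0) ≤
      ((m : ℝ) ^ m) ^ 2 * jacEnergy n (a + m) (b + m) (P m) := by
    intro n
    have hn : (0 : ℝ) ≤ n := n.cast_nonneg
    have h1 := jacEnergy_chain ha hb hab m hP hL n
    have h2 : (((n + m : ℕ) : ℝ) ^ m) ^ 2 ≤ ((m : ℝ) ^ m) ^ 2 * (((n : ℝ) + 1) ^ m) ^ 2 := by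
      rw [← mul_pow, ← mul_pow]
      push_cast
      gcongr
      nlinarith
    calc _ ≤ (((m : ℝ) ^ m) ^ 2 * (((n : ℝ) + 1) ^ m) ^ 2) * jacEnergy (n + m) a b (P 0) :=
          mul_le_mul_of_nonneg_right h2 (jacEnergy_nonneg ha hb _ _)
      _ = ((m : ℝ) ^ m) ^ 2 * ((((n : ℝ) + 1) ^ m) ^ 2 * jacEnergy (n + m) a b (P 0)) := by ring
      _ ≤ _ := by gcongr
  have hs2 := (summable_jacEnergy ha' hb' hLm).mul_left (((m : ℝ) ^ m) ^ 2)
  have hs1 : Summable fun n : ℕ => (((n + m : ℕ) : ℝ) ^ m) ^ 2 * jacEnergy (n + m) a b (P 0) :=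
    Summable.of_nonneg_of_le (fun n => mul_nonneg (sq_nonneg _) (jacEnergy_nonneg ha hb _ _)) key hs2
  have hs : Summable fun n : ℕ => ((n : ℝ) ^ m) ^ 2 * jacEnergy n a b (P 0) :=
    (summable_nat_add_iff m).1 hs1
  refine ⟨hs, ?_⟩
  -- Indices below m are controlled by the norm of the function itself, the others by Parseval for
  -- its m-th derivative.
  rw [← hs.sum_add_tsum_nat_add m, mul_add]
  refine add_le_add ?_ ?_
  · refine le_trans ?_ (mul_le_mul_of_nonneg_left (jacEnergy_le ha hb hL0 (Finset.range m))
      (sq_nonneg _))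
    rw [Finset.mul_sum]
    refine Finset.sum_le_sum fun n hn => ?_
    have hnm : (n : ℝ) ≤ m := by exact_mod_cast (Finset.mem_range.1 hn).le
    have := jacEnergy_nonneg ha hb n (P 0)
    gcongr
  · rw [← tsum_jacEnergy ha' hb' hLm, ← tsum_mul_left]
    exact hs1.tsum_le_tsum key hs2

/-- Weighted Poincaré inequality. -/
theorem exists_poincare (ha : -1 < a) (hb : -1 < b) (hab : -1 ≤ a + b) {v g : ℝ → ℝ}
    (hv : IsPrimitive v g) (hv1 : MemLp v 2 (weightMeasure a b))
    (hg1 : MemLp g 2 (weightMeasure (a + 1) (b + 1))) :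
    ∃ c, ∫ x, (v x - c) ^ 2 ∂(weightMeasure a b) ≤
      ∫ x, g x ^ 2 ∂(weightMeasure (a + 1) (b + 1)) := by
  have hfin := isFiniteMeasure_weightMeasure ha hb
  -- `jacNorm 0` is the total mass, so c is the weighted mean and v - c has no zeroth Jacobi energy.
  set c := (∫ x, v x ∂(weightMeasure a b)) / jacNorm 0 a b with hc
  refine ⟨c, ?_⟩
  have hN := jacNorm_pos ha hb 0
  have hw : MemLp (fun x => v x - c) 2 (weightMeasure a b) := hv1.sub (memLp_const c)
  have hwp : IsPrimitive (fun x => v x - c) g := by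
    have := hv.add (isPrimitive_const (-c))
    simpa [sub_eq_add_neg] using this
  have hE0 : jacEnergy 0 a b (fun x => v x - c) = 0 := by
    have hN1 : jacNorm 0 a b = ∫ _, (1 : ℝ) ∂(weightMeasure a b) := by simp [jacNorm, jacPoly_zero]
    have : ∫ x, (v x - c) ∂(weightMeasure a b) = 0 := by
      rw [integral_sub (integrable_of_memLp ha hb hv1) (integrable_const c)]
      have : ∫ _, c ∂(weightMeasure a b) = c * jacNorm 0 a b := by
        rw [hN1, ← integral_const_mul, mul_one]
      rw [this, hc, div_mul_cancel₀ _ hN.ne', sub_self]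
    simp [jacEnergy, jacPoly_zero, this]
  have hs := summable_jacEnergy ha hb hw
  have ha' : -1 < a + 1 := by linarith
  have hb' : -1 < b + 1 := by linarith
  rw [← tsum_jacEnergy ha hb hw, ← hs.sum_add_tsum_nat_add 1, Finset.sum_range_one, hE0, zero_add,
    ← tsum_jacEnergy ha' hb' hg1]
  refine ((summable_nat_add_iff 1).2 hs).tsum_le_tsum (fun n => ?_) (summable_jacEnergy ha' hb' hg1)
  refine le_trans ?_ (jacEnergy_succ_le ha hb hab hwp (integrable_of_memLp ha hb hw)
    (integrable_of_memLp ha' hb' hg1) n)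
  refine le_mul_of_one_le_left (jacEnergy_nonneg ha hb _ _) ?_
  have hn : (0 : ℝ) ≤ n := n.cast_nonneg
  nlinarith

theorem memLp_mul_of_bounded {κ v : ℝ → ℝ} {W : ℝ} (hκm : AEStronglyMeasurable κ volI)
    (hκ : ∀ᵐ x ∂volI, |κ x| ≤ W) (hv : MemLp v 2 (weightMeasure a b)) :
    MemLp (fun x => κ x * v x) 2 (weightMeasure a b) := by
  refine hv.of_le_mul (c := W) ((aestronglyMeasurable_weightMeasure_iff.2 hκm).mul hv.1) ?_
  rw [ae_weightMeasure]
  filter_upwards [hκ] with x hx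
  rw [norm_mul]
  exact mul_le_mul_of_nonneg_right hx (norm_nonneg _)

/-- Norm bound for a Leibniz sum. -/
theorem integral_leibniz_sq_le {m : ℕ} {κ H : ℕ → ℝ → ℝ} {W E : ℝ}
    (hκm : ∀ i ≤ m, AEStronglyMeasurable (κ i) volI)
    (hκ : ∀ i ≤ m, ∀ᵐ x ∂volI, |κ i x| ≤ W)
    (hH : ∀ k ≤ m, MemLp (H k) 2 (weightMeasure (a + k) (b + k)))
    (hE : ∀ k ≤ m, ∫ x, H k x ^ 2 ∂(weightMeasure (a + k) (b + k)) ≤ E) {j : ℕ} (hj : j ≤ m) :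
    MemLp (fun x => ∑ p ∈ Finset.HasAntidiagonal.antidiagonal j,
        (j.choose p.1 : ℝ) * (κ p.1 x * H p.2 x)) 2 (weightMeasure (a + j) (b + j)) ∧
    ∫ x, (∑ p ∈ Finset.HasAntidiagonal.antidiagonal j,
        (j.choose p.1 : ℝ) * (κ p.1 x * H p.2 x)) ^ 2 ∂(weightMeasure (a + j) (b + j)) ≤
      (2 ^ j) ^ 2 * W ^ 2 * E := by
  have hmem : ∀ p ∈ Finset.HasAntidiagonal.antidiagonal j, p.1 ≤ m ∧ p.2 ≤ m ∧ p.2 ≤ j := by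
    intro p hp
    have := Finset.HasAntidiagonal.mem_antidiagonal.1 hp
    omega
  -- Larger exponents mean a smaller weight on (0,1), so lower derivatives are also controlled in
  -- the weight of order j.
  have hmono : ∀ p ∈ Finset.HasAntidiagonal.antidiagonal j,
      weightMeasure (a + j) (b + j) ≤ weightMeasure (a + p.2) (b + p.2) := by
    intro p hp
    have : (p.2 : ℝ) ≤ j := by exact_mod_cast (hmem p hp).2.2
    exact weightMeasure_mono (by linarith) (by linarith)
  have hH' : ∀ p ∈ Finset.HasAntidiagonal.antidiagonal j,
      MemLp (H p.2) 2 (weightMeasure (a + j) (b + j)) := fun p hp =>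
    (hH p.2 (hmem p hp).2.1).mono_measure (hmono p hp)
  have hLp : MemLp (fun x => ∑ p ∈ Finset.HasAntidiagonal.antidiagonal j,
      (j.choose p.1 : ℝ) * (κ p.1 x * H p.2 x)) 2 (weightMeasure (a + j) (b + j)) :=
    memLp_finsetSum _ fun p hp =>
      (memLp_mul_of_bounded (hκm _ (hmem p hp).1) (hκ _ (hmem p hp).1) (hH' p hp)).const_mul _
  refine ⟨hLp, ?_⟩
  have hsumC : ∑ p ∈ Finset.HasAntidiagonal.antidiagonal j, (j.choose p.1 : ℝ) = 2 ^ j := by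
    rw [Finset.Nat.sum_antidiagonal_eq_sum_range_succ_mk]
    exact_mod_cast Nat.sum_range_choose j
  have hpt : ∀ᵐ x ∂(weightMeasure (a + j) (b + j)),
      (∑ p ∈ Finset.HasAntidiagonal.antidiagonal j, (j.choose p.1 : ℝ) * (κ p.1 x * H p.2 x)) ^ 2 ≤
      2 ^ j * ∑ p ∈ Finset.HasAntidiagonal.antidiagonal j,
        (j.choose p.1 : ℝ) * (W ^ 2 * H p.2 x ^ 2) := by
    rw [ae_weightMeasure]
    have hall : ∀ᵐ x ∂volI, ∀ p ∈ Finset.HasAntidiagonal.antidiagonal j, |κ p.1 x| ≤ W :=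
      (Finset.eventually_all _).2 fun p hp => hκ _ (hmem p hp).1
    filter_upwards [hall] with x hx
    -- Cauchy–Schwarz with the binomial coefficients as weights, whose total is 2^j.
    have h1 := Finset.sum_sq_le_sum_mul_sum_of_sq_le_mul (Finset.HasAntidiagonal.antidiagonal j)
      (r := fun p => (j.choose p.1 : ℝ) * (κ p.1 x * H p.2 x)) (f := fun p => (j.choose p.1 : ℝ))
      (g := fun p => (j.choose p.1 : ℝ) * (κ p.1 x ^ 2 * H p.2 x ^ 2))
      (fun p _ => by positivity) (fun p _ => by positivity) (fun p _ => le_of_eq (by ring))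
    rw [hsumC] at h1
    refine h1.trans (mul_le_mul_of_nonneg_left (Finset.sum_le_sum fun p hp => ?_) (by positivity))
    have h2 : κ p.1 x ^ 2 ≤ W ^ 2 := by
      rw [← sq_abs]; exact pow_le_pow_left₀ (abs_nonneg _) (hx p hp) 2
    gcongr
  have hint : ∀ p ∈ Finset.HasAntidiagonal.antidiagonal j,
      Integrable (fun x => (j.choose p.1 : ℝ) * (W ^ 2 * H p.2 x ^ 2))
        (weightMeasure (a + j) (b + j)) := fun p hp =>
    ((hH' p hp).integrable_sq.const_mul _).const_mul _
  calc _ ≤ ∫ x, 2 ^ j * ∑ p ∈ Finset.HasAntidiagonal.antidiagonal j,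
        (j.choose p.1 : ℝ) * (W ^ 2 * H p.2 x ^ 2) ∂(weightMeasure (a + j) (b + j)) :=
        integral_mono_ae hLp.integrable_sq ((integrable_finsetSum _ hint).const_mul _) hpt
    _ = 2 ^ j * ∑ p ∈ Finset.HasAntidiagonal.antidiagonal j, (j.choose p.1 : ℝ) *
        (W ^ 2 * ∫ x, H p.2 x ^ 2 ∂(weightMeasure (a + j) (b + j))) := by
        rw [integral_const_mul, integral_finsetSum _ hint]
        simp_rw [integral_const_mul]
    _ ≤ 2 ^ j * ∑ p ∈ Finset.HasAntidiagonal.antidiagonal j, (j.choose p.1 : ℝ) * (W ^ 2 * E) := by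
        refine mul_le_mul_of_nonneg_left (Finset.sum_le_sum fun p hp => ?_) (by positivity)
        have : ∫ x, H p.2 x ^ 2 ∂(weightMeasure (a + j) (b + j)) ≤ E :=
          (integral_mono_measure (hmono p hp) (Eventually.of_forall fun x => sq_nonneg _)
            (hH p.2 (hmem p hp).2.1).integrable_sq).trans (hE p.2 (hmem p hp).2.1)
        gcongr
    _ = _ := by rw [← Finset.sum_mul, hsumC]; ring

end

/-! ### Size of the eigenvalues and bounds on the data. -/

section

variable {α r a b : ℝ}

/-- The reflection formula at α-1 gives sin(πα) = -π/(Γ(α-1)Γ(2-α)), which accounts for the minus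
sign. -/
theorem lam_eq (h : Params α r (α - b) b) (i : ℕ) :
    lam α b i = -(((i : ℝ) + 1) * fluxEig α (α - b) b (i + 1)) := by
  have hS := h.sin_add_pos
  have h1 : 0 < Real.Gamma (α - 1) := Real.Gamma_pos_of_pos (by linarith [h.one_lt])
  have h2 := h.Gamma_pos
  have h3 := Real.Gamma_mul_Gamma_one_sub (α - 1)
  rw [show 1 - (α - 1) = 2 - α by ring,
    show Real.pi * (α - 1) = Real.pi * α - Real.pi by ring, Real.sin_sub_pi] at h3
  have h4 : Real.sin (Real.pi * α) ≠ 0 := by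
    intro h0
    rw [h0, neg_zero, div_zero] at h3
    exact (mul_pos h1 h2).ne' h3
  have h5 : Real.sin (Real.pi * α) = -(Real.pi / (Real.Gamma (α - 1) * Real.Gamma (2 - α))) := by
    rw [h3]
    have := Real.pi_pos.ne'
    field_simp
  have h6 : (i.factorial : ℝ) ≠ 0 := by positivity
  have h7 : (i : ℝ) + 1 ≠ 0 := by positivity
  rw [lam, fluxEig, fluxConst, Nat.factorial_succ, h5]
  push_cast
  rw [show (i : ℝ) + 1 + α - 1 = i + α by ring]
  field_simp

/-- Log-convexity of Γ between i+α and i+α+1, with weights α-1 and 2-α, gives (i+1)! ≤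
Γ(i+α)(i+α)^(2-α), and hence the growth of |λ_i|. -/
theorem exists_le_mul_fluxEig (h : Params α r a b) :
    ∃ k : ℝ, 0 < k ∧ ∀ i : ℕ,
      k * ((i : ℝ) + 1) ^ (α - 1) ≤ ((i : ℝ) + 1) * fluxEig α a b (i + 1) := by
  have h1 : 0 < Real.Gamma (α - 1) := Real.Gamma_pos_of_pos (by linarith [h.one_lt])
  have hα := h.one_lt
  have hα' := h.lt_two
  have hF := fluxConst_pos h
  refine ⟨fluxConst α a b / (2 * Real.Gamma (α - 1)), by positivity, fun i => ?_⟩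
  have hi : (0 : ℝ) ≤ i := i.cast_nonneg
  have hG : 0 < Real.Gamma (i + α) := Real.Gamma_pos_of_pos (by linarith)
  have key : ((i : ℝ) + 1) ^ (α - 1) / 2 ≤ Real.Gamma (i + α) / i.factorial := by
    have g1 := Real.Gamma_mul_add_mul_le_rpow_Gamma_mul_rpow_Gamma (s := i + α) (t := i + α + 1)
      (a := α - 1) (b := 2 - α) (by linarith) (by linarith) (by linarith) (by linarith) (by ring)
    rw [show (α - 1) * ((i : ℝ) + α) + (2 - α) * (i + α + 1) = ((i + 1 : ℕ) : ℝ) + 1 by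
        push_cast; ring, Real.Gamma_nat_eq_factorial,
      Real.Gamma_add_one (by linarith : 0 < (i : ℝ) + α).ne', mul_comm ((i : ℝ) + α),
      Real.mul_rpow hG.le (by linarith), ← mul_assoc, ← Real.rpow_add hG,
      show α - 1 + (2 - α) = 1 by ring, Real.rpow_one, Nat.factorial_succ] at g1
    push_cast at g1
    have g2 : ((i : ℝ) + α) ^ (2 - α) ≤ 2 * ((i : ℝ) + 1) ^ (2 - α) := by
      calc ((i : ℝ) + α) ^ (2 - α) ≤ (2 * ((i : ℝ) + 1)) ^ (2 - α) :=
            Real.rpow_le_rpow (by linarith) (by linarith) (by linarith)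
        _ = 2 ^ (2 - α) * ((i : ℝ) + 1) ^ (2 - α) := Real.mul_rpow (by norm_num) (by linarith)
        _ ≤ 2 ^ (1 : ℝ) * ((i : ℝ) + 1) ^ (2 - α) := by
            gcongr
            · norm_num
            · linarith
        _ = _ := by rw [Real.rpow_one]
    have g3 : ((i : ℝ) + 1) ^ (α - 1) * ((i : ℝ) + 1) ^ (2 - α) = (i : ℝ) + 1 := by
      rw [← Real.rpow_add (by linarith), show α - 1 + (2 - α) = 1 by ring, Real.rpow_one]
    have g4 : 0 < ((i : ℝ) + 1) ^ (2 - α) := Real.rpow_pos_of_pos (by linarith) _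
    rw [le_div_iff₀ (by positivity)]
    refine le_of_mul_le_mul_right ?_ g4
    calc ((i : ℝ) + 1) ^ (α - 1) / 2 * i.factorial * ((i : ℝ) + 1) ^ (2 - α)
        = (((i : ℝ) + 1) ^ (α - 1) * ((i : ℝ) + 1) ^ (2 - α)) * i.factorial / 2 := by ring
      _ = ((i : ℝ) + 1) * i.factorial / 2 := by rw [g3]
      _ ≤ Real.Gamma (i + α) * ((i : ℝ) + α) ^ (2 - α) / 2 := by gcongr
      _ ≤ Real.Gamma (i + α) * (2 * ((i : ℝ) + 1) ^ (2 - α)) / 2 := by gcongr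
      _ = _ := by ring
  have h6 : (i.factorial : ℝ) ≠ 0 := by positivity
  have h7 : (i : ℝ) + 1 ≠ 0 := by positivity
  have h8 : ((i : ℝ) + 1) * fluxEig α a b (i + 1) =
      fluxConst α a b / Real.Gamma (α - 1) * (Real.Gamma (i + α) / i.factorial) := by
    rw [fluxEig, Nat.factorial_succ]
    push_cast
    rw [show (i : ℝ) + 1 + α - 1 = i + α by ring]
    field_simp
  rw [h8]
  calc fluxConst α a b / (2 * Real.Gamma (α - 1)) * ((i : ℝ) + 1) ^ (α - 1)
      = fluxConst α a b / Real.Gamma (α - 1) * (((i : ℝ) + 1) ^ (α - 1) / 2) := by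
        field_simp
    _ ≤ _ := by gcongr

theorem isPrimitive_integral {f : ℝ → ℝ} (hf : LocallyIntegrableOn f (Ioo 0 1))
    (hfi : ∀ x ∈ Ioo (0 : ℝ) 1, IntervalIntegrable f volume 0 x) (A : ℝ) :
    IsPrimitive (fun x => (∫ y in (0 : ℝ)..x, f y) - A) f := by
  refine ⟨hf, (∫ y in (0 : ℝ)..(1 / 2), f y) - A, ?_⟩
  filter_upwards [ae_volI_mem] with x hx
  rw [← intervalIntegral.integral_add_adjacent_intervals (hfi _ half_mem)
    (intervalIntegrable_of_locallyIntegrableOn hf half_mem hx)]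
  ring

theorem MemWInf.ae_abs_le {m : ℕ} {v : ℝ → ℝ} (hv : MemWInf m v) {j : ℕ} (hj : j ≤ m) :
    ∀ᵐ x ∂volI, |weakDeriv j v x| ≤ wInfNorm m v := by
  have hfin : ∀ j ≤ m, eLpNorm (weakDeriv j v) ⊤ volI < ⊤ := by
    intro j hj
    obtain ⟨g, hg, hgL⟩ := hv j hj
    rw [eLpNorm_congr_ae ((hasWeakDeriv_weakDeriv hg).unique hg)]
    exact hgL.2
  have hsup : ((Finset.range (m + 1)).sup fun j => eLpNorm (weakDeriv j v) ⊤ volI) < ⊤ :=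
    (Finset.sup_lt_iff (by simp)).2 fun j hj => hfin j (by simpa [Nat.lt_succ_iff] using hj)
  have hle : eLpNorm (weakDeriv j v) ⊤ volI ≤
      (Finset.range (m + 1)).sup fun j => eLpNorm (weakDeriv j v) ⊤ volI :=
    Finset.le_sup (f := fun j => eLpNorm (weakDeriv j v) ⊤ volI) (by simpa [Nat.lt_succ_iff] using hj)
  rw [eLpNorm_exponent_top] at hle
  filter_upwards [ae_le_eLpNormEssSup (f := weakDeriv j v) (μ := volI)] with x hx
  have := (ENNReal.toReal_le_toReal (by simp) hsup.ne).2 (hx.trans hle)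
  simpa [wInfNorm] using this

theorem MemWInf.isPrimitive {m : ℕ} {v : ℝ → ℝ} (hv : MemWInf m v) {j : ℕ} (hj : j < m) :
    IsPrimitive (weakDeriv j v) (weakDeriv (j + 1) v) := by
  obtain ⟨g, hg, -⟩ := hv j hj.le
  obtain ⟨g', hg', -⟩ := hv (j + 1) hj
  exact ((hasWeakDeriv_weakDeriv hg).succ (hasWeakDeriv_weakDeriv hg')).isPrimitive

theorem MemWInf.aestronglyMeasurable {m : ℕ} {v : ℝ → ℝ} (hv : MemWInf m v) {j : ℕ} (hj : j ≤ m) :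
    AEStronglyMeasurable (weakDeriv j v) volI := by
  obtain ⟨g, hg, hgL⟩ := hv j hj
  exact hgL.1.congr (hg.unique (hasWeakDeriv_weakDeriv hg))

theorem MemH.isPrimitive {m : ℕ} {v : ℝ → ℝ} (hv : MemH m a b v) {j : ℕ} (hj : j < m) :
    IsPrimitive (weakDeriv j v) (weakDeriv (j + 1) v) := by
  obtain ⟨g, hg, -⟩ := hv j hj.le
  obtain ⟨g', hg', -⟩ := hv (j + 1) hj
  exact ((hasWeakDeriv_weakDeriv hg).succ (hasWeakDeriv_weakDeriv hg')).isPrimitive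

theorem MemH.memLp {m : ℕ} {v : ℝ → ℝ} (hv : MemH m a b v) {j : ℕ} (hj : j ≤ m) :
    MemLp (weakDeriv j v) 2 (weightMeasure (a + j) (b + j)) := by
  obtain ⟨g, hg, hgL⟩ := hv j hj
  refine hgL.ae_eq ?_
  rw [EventuallyEq, ae_weightMeasure]
  exact hg.unique (hasWeakDeriv_weakDeriv hg)

theorem MemH.integral_sq_le {m : ℕ} {v : ℝ → ℝ} (hv : MemH m a b v) {j : ℕ} (hj : j ≤ m) :
    ∫ x, weakDeriv j v x ^ 2 ∂(weightMeasure (a + j) (b + j)) ≤ hNorm m a b v ^ 2 := by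
  rw [integral_sq_eq _ _ (hv.memLp hj), hNorm, Real.sq_sqrt (Finset.sum_nonneg fun _ _ => sq_nonneg _)]
  exact Finset.single_le_sum (f := fun j : ℕ => wNorm (a + j) (b + j) (weakDeriv j v) ^ 2)
    (fun _ _ => sq_nonneg _) (by simpa [Nat.lt_succ_iff] using hj)

theorem MemH.locallyIntegrableOn {m : ℕ} {v : ℝ → ℝ} (hv : MemH m a b v) :
    LocallyIntegrableOn v (Ioo 0 1) := (hv 0 (Nat.zero_le _)).choose_spec.1.1

theorem MemH.ae_eq {m : ℕ} {v : ℝ → ℝ} (hv : MemH m a b v) : v =ᵐ[volI] weakDeriv 0 v :=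
  (hasWeakDeriv_weakDeriv (hv 0 (Nat.zero_le _)).choose_spec.1).ae_eq_of_zero

theorem MemWInf.ae_eq {m : ℕ} {v : ℝ → ℝ} (hv : MemWInf m v) : v =ᵐ[volI] weakDeriv 0 v :=
  (hasWeakDeriv_weakDeriv (hv 0 (Nat.zero_le _)).choose_spec.1).ae_eq_of_zero

/-- Subtracting the weighted mean is optimal up to the oscillation of the weight. -/
theorem integral_sub_sq_le (ha : -1 < a) (hb : -1 < b) {κ F : ℝ → ℝ} {k₀ k₁ A : ℝ}
    (hk : 0 < k₀) (hκm : AEStronglyMeasurable κ volI)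
    (hκ : ∀ᵐ x ∂volI, k₀ ≤ κ x ∧ κ x ≤ k₁) (hF : MemLp F 2 (weightMeasure a b))
    (hA : ∫ x, κ x * (F x - A) ∂(weightMeasure a b) = 0) (c : ℝ) :
    ∫ x, (F x - A) ^ 2 ∂(weightMeasure a b) ≤
      k₁ / k₀ * ∫ x, (F x - c) ^ 2 ∂(weightMeasure a b) := by
  have := isFiniteMeasure_weightMeasure ha hb
  have hκ' : ∀ᵐ x ∂(weightMeasure a b), k₀ ≤ κ x ∧ κ x ≤ k₁ := by rw [ae_weightMeasure]; exact hκ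
  have hκb : ∀ᵐ x ∂volI, |κ x| ≤ k₁ := by
    filter_upwards [hκ] with x hx
    rw [abs_of_pos (hk.trans_le hx.1)]; exact hx.2
  have hm : ∀ d : ℝ, MemLp (fun x => F x - d) 2 (weightMeasure a b) := fun d =>
    hF.sub (memLp_const d)
  have hi : ∀ d : ℝ, Integrable (fun x => κ x * (F x - d) ^ 2) (weightMeasure a b) := fun d => by
    have := (memLp_mul_of_bounded hκm hκb (hm d)).integrable_mul (hm d)
    refine this.congr (Eventually.of_forall fun x => ?_)
    simp only [Pi.mul_apply]; ring
  have hi1 : Integrable (fun x => κ x * (F x - A)) (weightMeasure a b) :=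
    integrable_of_memLp ha hb (memLp_mul_of_bounded hκm hκb (hm A))
  -- A is the κ-weighted mean of F, so the cross term vanishes and A minimises the κ-weighted
  -- quadratic deviation.
  have h1 : ∫ x, κ x * (F x - A) ^ 2 ∂(weightMeasure a b) ≤
      ∫ x, κ x * (F x - c) ^ 2 ∂(weightMeasure a b) := by
    have : ∫ x, (κ x * (F x - A) ^ 2 + 2 * (A - c) * (κ x * (F x - A))) ∂(weightMeasure a b) ≤
        ∫ x, κ x * (F x - c) ^ 2 ∂(weightMeasure a b) := by
      refine integral_mono_ae ((hi A).add (hi1.const_mul _)) (hi c) ?_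
      filter_upwards [hκ'] with x hx
      have : 0 ≤ κ x * (A - c) ^ 2 := mul_nonneg (hk.le.trans hx.1) (sq_nonneg _)
      nlinarith
    rwa [integral_add (hi A) (hi1.const_mul _), integral_const_mul, hA, mul_zero, add_zero] at this
  have h2 : k₀ * ∫ x, (F x - A) ^ 2 ∂(weightMeasure a b) ≤
      ∫ x, κ x * (F x - A) ^ 2 ∂(weightMeasure a b) := by
    rw [← integral_const_mul]
    refine integral_mono_ae ((hm A).integrable_sq.const_mul _) (hi A) ?_
    filter_upwards [hκ'] with x hx
    exact mul_le_mul_of_nonneg_right hx.1 (sq_nonneg _)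
  have h3 : ∫ x, κ x * (F x - c) ^ 2 ∂(weightMeasure a b) ≤
      k₁ * ∫ x, (F x - c) ^ 2 ∂(weightMeasure a b) := by
    rw [← integral_const_mul]
    refine integral_mono_ae (hi c) ((hm c).integrable_sq.const_mul _) ?_
    filter_upwards [hκ'] with x hx
    exact mul_le_mul_of_nonneg_right hx.2 (sq_nonneg _)
  rw [div_mul_eq_mul_div, le_div_iff₀ hk, mul_comm]
  linarith

end

/-! ### Regularity of the right-hand side. -/

section

/-- Admissible coefficient and right-hand side, with `a = α - β`, `b = β`. -/
structure Data (a b : ℝ) (s : ℕ) (Km KM : ℝ) (K f : ℝ → ℝ) : Prop where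
  pos : 0 < Km
  bounds : ∀ x ∈ Ioo (0 : ℝ) 1, Km ≤ K x ∧ K x ≤ KM
  memWInf : MemWInf (s + 1) (fun x => 1 / K x)
  memH : MemH s b a f
  integrable : ∀ x ∈ Ioo (0 : ℝ) 1, IntervalIntegrable f volume 0 x

/-- The right-hand side `f₁ - A f₂`. -/
def rhs (K f : ℝ → ℝ) (A x : ℝ) : ℝ := f₁ K f x - A * f₂ K x

namespace Data

variable {α r a b Km KM : ℝ} {s : ℕ} {K f : ℝ → ℝ}

theorem K_pos (hd : Data a b s Km KM K f) {x : ℝ} (hx : x ∈ Ioo (0 : ℝ) 1) : 0 < K x :=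
  hd.pos.trans_le (hd.bounds x hx).1

theorem KM_pos (hd : Data a b s Km KM K f) : 0 < KM :=
  hd.pos.trans_le ((hd.bounds _ half_mem).1.trans (hd.bounds _ half_mem).2)

theorem inv_bounds (hd : Data a b s Km KM K f) :
    ∀ᵐ x ∂volI, 1 / KM ≤ 1 / K x ∧ 1 / K x ≤ 1 / Km := by
  filter_upwards [ae_volI_mem] with x hx
  exact ⟨one_div_le_one_div_of_le (hd.K_pos hx) (hd.bounds x hx).2,
    one_div_le_one_div_of_le hd.pos (hd.bounds x hx).1⟩

theorem abs_inv_le (hd : Data a b s Km KM K f) : ∀ᵐ x ∂volI, |1 / K x| ≤ 1 / Km := by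
  filter_upwards [hd.inv_bounds, ae_volI_mem] with x hx hx'
  rw [abs_of_pos (one_div_pos.2 (hd.K_pos hx'))]
  exact hx.2

theorem aestronglyMeasurable_inv (hd : Data a b s Km KM K f) :
    AEStronglyMeasurable (fun x => 1 / K x) volI :=
  (hd.memWInf.aestronglyMeasurable (Nat.zero_le _)).congr hd.memWInf.ae_eq.symm

theorem isPrimitive (hd : Data a b s Km KM K f) (A : ℝ) :
    IsPrimitive (fun x => (∫ y in (0 : ℝ)..x, f y) - A) (weakDeriv 0 f) :=
  (isPrimitive_integral hd.memH.locallyIntegrableOn hd.integrable A).congr (ae_eq_refl _)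
    hd.memH.ae_eq

theorem memLp_primitive (hd : Data a b s Km KM K f) (h : Params α r a b) (A : ℝ) :
    MemLp (fun x => (∫ y in (0 : ℝ)..x, f y) - A) 2 (weightMeasure (b - 1) (a - 1)) := by
  have := hd.memH.memLp (Nat.zero_le _)
  rw [Nat.cast_zero, add_zero, add_zero] at this
  exact (hd.isPrimitive A).memLp h.b_pos h.b_le h.a_pos h.a_le this

theorem rhs_eq (K f : ℝ → ℝ) (A x : ℝ) :
    rhs K f A x = 1 / K x * ((∫ y in (0 : ℝ)..x, f y) - A) := by
  rw [rhs, f₁, f₂]; ring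

theorem memLp_rhs (hd : Data a b s Km KM K f) (h : Params α r a b) (A : ℝ) :
    MemLp (rhs K f A) 2 (weightMeasure (b - 1) (a - 1)) := by
  have := memLp_mul_of_bounded hd.aestronglyMeasurable_inv hd.abs_inv_le (hd.memLp_primitive h A)
  exact this.ae_eq (Eventually.of_forall fun x => (rhs_eq K f A x).symm)

theorem memLp_f₁ (hd : Data a b s Km KM K f) (h : Params α r a b) :
    MemLp (f₁ K f) 2 (weightMeasure (b - 1) (a - 1)) :=
  (hd.memLp_rhs h 0).ae_eq (Eventually.of_forall fun x => by simp [rhs])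

theorem memLp_f₂ (hd : Data a b s Km KM K f) (h : Params α r a b) :
    MemLp (f₂ K) 2 (weightMeasure (b - 1) (a - 1)) :=
  ((hd.memLp_f₁ h).sub (hd.memLp_rhs h 1)).ae_eq (Eventually.of_forall fun x => by
    simp [rhs])

theorem integral_f₂_pos (hd : Data a b s Km KM K f) (h : Params α r a b) :
    0 < ∫ x, f₂ K x ∂(weightMeasure (b - 1) (a - 1)) := by
  have hb : -1 < b - 1 := by linarith [h.b_pos]
  have ha : -1 < a - 1 := by linarith [h.a_pos]
  have := isFiniteMeasure_weightMeasure hb ha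
  have h1 : ∫ _, 1 / KM ∂(weightMeasure (b - 1) (a - 1)) ≤
      ∫ x, f₂ K x ∂(weightMeasure (b - 1) (a - 1)) := by
    refine integral_mono_ae (integrable_const _) (integrable_of_memLp hb ha (hd.memLp_f₂ h)) ?_
    rw [EventuallyLE, ae_weightMeasure]
    filter_upwards [hd.inv_bounds] with x hx using hx.1
  refine lt_of_lt_of_le ?_ h1
  have h2 := jacNorm_pos hb ha 0
  have h3 : ∫ _, 1 / KM ∂(weightMeasure (b - 1) (a - 1)) =
      1 / KM * jacNorm 0 (b - 1) (a - 1) := by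
    rw [jacNorm, ← integral_const_mul]; simp [jacPoly_zero]
  rw [h3]
  exact mul_pos (one_div_pos.2 hd.KM_pos) h2

theorem integral_rhs (hd : Data a b s Km KM K f) (h : Params α r a b) (A : ℝ) (p : ℝ[X]) :
    ∫ x, rhs K f A x * p.eval x ∂(weightMeasure (b - 1) (a - 1)) =
      (∫ x, f₁ K f x * p.eval x ∂(weightMeasure (b - 1) (a - 1))) -
        A * ∫ x, f₂ K x * p.eval x ∂(weightMeasure (b - 1) (a - 1)) := by
  have hb : -1 < b - 1 := by linarith [h.b_pos]
  have ha : -1 < a - 1 := by linarith [h.a_pos]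
  rw [← integral_const_mul, ← integral_sub
    (integrable_mul_eval (integrable_of_memLp hb ha (hd.memLp_f₁ h)) p)
    ((integrable_mul_eval (integrable_of_memLp hb ha (hd.memLp_f₂ h)) p).const_mul A)]
  exact integral_congr_ae (Eventually.of_forall fun x => by simp only [rhs]; ring)

/-- The weighted mean is affine in A, with slope minus the positive mean of 1/K. Thus the
compatibility condition determines the nonlocal constant. -/
theorem integral_rhs_eq_zero_iff {β : ℝ} (hd : Data (α - β) β s Km KM K f)
    (h : Params α r (α - β) β) (A : ℝ) :
    ∫ x, rhs K f A x ∂(weightMeasure (β - 1) (α - β - 1)) = 0 ↔ A = constA α β K f := by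
  have h1 := hd.integral_rhs h A 1
  simp only [eval_one, mul_one] at h1
  have h2 := hd.integral_f₂_pos h
  rw [h1, constA, wInner, wInner]
  simp only [mul_one]
  change _ ↔ A = _ / ∫ x, f₂ K x ∂(weightMeasure (β - 1) (α - β - 1))
  rw [eq_div_iff h2.ne', sub_eq_zero, eq_comm]

end Data

/-- The primitive of `f` with value `-A` at `0`, followed by the weak derivatives of `f`. -/
def primChain (f : ℝ → ℝ) (A : ℝ) : ℕ → ℝ → ℝ
  | 0 => fun x => (∫ y in (0 : ℝ)..x, f y) - A
  | k + 1 => weakDeriv k f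

/-- The weak derivatives of the right-hand side by the Leibniz rule. -/
def rhsChain (K f : ℝ → ℝ) (A : ℝ) (j : ℕ) (x : ℝ) : ℝ :=
  ∑ p ∈ Finset.HasAntidiagonal.antidiagonal j,
    (j.choose p.1 : ℝ) * (weakDeriv p.1 (fun x => 1 / K x) x * primChain f A p.2 x)

/-- The energy constant of the data. -/
def energyConst (s : ℕ) (Km KM : ℝ) : ℝ :=
  (((s + 1 : ℕ) : ℝ) ^ (s + 1)) ^ 2 * ((1 + (2 ^ (s + 1)) ^ 2) * (1 + |KM| / Km))

namespace Data

variable {α r a b Km KM : ℝ} {s : ℕ} {K f : ℝ → ℝ}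

theorem exponent_succ (c : ℝ) (k : ℕ) : c - 1 + ((k + 1 : ℕ) : ℝ) = c + k := by
  push_cast; ring

theorem memLp_primChain (hd : Data a b s Km KM K f) (h : Params α r a b) (A : ℝ) {k : ℕ}
    (hk : k ≤ s + 1) : MemLp (primChain f A k) 2 (weightMeasure (b - 1 + k) (a - 1 + k)) := by
  cases k with
  | zero =>
    rw [Nat.cast_zero, add_zero, add_zero]
    exact hd.memLp_primitive h A
  | succ k => rw [exponent_succ, exponent_succ]; exact hd.memH.memLp (by omega)

theorem isPrimitive_primChain (hd : Data a b s Km KM K f) (A : ℝ) {k : ℕ} (hk : k < s + 1) :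
    IsPrimitive (primChain f A k) (primChain f A (k + 1)) := by
  cases k with
  | zero => exact hd.isPrimitive A
  | succ k => exact hd.memH.isPrimitive (by omega)

/-- Poincaré controls the distance of the primitive to some constant. By the mean-zero condition A
is its 1/K-weighted mean, so replacing that constant by A costs at most the factor KM/Km. -/
theorem integral_primitive_sq_le (hd : Data a b s Km KM K f) (h : Params α r a b) {A : ℝ}
    (hA : ∫ x, rhs K f A x ∂(weightMeasure (b - 1) (a - 1)) = 0) :
    ∫ x, ((∫ y in (0 : ℝ)..x, f y) - A) ^ 2 ∂(weightMeasure (b - 1) (a - 1)) ≤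
      KM / Km * hNorm s b a f ^ 2 := by
  have hb : -1 < b - 1 := by linarith [h.b_pos]
  have ha : -1 < a - 1 := by linarith [h.a_pos]
  have hba : -1 ≤ (b - 1) + (a - 1) := by linarith [h.one_lt, h.sum]
  have hKm := hd.pos
  have hKM := hd.KM_pos
  have h0 := hd.memH.memLp (Nat.zero_le _)
  have h0' := hd.memH.integral_sq_le (Nat.zero_le _)
  rw [Nat.cast_zero, add_zero, add_zero] at h0 h0'
  obtain ⟨c, hc⟩ := exists_poincare hb ha hba (hd.isPrimitive 0) (hd.memLp_primitive h 0)
    (by simpa using h0)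
  rw [sub_add_cancel, sub_add_cancel] at hc
  have hA' : ∫ x, 1 / K x * ((∫ y in (0 : ℝ)..x, f y) - 0 - A)
      ∂(weightMeasure (b - 1) (a - 1)) = 0 :=
    (integral_congr_ae (Eventually.of_forall fun x => by
      simp only [rhs_eq, sub_zero])).trans hA
  have h1 := integral_sub_sq_le hb ha (one_div_pos.2 hKM) hd.aestronglyMeasurable_inv
    hd.inv_bounds (hd.memLp_primitive h 0) hA' c
  rw [show 1 / Km / (1 / KM) = KM / Km by field_simp] at h1
  have h2 := h1.trans (mul_le_mul_of_nonneg_left (hc.trans h0') (by positivity))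
  simpa only [sub_zero] using h2

theorem integral_primChain_sq_le (hd : Data a b s Km KM K f) (h : Params α r a b) {A : ℝ}
    (hA : ∫ x, rhs K f A x ∂(weightMeasure (b - 1) (a - 1)) = 0) {k : ℕ} (hk : k ≤ s + 1) :
    ∫ x, primChain f A k x ^ 2 ∂(weightMeasure (b - 1 + k) (a - 1 + k)) ≤
      (1 + |KM| / Km) * hNorm s b a f ^ 2 := by
  have hKK : 0 ≤ |KM| / Km := div_nonneg (abs_nonneg _) hd.pos.le
  cases k with
  | zero =>
    rw [Nat.cast_zero, add_zero, add_zero]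
    refine (hd.integral_primitive_sq_le h hA).trans
      (mul_le_mul_of_nonneg_right ?_ (sq_nonneg _))
    -- The absolute value keeps `energyConst` nonnegative for every real KM, as the constant is
    -- fixed before any K is given.
    rw [abs_of_pos hd.KM_pos]
    linarith
  | succ k =>
    rw [exponent_succ, exponent_succ]
    refine (hd.memH.integral_sq_le (by omega)).trans ?_
    exact le_mul_of_one_le_left (sq_nonneg _) (by linarith)

theorem rhsChain_zero_ae_eq (hd : Data a b s Km KM K f) (A : ℝ) :
    ∀ᵐ x ∂volI, rhsChain K f A 0 x = rhs K f A x := by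
  filter_upwards [hd.memWInf.ae_eq] with x hx
  rw [rhs_eq, hx]
  simp [rhsChain, primChain]

theorem isPrimitive_rhsChain (hd : Data a b s Km KM K f) (A : ℝ) {j : ℕ} (hj : j < s + 1) :
    IsPrimitive (rhsChain K f A j) (rhsChain K f A (j + 1)) :=
  isPrimitive_leibniz (m := s + 1) (v := fun i => weakDeriv i (fun x => 1 / K x))
    (w := primChain f A) (fun _ hi => hd.memWInf.isPrimitive hi)
    (fun _ hk => hd.isPrimitive_primChain A hk) hj

theorem rhsChain_bound (hd : Data a b s Km KM K f) (h : Params α r a b) {A : ℝ}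
    (hA : ∫ x, rhs K f A x ∂(weightMeasure (b - 1) (a - 1)) = 0) {j : ℕ} (hj : j ≤ s + 1) :
    MemLp (rhsChain K f A j) 2 (weightMeasure (b - 1 + j) (a - 1 + j)) ∧
    ∫ x, rhsChain K f A j x ^ 2 ∂(weightMeasure (b - 1 + j) (a - 1 + j)) ≤
      (2 ^ j) ^ 2 * wInfNorm (s + 1) (fun x => 1 / K x) ^ 2 *
        ((1 + |KM| / Km) * hNorm s b a f ^ 2) :=
  integral_leibniz_sq_le (m := s + 1) (κ := fun i => weakDeriv i (fun x => 1 / K x))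
    (H := primChain f A) (W := wInfNorm (s + 1) (fun x => 1 / K x))
    (E := (1 + |KM| / Km) * hNorm s b a f ^ 2)
    (fun _ hi => hd.memWInf.aestronglyMeasurable hi) (fun _ hi => hd.memWInf.ae_abs_le hi)
    (fun _ hk => hd.memLp_primChain h A hk) (fun _ hk => hd.integral_primChain_sq_le h hA hk) hj

/-- The right-hand side has one more derivative than f because f enters through its primitive; hence
the power s+1. -/
theorem tsum_jacEnergy_rhs_le (hd : Data a b s Km KM K f) (h : Params α r a b) {A : ℝ}
    (hA : ∫ x, rhs K f A x ∂(weightMeasure (b - 1) (a - 1)) = 0) :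
    (Summable fun n : ℕ => ((n : ℝ) ^ (s + 1)) ^ 2 * jacEnergy n (b - 1) (a - 1) (rhs K f A)) ∧
    ∑' n : ℕ, ((n : ℝ) ^ (s + 1)) ^ 2 * jacEnergy n (b - 1) (a - 1) (rhs K f A) ≤
      energyConst s Km KM * wInfNorm (s + 1) (fun x => 1 / K x) ^ 2 * hNorm s b a f ^ 2 := by
  have hb : -1 < b - 1 := by linarith [h.b_pos]
  have ha : -1 < a - 1 := by linarith [h.a_pos]
  have hba : -1 ≤ (b - 1) + (a - 1) := by linarith [h.one_lt, h.sum]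
  obtain ⟨hs, hle⟩ := tsum_pow_mul_jacEnergy_le (P := rhsChain K f A) (m := s + 1) hb ha hba (Nat.le_add_left 1 s)
    (fun j hj => hd.isPrimitive_rhsChain A hj) (fun j hj => (hd.rhsChain_bound h hA hj).1)
  have hen : ∀ n, jacEnergy n (b - 1) (a - 1) (rhsChain K f A 0) =
      jacEnergy n (b - 1) (a - 1) (rhs K f A) := by
    intro n
    rw [jacEnergy, jacEnergy]
    congr 2
    refine integral_congr_ae ?_
    rw [EventuallyEq, ae_weightMeasure]
    filter_upwards [hd.rhsChain_zero_ae_eq A] with x hx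
    rw [hx]
  simp only [hen] at hs hle
  refine ⟨hs, hle.trans ?_⟩
  have l0 := (hd.rhsChain_bound h hA (Nat.zero_le _)).2
  have l1 := (hd.rhsChain_bound h hA (le_refl (s + 1))).2
  rw [Nat.cast_zero, add_zero, add_zero] at l0
  refine (mul_le_mul_of_nonneg_left (add_le_add l0 l1) (by positivity)).trans (le_of_eq ?_)
  rw [energyConst]; ring

end Data

end

/-! ### Jacobi coefficients of a solution and their decay. -/

section

theorem intervalIntegral_eq_setIntegral_Ioo (g : ℝ → ℝ) :
    ∫ x in (0 : ℝ)..1, g x = ∫ x in Ioo (0 : ℝ) 1, g x := by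
  rw [intervalIntegral.integral_of_le zero_le_one, integral_Ioc_eq_integral_Ioo]

theorem integrable_deriv_of_absCont {u : ℝ → ℝ} (hu : AbsolutelyContinuousOnInterval u 0 1) :
    Integrable (deriv u) volI := by
  have := (intervalIntegrable_iff_integrableOn_Ioo_of_le zero_le_one).1 hu.intervalIntegrable_deriv
  exact this

theorem absCont_eval (p : ℝ[X]) :
    AbsolutelyContinuousOnInterval (fun x => p.eval x) 0 1 :=
  ContDiffOn.absolutelyContinuousOnInterval (by
    have : ContDiff ℝ 1 fun x => p.eval x := by simpa using p.contDiff_aeval (𝕜 := ℝ) 1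
    exact this.contDiffOn)

theorem integral_deriv_mul_eval {u : ℝ → ℝ} (hu : AbsolutelyContinuousOnInterval u 0 1)
    (h0 : u 0 = 0) (h1 : u 1 = 0) (p : ℝ[X]) :
    ∫ x in Ioo (0 : ℝ) 1, deriv u x * p.eval x =
      -∫ x in Ioo (0 : ℝ) 1, u x * (derivative p).eval x := by
  have h := hu.integral_mul_deriv_eq_deriv_mul (absCont_eval p)
  simp only [Polynomial.deriv, h0, h1, zero_mul, sub_zero, zero_sub] at h
  rw [intervalIntegral_eq_setIntegral_Ioo, intervalIntegral_eq_setIntegral_Ioo] at h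
  rw [h, neg_neg]

variable {α r a b : ℝ}

/-- The Jacobi coefficients of `ω^{(-a,-b)} u`, where the flux of `u'` is `-g`. -/
def solCoeff (α a b : ℝ) (g : ℝ → ℝ) (i : ℕ) : ℝ :=
  (∫ x, g x * (jacPoly (i + 1) (b - 1) (a - 1)).eval x ∂(weightMeasure (b - 1) (a - 1))) /
    (((i : ℝ) + 1) * fluxEig α a b (i + 1) * jacNorm (i + 1) (b - 1) (a - 1))

theorem jacNorm_eq_div (h : Params α r a b) (i : ℕ) :
    jacNorm i a b = ((i : ℝ) + 1) / (i + α) * jacNorm (i + 1) (b - 1) (a - 1) := by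
  have h1 := jacNorm_succ (a := a - 1) (b := b - 1) (by linarith [h.a_pos]) (by linarith [h.b_pos]) i
  have hi : (0 : ℝ) ≤ i := i.cast_nonneg
  have : (i : ℝ) + α ≠ 0 := by linarith [h.one_lt] |> fun (h : 0 < (i : ℝ) + α) => h.ne'
  rw [sub_add_cancel, sub_add_cancel, ← jacNorm_comm h] at h1
  rw [div_mul_eq_mul_div, eq_div_iff this, ← h1, ← h.sum]
  ring

/-- The numerator of c_i is minus the coefficient of f₁ - A f₂, and this sign cancels the one in
`lam_eq`. -/
theorem coeffC_eq {β Km KM : ℝ} {s : ℕ} {K f : ℝ → ℝ} (h : Params α r (α - β) β)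
    (hd : Data (α - β) β s Km KM K f) (i : ℕ) :
    coeffC α β K f i = solCoeff α (α - β) β (rhs K f (constA α β K f)) i := by
  have hb : -1 < β - 1 := by linarith [h.b_pos]
  have ha : -1 < α - β - 1 := by linarith [h.a_pos]
  have hco : ∀ (g : ℝ → ℝ) (j : ℕ), jacobiCoeff α β g j =
      (∫ x, g x * (jacPoly j (β - 1) (α - β - 1)).eval x ∂(weightMeasure (β - 1) (α - β - 1))) /
        jacNorm j (β - 1) (α - β - 1) := by
    intro g j
    have h1 : jacobiG j (β - 1) (α - β - 1) =
      fun x => (jacPoly j (β - 1) (α - β - 1)).eval x := funext fun x => jacobiG_eq_eval _ _ _ _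
    rw [jacobiCoeff, wInner, h1, ← integral_sq_eq _ _ (memLp_eval hb ha _ 2), jacNorm]
  have hN := (jacNorm_pos hb ha (i + 1)).ne'
  have hE := (fluxEig_pos h (i + 1)).ne'
  have hi : (i : ℝ) + 1 ≠ 0 := by positivity
  rw [coeffC, hco, hco, solCoeff, hd.integral_rhs h, lam_eq h]
  field_simp
  ring

/-- Moments of a solution. -/
theorem integral_mul_jacPoly_of_flux (h : Params α r a b) {u g : ℝ → ℝ}
    (hu : AbsolutelyContinuousOnInterval u 0 1) (h0 : u 0 = 0) (h1 : u 1 = 0)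
    (hg : ∀ᵐ x ∂volI, flux α r (deriv u) x = -g x) :
    (∫ x, g x ∂(weightMeasure (b - 1) (a - 1)) = 0) ∧ ∀ i : ℕ,
      ∫ x in Ioo (0 : ℝ) 1, u x * (jacPoly i a b).eval x = solCoeff α a b g i * jacNorm i a b := by
  have hb : -1 < b - 1 := by linarith [h.b_pos]
  have ha : -1 < a - 1 := by linarith [h.a_pos]
  -- Duality moves the flux onto the polynomial, and integration by parts uses u(0) = u(1) = 0. The
  -- index n = 0 yields the mean-zero condition, n = i+1 the i-th coefficient.
  have key : ∀ n, ∫ x, g x * (jacPoly n (b - 1) (a - 1)).eval x ∂(weightMeasure (b - 1) (a - 1)) =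
      fluxEig α a b n *
        ∫ x in Ioo (0 : ℝ) 1, u x * (derivative (jacPoly n (a - 1) (b - 1))).eval x := by
    intro n
    have h2 := integral_flux_mul_jacPoly h (integrable_deriv_of_absCont hu) n
    rw [integral_deriv_mul_eval hu h0 h1] at h2
    have h3 : ∫ x, g x * (jacPoly n (b - 1) (a - 1)).eval x ∂(weightMeasure (b - 1) (a - 1)) =
        -∫ x, flux α r (deriv u) x * (jacPoly n (b - 1) (a - 1)).eval x
          ∂(weightMeasure (b - 1) (a - 1)) := by
      rw [← integral_neg]
      refine integral_congr_ae ?_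
      rw [EventuallyEq, ae_weightMeasure]
      filter_upwards [hg] with x hx
      rw [hx]; ring
    rw [h3, h2]; ring
  refine ⟨by simpa [jacPoly_zero] using key 0, fun i => ?_⟩
  have hN := (jacNorm_pos hb ha (i + 1)).ne'
  have hE := (fluxEig_pos h (i + 1)).ne'
  have hi : (i : ℝ) + 1 ≠ 0 := by positivity
  have hia : (i : ℝ) + α ≠ 0 := by
    have : (0 : ℝ) ≤ i := i.cast_nonneg
    linarith [h.one_lt] |> fun (h : 0 < (i : ℝ) + α) => h.ne'
  have h4 : ∫ x in Ioo (0 : ℝ) 1, u x * (derivative (jacPoly (i + 1) (a - 1) (b - 1))).eval x =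
      ((i : ℝ) + α) * ∫ x in Ioo (0 : ℝ) 1, u x * (jacPoly i a b).eval x := by
    rw [← integral_const_mul]
    refine integral_congr_ae (Eventually.of_forall fun x => ?_)
    simp only [derivative_jacPoly, sub_add_cancel, eval_mul, eval_C]
    rw [← h.sum]; ring
  rw [solCoeff, key, h4, jacNorm_eq_div h]
  field_simp

theorem exists_sq_solCoeff_le (h : Params α r a b) : ∃ k : ℝ, 0 < k ∧ ∀ (g : ℝ → ℝ) (i : ℕ),
    solCoeff α a b g i ^ 2 * jacNorm i a b ≤
      k / (((i : ℝ) + 1) ^ (α - 1)) ^ 2 * jacEnergy (i + 1) (b - 1) (a - 1) g := by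
  have hb : -1 < b - 1 := by linarith [h.b_pos]
  have ha : -1 < a - 1 := by linarith [h.a_pos]
  obtain ⟨k, hk, hle⟩ := exists_le_mul_fluxEig h
  refine ⟨1 / k ^ 2, by positivity, fun g i => ?_⟩
  have hi : (0 : ℝ) ≤ i := i.cast_nonneg
  have hN := jacNorm_pos hb ha (i + 1)
  have hia : (0 : ℝ) < (i : ℝ) + α := by linarith [h.one_lt]
  have hp : 0 < ((i : ℝ) + 1) ^ (α - 1) := Real.rpow_pos_of_pos (by linarith) _
  have hl := hle i
  set L := ((i : ℝ) + 1) * fluxEig α a b (i + 1) with hL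
  set t := ((i : ℝ) + 1) ^ (α - 1) with ht
  have hLpos : 0 < L := (mul_pos hk hp).trans_le hl
  rw [solCoeff, jacNorm_eq_div h, jacEnergy, ← hL]
  set J := ∫ x, g x * (jacPoly (i + 1) (b - 1) (a - 1)).eval x ∂(weightMeasure (b - 1) (a - 1))
  set M := jacNorm (i + 1) (b - 1) (a - 1)
  have e1 : (J / (L * M)) ^ 2 * (((i : ℝ) + 1) / (i + α) * M) =
      1 / L ^ 2 * (((i : ℝ) + 1) / (i + α)) * (J ^ 2 / M) := by
    field_simp
  have e2 : 1 / k ^ 2 / t ^ 2 = 1 / (k * t) ^ 2 := by rw [div_div, mul_pow]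
  rw [e1, e2]
  refine mul_le_mul_of_nonneg_right ?_ (by positivity)
  calc 1 / L ^ 2 * (((i : ℝ) + 1) / (i + α)) ≤ 1 / L ^ 2 * 1 := by
        gcongr
        rw [div_le_one hia]
        linarith [h.one_lt]
    _ = 1 / L ^ 2 := mul_one _
    _ ≤ _ := by gcongr

/-- The rate splits as α+s = (α-1) + (s+1): the first part is the growth of the eigenvalues, the
second the decay of the coefficients of g. -/
theorem exists_tail_le (h : Params α r a b) (s : ℕ) : ∃ k : ℝ, 0 < k ∧ ∀ (g : ℝ → ℝ),
    (Summable fun n : ℕ => ((n : ℝ) ^ (s + 1)) ^ 2 * jacEnergy n (b - 1) (a - 1) g) →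
    (Summable fun i => solCoeff α a b g i ^ 2 * jacNorm i a b) ∧ ∀ N : ℕ,
      ∑' i, solCoeff α a b g (i + (N + 1)) ^ 2 * jacNorm (i + (N + 1)) a b ≤
        k / (((N : ℝ) + 1) ^ (α + s)) ^ 2 *
          ∑' n : ℕ, ((n : ℝ) ^ (s + 1)) ^ 2 * jacEnergy n (b - 1) (a - 1) g := by
  have hb : -1 < b - 1 := by linarith [h.b_pos]
  have ha : -1 < a - 1 := by linarith [h.a_pos]
  have hα := h.one_lt
  obtain ⟨k, hk, hle⟩ := exists_sq_solCoeff_le h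
  refine ⟨k, hk, fun g hs => ?_⟩
  have hnn : ∀ n : ℕ, 0 ≤ ((n : ℝ) ^ (s + 1)) ^ 2 * jacEnergy n (b - 1) (a - 1) g := fun n =>
    mul_nonneg (by positivity) (jacEnergy_nonneg hb ha _ _)
  have hterm : ∀ (M i : ℕ), M ≤ i → solCoeff α a b g i ^ 2 * jacNorm i a b ≤
      k / (((M : ℝ) + 1) ^ (α + s)) ^ 2 *
        ((((i + 1 : ℕ) : ℝ) ^ (s + 1)) ^ 2 * jacEnergy (i + 1) (b - 1) (a - 1) g) := by
    intro M i hMi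
    refine (hle g i).trans ?_
    have hi : (0 : ℝ) < (i : ℝ) + 1 := by positivity
    have hM : (0 : ℝ) < (M : ℝ) + 1 := by positivity
    have e : ((i : ℝ) + 1) ^ (α + s) = ((i : ℝ) + 1) ^ (α - 1) * ((i : ℝ) + 1) ^ (s + 1) := by
      rw [← Real.rpow_natCast, ← Real.rpow_add hi]
      congr 1; push_cast; ring
    have hMi' : (M : ℝ) ≤ i := by exact_mod_cast hMi
    have hp : ((M : ℝ) + 1) ^ (α + s) ≤ ((i : ℝ) + 1) ^ (α + s) :=
      Real.rpow_le_rpow hM.le (by linarith) (by positivity)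
    have hp0 : 0 < ((M : ℝ) + 1) ^ (α + s) := Real.rpow_pos_of_pos hM _
    have hq0 : 0 < ((i : ℝ) + 1) ^ (α - 1) := Real.rpow_pos_of_pos hi _
    rw [← mul_assoc]
    refine mul_le_mul_of_nonneg_right ?_ (jacEnergy_nonneg hb ha _ _)
    push_cast
    rw [div_mul_eq_mul_div, div_le_div_iff₀ (by positivity) (by positivity), mul_assoc]
    refine mul_le_mul_of_nonneg_left ?_ hk.le
    rw [← mul_pow, mul_comm (((i : ℝ) + 1) ^ (s + 1)), ← e]
    gcongr
  have hs1 := (summable_nat_add_iff 1).2 hs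
  have hpos : ∀ i, 0 ≤ solCoeff α a b g i ^ 2 * jacNorm i a b := fun i =>
    mul_nonneg (sq_nonneg _) (jacNorm_pos (by linarith) (by linarith) i).le
  have hsum : Summable fun i => solCoeff α a b g i ^ 2 * jacNorm i a b :=
    Summable.of_nonneg_of_le hpos (fun i => hterm 0 i (Nat.zero_le _)) (hs1.mul_left _)
  refine ⟨hsum, fun N => ?_⟩
  have hs2 := (summable_nat_add_iff (N + 2)).2 hs
  have hmul : 0 ≤ k / (((N : ℝ) + 1) ^ (α + s)) ^ 2 := by positivity
  calc ∑' i, solCoeff α a b g (i + (N + 1)) ^ 2 * jacNorm (i + (N + 1)) a b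
      ≤ ∑' i : ℕ, k / (((N : ℝ) + 1) ^ (α + s)) ^ 2 * ((((i + (N + 2) : ℕ) : ℝ) ^ (s + 1)) ^ 2 *
          jacEnergy (i + (N + 2)) (b - 1) (a - 1) g) :=
        ((summable_nat_add_iff (N + 1)).2 hsum).tsum_le_tsum
          (fun i => hterm N (i + (N + 1)) (by omega)) (hs2.mul_left _)
    _ = k / (((N : ℝ) + 1) ^ (α + s)) ^ 2 * ∑' i : ℕ, ((((i + (N + 2) : ℕ) : ℝ) ^ (s + 1)) ^ 2 *
          jacEnergy (i + (N + 2)) (b - 1) (a - 1) g) := tsum_mul_left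
    _ ≤ _ := by
        refine mul_le_mul_of_nonneg_left ?_ hmul
        rw [← hs.sum_add_tsum_nat_add (N + 2)]
        exact le_add_of_nonneg_left (Finset.sum_nonneg fun n _ => hnn n)

end

/-! ### Truncation error and passage to the unweighted norm. -/

section

variable {α r a b : ℝ}

theorem memLp_weight_neg_mul {u : ℝ → ℝ} (hu : MemLp u 2 (weightMeasure (-a) (-b))) :
    MemLp (fun x => weight (-a) (-b) x * u x) 2 (weightMeasure a b) := by
  rw [memLp_two_weightMeasure_iff] at hu ⊢
  refine ⟨(measurable_weight _ _).aestronglyMeasurable.mul hu.1, ?_⟩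
  refine hu.2.congr_fun (fun x hx => ?_) measurableSet_Ioo
  have := weight_neg_mul_weight a b hx
  linear_combination (-(weight (-a) (-b) x * u x ^ 2)) * this

theorem integral_weight_neg_mul (u φ : ℝ → ℝ) :
    ∫ x, weight (-a) (-b) x * u x * φ x ∂(weightMeasure a b) =
      ∫ x in Ioo (0 : ℝ) 1, u x * φ x := by
  rw [integral_weightMeasure]
  refine setIntegral_congr_fun measurableSet_Ioo fun x hx => ?_
  linear_combination (u x * φ x) * weight_neg_mul_weight a b hx

/-- Truncation error of a Jacobi expansion. -/
theorem integral_sub_sum_sq (ha : -1 < a) (hb : -1 < b) {q : ℝ → ℝ}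
    (hq : MemLp q 2 (weightMeasure a b)) {c : ℕ → ℝ}
    (hc : ∀ i, ∫ x, q x * (jacPoly i a b).eval x ∂(weightMeasure a b) = c i * jacNorm i a b)
    (M : ℕ) :
    MemLp (fun x => q x - ∑ i ∈ Finset.range M, c i * (jacPoly i a b).eval x) 2
      (weightMeasure a b) ∧
    ∫ x, (q x - ∑ i ∈ Finset.range M, c i * (jacPoly i a b).eval x) ^ 2 ∂(weightMeasure a b) =
      ∑' i, c (i + M) ^ 2 * jacNorm (i + M) a b := by
  set S : ℝ[X] := ∑ i ∈ Finset.range M, C (c i) * jacPoly i a b with hS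
  have hSe : ∀ x, ∑ i ∈ Finset.range M, c i * (jacPoly i a b).eval x = S.eval x := fun x => by
    simp [hS, eval_finsetSum]
  simp only [hSe]
  have hw : MemLp (fun x => q x - S.eval x) 2 (weightMeasure a b) :=
    hq.sub (memLp_eval ha hb S 2)
  refine ⟨hw, ?_⟩
  have hSm : ∀ n, ∫ x, S.eval x * (jacPoly n a b).eval x ∂(weightMeasure a b) =
      if n < M then c n * jacNorm n a b else 0 := by
    intro n
    have e : ∀ x, S.eval x * (jacPoly n a b).eval x =
        ∑ i ∈ Finset.range M, c i * ((jacPoly i a b).eval x * (jacPoly n a b).eval x) := fun x => by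
      rw [← hSe, Finset.sum_mul]; exact Finset.sum_congr rfl fun i _ => by ring
    simp only [e]
    rw [integral_finsetSum _ fun i _ =>
      (integrable_mul_eval (integrable_eval ha hb _) _).const_mul _]
    have e2 : ∀ i, ∫ x, c i * ((jacPoly i a b).eval x * (jacPoly n a b).eval x)
        ∂(weightMeasure a b) = if n = i then c n * jacNorm n a b else 0 := by
      intro i
      rw [integral_const_mul]
      split_ifs with hi
      · rw [hi, jacNorm]; simp only [sq]
      · rw [integral_jacPoly_mul_jacPoly ha hb (Ne.symm hi), mul_zero]
    simp only [e2]
    rw [Finset.sum_ite_eq]; simp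
  -- Subtracting the partial sum removes the energies below M and leaves the others untouched.
  have hen : ∀ n, jacEnergy n a b (fun x => q x - S.eval x) =
      if n < M then 0 else c n ^ 2 * jacNorm n a b := by
    intro n
    have hN := (jacNorm_pos ha hb n).ne'
    have : ∫ x, (q x - S.eval x) * (jacPoly n a b).eval x ∂(weightMeasure a b) =
        if n < M then 0 else c n * jacNorm n a b := by
      simp only [sub_mul]
      rw [integral_sub (integrable_mul_eval (integrable_of_memLp ha hb hq) _)
        (integrable_mul_eval (integrable_eval ha hb _) _), hc, hSm]
      split_ifs <;> ring
    rw [jacEnergy, this]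
    split_ifs
    · simp
    · field_simp
  rw [← tsum_jacEnergy ha hb hw, ← (summable_jacEnergy ha hb hw).sum_add_tsum_nat_add M,
    Finset.sum_eq_zero fun n hn => by rw [hen, if_pos (Finset.mem_range.1 hn)], zero_add]
  exact tsum_congr fun i => by rw [hen, if_neg (by omega)]

theorem weightMeasure_zero : weightMeasure 0 0 = volI := by
  have : (fun x => ENNReal.ofReal (weight 0 0 x)) = 1 := by
    funext x; simp [weight_zero]
  rw [weightMeasure, this, withDensity_one]

theorem eLpNorm_le_of_integral_sq_le {g : ℝ → ℝ} {B : ℝ} (hB : 0 ≤ B) (hg : MemLp g 2 volI)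
    (h : ∫ x in Ioo (0 : ℝ) 1, g x ^ 2 ≤ B ^ 2) : eLpNorm g 2 volI ≤ ENNReal.ofReal B := by
  rw [← weightMeasure_zero] at hg
  have h1 := integral_sq_eq 0 0 hg
  have h2 : wNorm 0 0 g ≤ B := by
    rw [weightMeasure_zero, volI] at h1
    rw [h1] at h
    exact (le_abs_self _).trans (abs_le_of_sq_le_sq h hB)
  rw [wNorm, weightMeasure_zero] at h2
  rw [weightMeasure_zero] at hg
  exact (ENNReal.le_ofReal_iff_toReal_le hg.2.ne hB).2 h2

/-- Nonnegative exponents give ω ≤ 1, hence ω² ≤ ω; this converts the weighted error of ω^{(-a,-b)}u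
into the L² error of u. -/
theorem memLp_weight_mul (ha : 0 ≤ a) (hb : 0 ≤ b) {w : ℝ → ℝ}
    (hw : MemLp w 2 (weightMeasure a b)) :
    MemLp (fun x => weight a b x * w x) 2 volI ∧
    ∫ x in Ioo (0 : ℝ) 1, (weight a b x * w x) ^ 2 ≤ ∫ x, w x ^ 2 ∂(weightMeasure a b) := by
  have hw' := memLp_two_weightMeasure_iff.1 hw
  have hpt : ∀ x ∈ Ioo (0 : ℝ) 1, (weight a b x * w x) ^ 2 ≤ weight a b x * w x ^ 2 := by
    intro x hx
    have h1 := weight_le_one ha hb hx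
    have h0 := weight_pos a b hx
    rw [mul_pow, sq (weight a b x)]
    exact mul_le_mul_of_nonneg_right (mul_le_of_le_one_left h0.le h1) (sq_nonneg _)
  have hm : AEStronglyMeasurable (fun x => weight a b x * w x) volI :=
    (measurable_weight _ _).aestronglyMeasurable.mul hw'.1
  have hi : IntegrableOn (fun x => (weight a b x * w x) ^ 2) (Ioo 0 1) := by
    refine Integrable.mono' hw'.2 (hm.pow 2) ?_
    filter_upwards [ae_restrict_mem measurableSet_Ioo] with x hx
    rw [Real.norm_of_nonneg (sq_nonneg _)]
    exact hpt x hx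
  refine ⟨(memLp_two_iff_integrable_sq hm).2 hi, ?_⟩
  rw [integral_weightMeasure]
  exact setIntegral_mono_on hi hw'.2 measurableSet_Ioo hpt

theorem eLpNorm_sub_le (ha : 0 ≤ a) (hb : 0 ≤ b) {u : ℝ → ℝ}
    (hu : MemLp u 2 (weightMeasure (-a) (-b))) {c : ℕ → ℝ}
    (hc : ∀ i, ∫ x in Ioo (0 : ℝ) 1, u x * (jacPoly i a b).eval x = c i * jacNorm i a b)
    (M : ℕ) {B : ℝ} (hB : 0 ≤ B) (h : ∑' i, c (i + M) ^ 2 * jacNorm (i + M) a b ≤ B ^ 2) :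
    eLpNorm (fun x => u x - weight a b x * ∑ i ∈ Finset.range M, c i * jacobiG i a b x) 2 volI ≤
      ENNReal.ofReal B := by
  have hq := memLp_weight_neg_mul hu
  obtain ⟨h1, h2⟩ := integral_sub_sum_sq (by linarith) (by linarith) hq (c := c)
    (fun i => by rw [integral_weight_neg_mul, hc]) M
  obtain ⟨h3, h4⟩ := memLp_weight_mul ha hb h1
  have e : ∀ᵐ x ∂volI, weight a b x * (weight (-a) (-b) x * u x -
        ∑ i ∈ Finset.range M, c i * (jacPoly i a b).eval x) =
      u x - weight a b x * ∑ i ∈ Finset.range M, c i * jacobiG i a b x := by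
    filter_upwards [ae_volI_mem] with x hx
    have := weight_neg_mul_weight a b hx
    simp only [jacobiG_eq_eval]
    linear_combination u x * this
  rw [← eLpNorm_congr_ae e]
  exact eLpNorm_le_of_integral_sq_le hB h3 (h4.trans (h2.trans_le h))

end

/-! ### Existence of a solution and the error bound. -/

section

variable {α r a b : ℝ}

theorem ae_deriv_primitive_eq {v : ℝ → ℝ} (hv : IntervalIntegrable v volume 0 1) :
    ∀ᵐ x ∂volI, deriv (fun x => ∫ y in (0 : ℝ)..x, v y) x = v x := by
  filter_upwards [ae_restrict_of_ae hv.ae_hasDerivAt_integral, ae_volI_mem] with x hx hx'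
  exact (hx (by rw [uIcc_of_le zero_le_one]; exact Ioo_subset_Icc_self hx') 0
    left_mem_uIcc).deriv

/-- Solvability of the flux equation for a right-hand side of weighted mean zero. -/
theorem exists_flux_eq (h : Params α r a b) {g : ℝ → ℝ}
    (hg : MemLp g 2 (weightMeasure (b - 1) (a - 1)))
    (hg0 : ∫ x, g x ∂(weightMeasure (b - 1) (a - 1)) = 0)
    (hs : Summable fun n : ℕ => (n : ℝ) ^ 2 * jacEnergy n (b - 1) (a - 1) g) :
    ∃ u : ℝ → ℝ, AbsolutelyContinuousOnInterval u 0 1 ∧ u 0 = 0 ∧ u 1 = 0 ∧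
      ∀ᵐ x ∂volI, flux α r (deriv u) x = -g x := by
  have hb : -1 < b - 1 := by linarith [h.b_pos]
  have ha : -1 < a - 1 := by linarith [h.a_pos]
  have hα := h.one_lt
  set m : ℕ → ℝ := fun n =>
    ∫ x, g x * (jacPoly n (b - 1) (a - 1)).eval x ∂(weightMeasure (b - 1) (a - 1)) with hm
  -- By `integral_flux_mul_jacPoly` these are the moments u' must have. Since 1/`fluxEig` n is at
  -- most n/k for n ≥ 1 and m 0 = 0, the summability hypothesis makes them square summable.
  set γ : ℕ → ℝ := fun n => -(m n / fluxEig α a b n) with hγ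
  have hm0 : m 0 = 0 := by simpa [hm, jacPoly_zero] using hg0
  obtain ⟨k, hk, hle⟩ := exists_le_mul_fluxEig h
  have hγs : Summable fun n => γ n ^ 2 / jacNorm n (a - 1) (b - 1) := by
    refine Summable.of_nonneg_of_le (fun n => div_nonneg (sq_nonneg _) (jacNorm_pos ha hb n).le)
      (fun n => ?_) (hs.mul_left (1 / k ^ 2))
    cases n with
    | zero => simp [hγ, hm0]
    | succ i =>
      have hi : (0 : ℝ) < (i : ℝ) + 1 := by positivity
      have h1 : k ≤ ((i : ℝ) + 1) * fluxEig α a b (i + 1) := by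
        refine le_trans (le_mul_of_one_le_right hk.le ?_) (hle i)
        exact Real.one_le_rpow (by linarith [(i.cast_nonneg : (0 : ℝ) ≤ i)]) (by linarith)
      have hE := fluxEig_pos h (i + 1)
      have hN := jacNorm_pos hb ha (i + 1)
      rw [← jacNorm_comm h, jacEnergy]
      change (-(m (i + 1) / fluxEig α a b (i + 1))) ^ 2 / jacNorm (i + 1) (b - 1) (a - 1) ≤
        1 / k ^ 2 * (((i + 1 : ℕ) : ℝ) ^ 2 * (m (i + 1) ^ 2 / jacNorm (i + 1) (b - 1) (a - 1)))
      have e1 : (-(m (i + 1) / fluxEig α a b (i + 1))) ^ 2 / jacNorm (i + 1) (b - 1) (a - 1) =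
          1 / (((i : ℝ) + 1) * fluxEig α a b (i + 1)) ^ 2 *
            (((i + 1 : ℕ) : ℝ) ^ 2 * (m (i + 1) ^ 2 / jacNorm (i + 1) (b - 1) (a - 1))) := by
        push_cast
        field_simp
      rw [e1]
      gcongr
  obtain ⟨w, hw, hwγ⟩ := exists_memLp_of_summable ha hb hγs
  set v : ℝ → ℝ := fun x => weight (a - 1) (b - 1) x * w x with hv
  have hvi : Integrable v volI := integrable_weightMeasure_iff.1 (integrable_of_memLp ha hb hw)
  have hvm : ∀ n, ∫ x in Ioo (0 : ℝ) 1, v x * (jacPoly n (a - 1) (b - 1)).eval x = γ n := by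
    intro n
    rw [← hwγ, integral_weightMeasure]
    exact integral_congr_ae (Eventually.of_forall fun x => by simp only [hv]; ring)
  have hvI : IntervalIntegrable v volume 0 1 :=
    (intervalIntegrable_iff_integrableOn_Ioo_of_le zero_le_one).2 hvi
  refine ⟨fun x => ∫ y in (0 : ℝ)..x, v y,
    hvI.absolutelyContinuousOnInterval_intervalIntegral left_mem_uIcc, by simp, ?_, ?_⟩
  -- The zeroth moment of v is γ 0 = 0, which is the boundary condition at 1.
  · have := hvm 0
    simp only [jacPoly_zero, eval_one, mul_one] at this
    simp only [intervalIntegral_eq_setIntegral_Ioo, this]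
    simp [hγ, hm0]
  have hflux : flux α r (deriv fun x => ∫ y in (0 : ℝ)..x, v y) = flux α r v := by
    funext y
    refine integral_congr_ae ?_
    filter_upwards [ae_deriv_primitive_eq hvI] with x hx
    rw [hx]
  rw [hflux]
  have hgi := integrable_of_memLp hb ha hg
  have hfi := integrable_weight_mul_flux h hvi
  filter_upwards [jacPoly_complete hb ha (hfi.add hgi) fun n => by
    simp only [Pi.add_apply, add_mul]
    rw [integral_add (integrable_mul_eval hfi _) (integrable_mul_eval hgi _),
      integral_flux_mul_jacPoly h hvi, hvm]
    have := (fluxEig_pos h n).ne'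
    change fluxEig α a b n * -(m n / fluxEig α a b n) + m n = 0
    field_simp
    ring] with x hx
  simp only [Pi.add_apply] at hx
  linarith

/-- Weighted integrability of a function with square summable Jacobi moments. -/
theorem memLp_of_moments (ha : 0 ≤ a) (hb : 0 ≤ b) {u : ℝ → ℝ} (hu : Integrable u volI) {c : ℕ → ℝ}
    (hc : ∀ i, ∫ x in Ioo (0 : ℝ) 1, u x * (jacPoly i a b).eval x = c i * jacNorm i a b)
    (hs : Summable fun i => c i ^ 2 * jacNorm i a b) : MemLp u 2 (weightMeasure (-a) (-b)) := by
  have ha' : -1 < a := by linarith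
  have hb' : -1 < b := by linarith
  obtain ⟨q, hq, hqm⟩ := exists_memLp_of_summable (a := a) (b := b) (γ := fun i => c i * jacNorm i a b)
    ha' hb' (hs.congr fun i => by
      have := (jacNorm_pos ha' hb' i).ne'
      field_simp)
  have hqi := integrable_of_memLp ha' hb' hq
  have hui : Integrable (fun x => weight (-a) (-b) x * u x) (weightMeasure a b) := by
    rw [integrable_weightMeasure_iff]
    refine IntegrableOn.congr_fun hu (fun x hx => ?_) measurableSet_Ioo
    linear_combination (-u x) * weight_neg_mul_weight a b hx
  have hae := jacPoly_complete ha' hb' (hui.sub hqi) fun n => by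
    simp only [Pi.sub_apply, sub_mul]
    rw [integral_sub (integrable_mul_eval hui _) (integrable_mul_eval hqi _),
      integral_weight_neg_mul, hc, hqm, sub_self]
  have hq2 : MemLp (fun x => weight (-a) (-b) x * u x) 2 (weightMeasure a b) := by
    refine hq.ae_eq ?_
    rw [EventuallyEq, ae_weightMeasure]
    filter_upwards [hae] with x hx
    simp only [Pi.sub_apply] at hx
    linarith
  rw [memLp_two_weightMeasure_iff] at hq2 ⊢
  refine ⟨hu.1, hq2.2.congr_fun (fun x hx => ?_) measurableSet_Ioo⟩
  linear_combination (weight (-a) (-b) x * u x ^ 2) * weight_neg_mul_weight a b hx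

theorem continuousOn_primitive_Ico {f : ℝ → ℝ}
    (hf : ∀ x ∈ Ioo (0 : ℝ) 1, IntervalIntegrable f volume 0 x) :
    ContinuousOn (fun x => ∫ y in (0 : ℝ)..x, f y) (Ico 0 1) := by
  intro x hx
  have hy : (x + 1) / 2 ∈ Ioo (0 : ℝ) 1 := ⟨by linarith [hx.1], by linarith [hx.2]⟩
  have h1 := intervalIntegral.continuousOn_primitive_interval' (hf _ hy) left_mem_uIcc
  rw [uIcc_of_le hy.1.le] at h1
  refine (h1 x ⟨hx.1, by linarith [hx.2]⟩).mono_of_mem_nhdsWithin ?_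
  have : Iio ((x + 1) / 2) ∈ 𝓝 x := Iio_mem_nhds (by linarith [hx.2])
  filter_upwards [mem_nhdsWithin_of_mem_nhds this, self_mem_nhdsWithin] with z hz hz'
  exact ⟨hz'.1, le_of_lt hz⟩

variable {β Km KM : ℝ} {s : ℕ} {K f : ℝ → ℝ}

/-- The zeroth relation forces p 0 = A_*, after which every coefficient is prescribed; all solutions
therefore share the same expansion. -/
theorem IsSolution.moments (h : Params α r (α - β) β) (hd : Data (α - β) β s Km KM K f)
    {u : ℝ → ℝ} (hu : IsSolution α β r K f u) (i : ℕ) :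
    ∫ x in Ioo (0 : ℝ) 1, u x * (jacPoly i (α - β) β).eval x =
      coeffC α β K f i * jacNorm i (α - β) β := by
  obtain ⟨p, -, -, hp⟩ := hu.equation
  have hfl : ∀ᵐ x ∂volI, flux α r (deriv u) x = -rhs K f (p 0) x := by
    filter_upwards [hp, fracFlux_ae_eq_flux h (integrable_deriv_of_absCont hu.absCont)] with x h1 h2
    rw [Lop, h2] at h1
    rw [rhs, ← h1, neg_neg]
  obtain ⟨h0, hm⟩ := integral_mul_jacPoly_of_flux h hu.absCont hu.left_bc hu.right_bc hfl
  rw [hm, (hd.integral_rhs_eq_zero_iff h _).1 h0, coeffC_eq h hd]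

theorem exists_isSolution (h : Params α r (α - β) β) (hd : Data (α - β) β s Km KM K f) :
    ∃ u, IsSolution α β r K f u := by
  have hb : -1 < β - 1 := by linarith [h.b_pos]
  have ha : -1 < α - β - 1 := by linarith [h.a_pos]
  set A := constA α β K f with hA
  have h0 := (hd.integral_rhs_eq_zero_iff h A).2 rfl
  have hs := (hd.tsum_jacEnergy_rhs_le h h0).1
  have hs' : Summable fun n : ℕ =>
      (n : ℝ) ^ 2 * jacEnergy n (β - 1) (α - β - 1) (rhs K f A) := by
    refine Summable.of_nonneg_of_le (fun n => mul_nonneg (sq_nonneg _) (jacEnergy_nonneg hb ha _ _))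
      (fun n => mul_le_mul_of_nonneg_right ?_ (jacEnergy_nonneg hb ha _ _)) hs
    cases n with
    | zero => simp
    | succ n =>
      have : (1 : ℝ) ≤ ((n + 1 : ℕ) : ℝ) := by push_cast; linarith [(n.cast_nonneg : (0 : ℝ) ≤ n)]
      gcongr
      exact le_self_pow₀ this (Nat.succ_ne_zero s)
  obtain ⟨u, hu, hu0, hu1, hfl⟩ := exists_flux_eq h (hd.memLp_rhs h A) h0 hs'
  obtain ⟨-, hm⟩ := integral_mul_jacPoly_of_flux h hu hu0 hu1 hfl
  obtain ⟨k, -, hk⟩ := exists_tail_le h s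
  have hfr := fracFlux_ae_eq_flux h (integrable_deriv_of_absCont hu)
  have hui : Integrable u volI := by
    have h2 : ContinuousOn u (Icc 0 1) := by
      have := hu.continuousOn
      rwa [uIcc_of_le zero_le_one] at this
    exact h2.integrableOn_Icc.mono_set Ioo_subset_Icc_self
  refine ⟨u, hu, hu0, hu1, memLp_of_moments h.a_pos.le h.b_pos.le hui hm (hk _ hs).1,
    -- Multiplying the flux equation by K gives this continuous representative; its value at 0 is A
    -- because the integral vanishes there.
    fun x => A - ∫ y in (0 : ℝ)..x, f y,
    continuousOn_const.sub (continuousOn_primitive_Ico hd.integrable), ?_, ?_⟩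
  · filter_upwards [hfl, hfr, ae_volI_mem] with x h1 h2 hx
    have := (hd.K_pos hx).ne'
    rw [h2, h1, Data.rhs_eq]
    field_simp
    ring
  · filter_upwards [hfl, hfr] with x h1 h2
    rw [Lop, h2, h1, neg_neg, intervalIntegral.integral_same, sub_zero, rhs]

theorem exists_error_bound (h : Params α r (α - β) β) (s : ℕ) (hKm : 0 < Km) (KM : ℝ) :
    ∃ C : ℝ, 0 < C ∧ ∀ K f : ℝ → ℝ, Data (α - β) β s Km KM K f →
      ∀ u, IsSolution α β r K f u → ∀ N : ℕ,
        eLpNorm (fun x => u x - uN α β K f N x) 2 volI ≤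
          ENNReal.ofReal (C * wInfNorm (s + 1) (fun x => 1 / K x) /
            ((N : ℝ) + 1) ^ (α + s) * (hNorm s β (α - β) f + 1)) := by
  obtain ⟨k, hk, htail⟩ := exists_tail_le h s
  have hEn : 0 ≤ energyConst s Km KM := by unfold energyConst; positivity
  -- The estimate yields the square of the error with factor kE; using kE ≤ (1+kE)² avoids a square
  -- root and keeps C positive.
  refine ⟨1 + k * energyConst s Km KM, by positivity, fun K f hd u hu N => ?_⟩
  set E := energyConst s Km KM with hE
  set W := wInfNorm (s + 1) (fun x => 1 / K x) with hW
  have hW0 : 0 ≤ W := ENNReal.toReal_nonneg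
  set H := hNorm s β (α - β) f with hH
  have hH0 : 0 ≤ H := Real.sqrt_nonneg _
  have h0 := (hd.integral_rhs_eq_zero_iff h (constA α β K f)).2 rfl
  obtain ⟨hs, hle⟩ := hd.tsum_jacEnergy_rhs_le h h0
  have ht := (htail _ hs).2 N
  simp only [← coeffC_eq h hd] at ht
  set t := ((N : ℝ) + 1) ^ (α + s) with htd
  have htp : 0 < t := Real.rpow_pos_of_pos (by positivity) _
  refine eLpNorm_sub_le h.a_pos.le h.b_pos.le hu.memLp (hu.moments h hd) (N + 1) (by positivity)
    (ht.trans ?_)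
  calc _ ≤ k / t ^ 2 * (E * W ^ 2 * H ^ 2) := mul_le_mul_of_nonneg_left hle (by positivity)
    _ = (k * E) * (W / t * H) ^ 2 := by field_simp
    _ ≤ (1 + k * E) ^ 2 * (W / t * (H + 1)) ^ 2 := by
        have : 0 ≤ k * E := by positivity
        gcongr
        · nlinarith
        · linarith
    _ = _ := by field_simp

end

end FracDiff

end

theorem mainTheorem6 (α β r Km KM : ℝ) (hα₁ : 1 < α) (hα₂ : α < 2)
    (hr₀ : 0 ≤ r) (hr₁ : r ≤ 1) (hβ₁ : α - 1 ≤ β) (hβ₂ : β ≤ 1)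
    (hβ : r = Real.sin (Real.pi * β) /
      (Real.sin (Real.pi * (α - β)) + Real.sin (Real.pi * β)))
    (hKm : 0 < Km) (s : ℕ) :
    ∃ C : ℝ, 0 < C ∧ ∀ K f : ℝ → ℝ,
      (∀ x ∈ Ioo (0 : ℝ) 1, Km ≤ K x ∧ K x ≤ KM) →
      FracDiff.MemWInf (s + 1) (fun x => 1 / K x) →
      FracDiff.MemH s β (α - β) f →
      (∀ x ∈ Ioo (0 : ℝ) 1, IntervalIntegrable f volume 0 x) →
      (∃ u, FracDiff.IsSolution α β r K f u) ∧
      ∀ u, FracDiff.IsSolution α β r K f u → ∀ N : ℕ,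
        eLpNorm (fun x => u x - FracDiff.uN α β K f N x) 2 FracDiff.volI ≤
          ENNReal.ofReal (C * FracDiff.wInfNorm (s + 1) (fun x => 1 / K x) /
            ((N : ℝ) + 1) ^ (α + s) * (FracDiff.hNorm s β (α - β) f + 1)) := by
  have h : FracDiff.Params α r (α - β) β :=
    ⟨hα₁, hα₂, by ring, by linarith, hβ₂, hβ⟩
  obtain ⟨C, hC, hbound⟩ := FracDiff.exists_error_bound h s hKm KM
  refine ⟨C, hC, fun K f hK hW hH hf => ?_⟩
  have hd : FracDiff.Data (α - β) β s Km KM K f := ⟨hKm, hK, hW, hH, hf⟩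
  exact ⟨FracDiff.exists_isSolution h hd, hbound K f hd⟩
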